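/- Logarithms without a base are to base 2. A text of length $n$ over an alphabet of size $\sigma\ge 2$ is a string $T\in\{0,\dots,\sigma-1\}^n$; its suffix array $A$ is the permutation of the positions that lists the suffixes of $T$ in increasing lexicographic order; its LCP-array $H$ has first entry $0$, and for every later index $i$, $H[i]$ is the length of the longest common prefix of the suffixes starting at $A[i-1]$ and $A[i]$. The $k$-th order empirical entropy of $T$ is $H_k(T)=\frac1n\sum_{c\in\{0,\dots,\sigma-1\}^k}|T_c|\,H_0(T_c)$, where $T_c$ is the string of the symbols of $T$ that immediately follow the occurrences of $c$, and $H_0(s)=\sum_{a:\,|s|_a>0}\frac{|s|_a}{|s|}\log\frac{|s|}{|s|_a}$, with $|s|_a$ the number of occurrences of $a$ in $s$ and $H_0=0$ for the empty string. The model is the word-RAM with word width $w$, $n<2^w$, with unit-cost arithmetic, shift and bitwise operations on $w$-bit words, in which an entry of $A$ can be retrieved in time $t_A$. **Corollary.** Let $0<\delta\le 1$. There are a query program, a data structure (a bit string $D(T)$ for every text $T$ and every word width) and constants $C$, $n_0$, depending only on $\delta$, such that the following holds for every text $T$ of length $n\ge n_0$ over an alphabet of size $\sigma\ge 2$, every $w$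 with $n<2^w$, and every $t_A$. 1. Space: simultaneously for all $k\ge 0$ (in particular for all $k=o(\log_\sigma n)$), the number of bits of $D(T)$ is at most $$nH_k(T)+C\left(\frac{n(k\log\sigma+\log\log n)}{\log_\sigma n}+\frac{n}{\log\log n}\right).$$ 2. Time: given $D(T)$ in memory and access to $A$ in time $t_A$ per entry, the program computes any entry $H[i]$ of the LCP-array in time at most $C\,(t_A+\log^\delta n)$. In other words, the LCP-array can be stored in $nH_k+O\!\left(\frac{n(k\log\sigma+\log\log n)}{\log_\sigma n}+\frac{n}{\log\log n}\right)$ bits in addition to the suffix array, simultaneously over all $k=o(\log_\sigma n)$, while its entries can be accessed in $O(t_A+\log^\delta n)$ time, for an arbitrary constant $0<\delta\le 1$. -/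

import Mathlib

namespace WeeLCP

/-! ### Texts, suffix arrays and LCP-arrays

A text of length `n` over an ordered alphabet of size `σ` is a map `T : Fin n → Fin σ`.
Positions and array indices are counted from `0`. -/

/-- The suffix of `T` that starts at position `i`. -/
def suffix {n σ : ℕ} (T : Fin n → Fin σ) (i : Fin n) : List (Fin σ) :=
  (List.ofFn T).drop i

theorem suffix_injective {n σ : ℕ} (T : Fin n → Fin σ) : Function.Injective (suffix T) := by
  intro i j h
  have h1 := congrArg List.length h
  simp only [suffix, List.length_drop, List.length_ofFn] at h1
  apply Fin.ext
  have := i.isLt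
  have := j.isLt
  omega

/-- The suffix array: the permutation of the positions of `T` that lists the suffixes in
lexicographic order (a proper prefix of a string is smaller than the string). -/
def suffixArray {n σ : ℕ} (T : Fin n → Fin σ) : Equiv.Perm (Fin n) :=
  Tuple.sort (suffix T)

theorem suffixArray_strictMono {n σ : ℕ} (T : Fin n → Fin σ) :
    StrictMono fun i => suffix T (suffixArray T i) :=
  (Tuple.monotone_sort (suffix T)).strictMono_of_injective
    ((suffix_injective T).comp (suffixArray T).injective)

/-- The length of the longest common prefix of two strings. -/
def lcp {α : Type*} [DecidableEq α] : List α → List α → ℕ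
  | a :: l, b :: m => if a = b then lcp l m + 1 else 0
  | _, _ => 0

theorem lcp_isGreatest {α : Type*} [DecidableEq α] (l m : List α) :
    IsGreatest {k | ∃ p : List α, p.length = k ∧ p <+: l ∧ p <+: m} (lcp l m) := by
  induction l generalizing m with
  | nil =>
    refine ⟨⟨[], by simp [lcp], by simp, by simp⟩, ?_⟩
    rintro k ⟨p, rfl, h1, -⟩
    simp [List.prefix_nil.mp h1]
  | cons a l ih =>
    cases m with
    | nil =>
      refine ⟨⟨[], by simp [lcp], by simp, by simp⟩, ?_⟩
      rintro k ⟨p, rfl, -, h1⟩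
      simp [List.prefix_nil.mp h1]
    | cons b m =>
      by_cases hab : a = b
      · subst hab
        obtain ⟨⟨p, hp, h1, h2⟩, hub⟩ := ih m
        refine ⟨⟨a :: p, by simp [lcp, hp], by simpa using h1, by simpa using h2⟩, ?_⟩
        rintro k ⟨q, rfl, h3, h4⟩
        cases q with
        | nil => simp
        | cons c q =>
          rw [List.cons_prefix_cons] at h3 h4
          have := hub ⟨q, rfl, h3.2, h4.2⟩
          simpa [lcp] using this
      · refine ⟨⟨[], by simp [lcp, hab], by simp, by simp⟩, ?_⟩
        rintro k ⟨q, rfl, h3, h4⟩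
        cases q with
        | nil => simp
        | cons c q =>
          rw [List.cons_prefix_cons] at h3 h4
          exact absurd (h3.1.symm.trans h4.1) hab

/-- The LCP-array: entry `0` is `0`, and entry `i > 0` is the length of the longest common
prefix of the suffixes of ranks `i - 1` and `i`. -/
def lcpArray {n σ : ℕ} (T : Fin n → Fin σ) : Fin n → ℕ
  | ⟨0, _⟩ => 0
  | ⟨m + 1, h⟩ =>
    lcp (suffix T (suffixArray T ⟨m, Nat.lt_of_succ_lt h⟩)) (suffix T (suffixArray T ⟨m + 1, h⟩))

/-! ### Empirical entropy -/

/-- Zeroth-order empirical entropy of a string, in bits per symbol: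
`∑ₐ (nₐ / |s|) log₂ (|s| / nₐ)` where `nₐ` is the number of occurrences of `a` in `s`.
Symbols that do not occur contribute `0`, and the empty string has entropy `0`. -/
noncomputable def entropyZero {σ : ℕ} (s : List (Fin σ)) : ℝ :=
  ∑ a : Fin σ, ((s.count a : ℝ) / s.length) * Real.logb 2 ((s.length : ℝ) / s.count a)

/-- The symbols of `T`, from left to right, that are immediately preceded by the string `c`. -/
def followers {n σ k : ℕ} (T : Fin n → Fin σ) (c : Fin k → Fin σ) : List (Fin σ) :=
  ((List.finRange n).filter
    fun i : Fin n => decide (List.ofFn c <:+ (List.ofFn T).take i)).map T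

/-- `k`-th order empirical entropy `H_k(T) = (1/n) ∑_{c ∈ Σ^k} |T_c| H_0(T_c)`, where `T_c` is
the string of the symbols that follow the occurrences of `c` in `T`. -/
noncomputable def entropy {n σ : ℕ} (T : Fin n → Fin σ) (k : ℕ) : ℝ :=
  (∑ c : Fin k → Fin σ, ((followers T c).length : ℝ) * entropyZero (followers T c)) / n

/-! ### The word-RAM

Programs work on registers that hold `w`-bit words. They read a data structure, which is a
string of bits packed into `w`-bit memory words, and they may ask for entries of the suffix
array. Programs are structured (sequence, branch, loop) and do not write to the data
structure; both only restrict the usual machine, which runs them with constant overhead.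
A program is a finite object that does not depend on the word width. -/

/-- The arithmetic and logical operations on words. -/
inductive Op
  | add | sub | mul | div | mod | and | or | xor | shl | shr

/-- Arithmetic is modulo `2 ^ w`; division and remainder are unsigned. -/
def Op.eval {w : ℕ} : Op → BitVec w → BitVec w → BitVec w
  | .add, x, y => x + y
  | .sub, x, y => x - y
  | .mul, x, y => x * y
  | .div, x, y => x / y
  | .mod, x, y => x % y
  | .and, x, y => x &&& y
  | .or, x, y => x ||| y
  | .xor, x, y => x ^^^ y
  | .shl, x, y => x <<< y
  | .shr, x, y => x >>> y

/-- Programs; the numbers `d`, `a`, `b` are names of registers. -/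
inductive Program
  /-- do nothing -/
  | skip
  /-- `d := c mod 2 ^ w` -/
  | const (d c : ℕ)
  /-- `d := a o b` -/
  | op (o : Op) (d a b : ℕ)
  /-- `d :=` the memory word at address `a` -/
  | load (d a : ℕ)
  /-- `d :=` entry number `a` of the suffix array -/
  | access (d a : ℕ)
  /-- `p`, then `q` -/
  | seq (p q : Program)
  /-- if `a < b` (unsigned) then `p` else `q` -/
  | ifLt (a b : ℕ) (p q : Program)
  /-- while `a < b` (unsigned) do `p` -/
  | whileLt (a b : ℕ) (p : Program)

/-- The contents of the registers. -/
abbrev Regs (w : ℕ) := ℕ → BitVec w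

/-- What a program can read: the memory, the suffix array, and the time for one access to the
suffix array. -/
structure Env (w : ℕ) where
  mem : BitVec w → BitVec w
  sa : BitVec w → BitVec w
  tA : ℕ

/-- `Exec E p r r' t`: in the environment `E`, the program `p`, started with registers `r`,
terminates with registers `r'` after time `t`. Every operation, every load and every evaluation
of a test takes one unit of time; an access to the suffix array takes `E.tA` units. -/
inductive Exec {w : ℕ} (E : Env w) : Program → Regs w → Regs w → ℕ → Prop
  | skip (r : Regs w) : Exec E .skip r r 1
  | const (r : Regs w) (d c : ℕ) :
      Exec E (.const d c) r (Function.update r d (BitVec.ofNat w c)) 1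
  | op (r : Regs w) (o : Op) (d a b : ℕ) :
      Exec E (.op o d a b) r (Function.update r d (o.eval (r a) (r b))) 1
  | load (r : Regs w) (d a : ℕ) :
      Exec E (.load d a) r (Function.update r d (E.mem (r a))) 1
  | access (r : Regs w) (d a : ℕ) :
      Exec E (.access d a) r (Function.update r d (E.sa (r a))) E.tA
  | seq {p q : Program} {r r' r'' : Regs w} {t t' : ℕ} :
      Exec E p r r' t → Exec E q r' r'' t' → Exec E (.seq p q) r r'' (t + t')
  | ifTrue {a b : ℕ} {p q : Program} {r r' : Regs w} {t : ℕ} :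
      r a < r b → Exec E p r r' t → Exec E (.ifLt a b p q) r r' (t + 1)
  | ifFalse {a b : ℕ} {p q : Program} {r r' : Regs w} {t : ℕ} :
      ¬ r a < r b → Exec E q r r' t → Exec E (.ifLt a b p q) r r' (t + 1)
  | whileTrue {a b : ℕ} {p : Program} {r r' r'' : Regs w} {t t' : ℕ} :
      r a < r b → Exec E p r r' t → Exec E (.whileLt a b p) r' r'' t' →
        Exec E (.whileLt a b p) r r'' (t + t' + 1)
  | whileFalse {a b : ℕ} {p : Program} {r : Regs w} :
      ¬ r a < r b → Exec E (.whileLt a b p) r r 1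

/-- The machine is deterministic: result and running time are unique. -/
theorem Exec.deterministic {w : ℕ} {E : Env w} {p : Program} {r r₁ r₂ : Regs w} {t₁ t₂ : ℕ}
    (h₁ : Exec E p r r₁ t₁) (h₂ : Exec E p r r₂ t₂) : r₁ = r₂ ∧ t₁ = t₂ := by
  induction h₁ generalizing r₂ t₂ with
  | skip | const | op | load | access => cases h₂; exact ⟨rfl, rfl⟩
  | seq _ _ ih ih' =>
    cases h₂ with
    | seq g g' =>
      obtain ⟨rfl, rfl⟩ := ih g
      obtain ⟨rfl, rfl⟩ := ih' g'
      exact ⟨rfl, rfl⟩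
  | ifTrue h _ ih =>
    cases h₂ with
    | ifTrue _ g => obtain ⟨rfl, rfl⟩ := ih g; exact ⟨rfl, rfl⟩
    | ifFalse h' _ => exact absurd h h'
  | ifFalse h _ ih =>
    cases h₂ with
    | ifTrue h' _ => exact absurd h' h
    | ifFalse _ g => obtain ⟨rfl, rfl⟩ := ih g; exact ⟨rfl, rfl⟩
  | whileTrue h _ _ ih ih' =>
    cases h₂ with
    | whileTrue _ g g' =>
      obtain ⟨rfl, rfl⟩ := ih g
      obtain ⟨rfl, rfl⟩ := ih' g'
      exact ⟨rfl, rfl⟩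
    | whileFalse h' => exact absurd h h'
  | whileFalse h =>
    cases h₂ with
    | whileTrue h' _ _ => exact absurd h' h
    | whileFalse _ => exact ⟨rfl, rfl⟩

/-- A bit string packed into `w`-bit memory words: bit `j` of the word at address `a` is bit
`a * w + j` of the string; everything behind the end of the string is `0`. -/
def memory (w : ℕ) (D : List Bool) (a : BitVec w) : BitVec w :=
  BitVec.ofFnLE fun j : Fin w => D.getD (a.toNat * w + j) false

/-- The suffix array as an array of words (out-of-range accesses return `0`). -/
def suffixArrayWords (w : ℕ) {n σ : ℕ} (T : Fin n → Fin σ) (x : BitVec w) : BitVec w :=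
  if h : x.toNat < n then BitVec.ofNat w (suffixArray T ⟨x.toNat, h⟩) else 0

/-- The registers at the start of query `i`: register `0` holds `i`, register `1` the length `n`
of the text, register `2` the word width `w`; all others hold `0`. -/
def initRegs (w n i : ℕ) : Regs w
  | 0 => BitVec.ofNat w i
  | 1 => BitVec.ofNat w n
  | 2 => BitVec.ofNat w w
  | _ => 0

/-- `Answers P w T D tA i v t`: on the word-RAM of width `w`, given the data structure `D` and
the suffix array of `T` with access time `tA`, the program `P` answers query `i` with `v` (in
register `0`) after time exactly `t`. -/
def Answers (P : Program) (w : ℕ) {n σ : ℕ} (T : Fin n → Fin σ) (D : List Bool)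
    (tA i v t : ℕ) : Prop :=
  ∃ r : Regs w, Exec ⟨memory w D, suffixArrayWords w T, tA⟩ P (initRegs w n i) r t ∧
    (r 0).toNat = v

end WeeLCP

/-!
The values of the LCP-array are stored in text order: by the classical argument of Kasai et al.,
`Φ(p) = LCP-value of the suffix at p, plus p` is monotone in the text position `p` and at most `n`
(`phi_mono`, `phi_le`). A query for entry `i` retrieves `p = A[i]` and `q = A[i - 1]` and has to find
`Φ(p) - p`.

Let `b` be about `¼ log_σ n` and `s = ⌈log^δ n⌉`. The function `Φ` is sampled at every `s`-th
position. Over an `s`-block in which `Φ` grows by at least `s * b` all its values are stored; by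
monotonicity there are at most `n / (s * b)` such blocks, with `n / b` values in total
(`Par.sum_numLarge_mul_le`). In any other block the samples leave a gap of less than `s * b` between
a lower and an upper bound of the LCP-value (`Par.Ok.wp_phi`), and the suffixes at `p` and `q` are
compared directly from the lower bound on. The text is stored for this purpose in blocks of `b`
symbols, each given by an identifier; a table indexed by two identifiers and two offsets tells how
far the two blocks agree. Every round of the comparison either finds a mismatch or reaches the end
of a block in one of the suffixes, so that `O(s)` rounds are enough (`Par.variant`,
`Par.variant_le`, `Par.Ok.wp_loop_body`).

The identifiers are at most `σ ^ b ≤ n ^ (1/4)`, so the table has `o(n / log n)` bits. The identifier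
of a block is its rank by frequency, and its codeword is the binary representation of the
identifier without the leading one. The length of this codeword is at most the logarithm of the
inverse relative frequency (`exists_rank`), and by Gibbs' inequality (`sum_log_le`) the total length
is at most the ideal code length under any probability distribution on the blocks. One such
distribution spends `log σ` bits on each of the first `k` symbols of a block and predicts every
other symbol from its `k` predecessors (`exists_blockProb`), which gives the bound
`n H_k + (n / b) k log σ` for all `k` at once (`exists_code`). Codewords need no delimiters because
there are pointers to all of them.

Samples, explicit values and pointers are relative to superblocks of `b * s * log² n` positions and
take `g = O(log log n)` bits each. Only if `Φ` grows by `2 ^ g` or more over a superblock does that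
superblock use fields of `O(log n)` bits, and this happens at most `n / 2 ^ g` times
(`Par.card_bigSupers_mul_le`). Over all superblocks this amounts to
`O(n log log n / s + n log log n / b)` bits, and the first term is `O(n / log log n)` because
`(log log n)² ≤ log^δ n` for large `n`.

When `n < σ ^ 4`, the claimed space is at least of order `n log log n`, and all values of `Φ` are
stored explicitly, with `b = s = 1` and without the text.

The query program is assembled from expressions over registers (`Ex`), whose evaluation on the
machine is verified once (`Ex.exec_code`), and a small logic for total correctness with running
times (`WP`).
-/

namespace WeeLCP

/-! ### Arithmetic -/

theorem two_mul_le_two_pow {w : ℕ} (hw : 4 ≤ w) : 2 * w + 2 ≤ 2 ^ w := by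
  induction w, hw using Nat.le_induction with
  | base => norm_num
  | succ k hk ih => rw [pow_succ]; omega

/-- If the lowest one of a binary number is bit `k`, then `N` and `N - 1` differ exactly in the bits
up to `k`. -/
theorem testBit_xor_pred {N k : ℕ} (h1 : ∀ j < k, N.testBit j = false) (h2 : N.testBit k = true) :
    N ^^^ (N - 1) = 2 ^ (k + 1) - 1 := by
  have e1 : N % 2 ^ (k + 1) = 2 ^ k := by
    apply Nat.eq_of_testBit_eq
    intro j
    rw [Nat.testBit_mod_two_pow, Nat.testBit_two_pow]
    rcases lt_trichotomy j k with hj | hj | hj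
    · simp [h1 j hj, hj.ne']
    · subst hj; simp [h2]
    · simp [hj.ne]; omega
  have hk : 0 < 2 ^ k := by positivity
  have hk1 : 2 ^ (k + 1) = 2 * 2 ^ k := by ring
  have hk2 : 2 ^ k < 2 ^ (k + 1) := by omega
  have e2 : N = 2 ^ (k + 1) * (N / 2 ^ (k + 1)) + 2 ^ k := by
    conv_lhs => rw [← Nat.div_add_mod N (2 ^ (k + 1)), e1]
  have e3 : N - 1 = 2 ^ (k + 1) * (N / 2 ^ (k + 1)) + (2 ^ k - 1) := by omega
  apply Nat.eq_of_testBit_eq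
  intro j
  rw [Nat.testBit_xor, e3]
  conv_lhs => rw [e2]
  have e4 : 2 ^ (k + 1) * (N / 2 ^ (k + 1)) / 2 ^ (k + 1) = N / 2 ^ (k + 1) :=
    Nat.mul_div_cancel_left _ (by positivity)
  have e5 : (2 ^ (k + 1) * (N / 2 ^ (k + 1)) + 2 ^ k) / 2 ^ (k + 1) = N / 2 ^ (k + 1) := by
    rw [Nat.mul_add_div (by positivity), Nat.div_eq_of_lt hk2, Nat.add_zero]
  rw [e5, Nat.testBit_two_pow_mul_add _ (by omega), Nat.testBit_two_pow_mul_add _ (by omega),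
    Nat.testBit_two_pow_sub_one]
  by_cases hj : j < k + 1
  · simp only [hj, if_true, Nat.testBit_two_pow, Nat.testBit_two_pow_sub_one, decide_true]
    rcases Nat.lt_succ_iff_lt_or_eq.mp hj with h | h
    · simp [h, h.ne']
    · simp [h]
  · simp [hj]

theorem div_add_sub_mod {x b : ℕ} (hb : 0 < b) : (x + (b - x % b)) / b = x / b + 1 := by
  have h1 := Nat.div_add_mod x b
  have h2 := Nat.mod_lt x hb
  have h3 : x + (b - x % b) = (x / b + 1) * b := by
    rw [Nat.add_mul, Nat.one_mul, Nat.mul_comm]; omega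
  rw [h3, Nat.mul_div_cancel _ hb]

theorem two_pow_size_le {R : ℕ} (hR : 0 < R) : 2 ^ R.size ≤ 2 * R := by
  have h1 : 0 < R.size := Nat.size_pos.mpr hR
  have h2 : 2 ^ (R.size - 1) ≤ R := Nat.lt_size.mp (by omega)
  calc 2 ^ R.size = 2 * 2 ^ (R.size - 1) := by rw [← pow_succ']; congr 1; omega
    _ ≤ _ := by omega

/-! ### Expressions on the word-RAM -/

/-- Side-effect free expressions over registers, constants and memory words. -/
inductive Ex
  | reg (k : ℕ)
  | lit (c : ℕ)
  | bin (o : Op) (x y : Ex)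
  | ld (x : Ex)

namespace Ex

instance : Add Ex := ⟨bin .add⟩
instance : Sub Ex := ⟨bin .sub⟩
instance : Mul Ex := ⟨bin .mul⟩
instance : Div Ex := ⟨bin .div⟩
instance : Mod Ex := ⟨bin .mod⟩

/-- The word denoted by an expression. -/
def eval {w : ℕ} (E : Env w) (r : Regs w) : Ex → BitVec w
  | reg k => r k
  | lit c => BitVec.ofNat w c
  | bin o x y => o.eval (x.eval E r) (y.eval E r)
  | ld x => E.mem (x.eval E r)

/-- Code that leaves the value of the expression in register `d`, with the registers from `d` on
as an evaluation stack. -/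
def code : Ex → ℕ → Program
  | reg k, d => .op .or d k k
  | lit c, d => .const d c
  | bin o x y, d => .seq (x.code d) (.seq (y.code (d + 1)) (.op o d d (d + 1)))
  | ld x, d => .seq (x.code d) (.load d d)

/-- All registers that occur in the expression are smaller than `d`. -/
def Below (d : ℕ) : Ex → Prop
  | reg k => k < d
  | lit _ => True
  | bin _ x y => x.Below d ∧ y.Below d
  | ld x => x.Below d

end Ex

/-- An upper bound for the running time of a loop-free program, not counting its accesses to the
suffix array. -/
def Program.cost : Program → ℕ
  | .seq p q => p.cost + q.cost
  | .ifLt _ _ p q => p.cost + q.cost + 1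
  | _ => 1

theorem Ex.Below.mono {d d' : ℕ} (h : d ≤ d') : ∀ {e : Ex}, e.Below d → e.Below d'
  | .reg _, he => lt_of_lt_of_le he h
  | .lit _, _ => trivial
  | .bin _ _ _, he => ⟨he.1.mono h, he.2.mono h⟩
  | .ld x, he => Ex.Below.mono (e := x) h he

theorem Ex.eval_congr {w : ℕ} {E : Env w} {r r' : Regs w} {d : ℕ} (h : ∀ k < d, r' k = r k) :
    ∀ {e : Ex}, e.Below d → e.eval E r' = e.eval E r
  | .reg _, he => h _ he
  | .lit _, _ => rfl
  | .bin _ _ _, he => by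
    simp only [Ex.eval, Ex.eval_congr h he.1, Ex.eval_congr h he.2]
  | .ld x, he => by
    simp only [Ex.eval, Ex.eval_congr (e := x) h he]

theorem Ex.exec_code {w : ℕ} (E : Env w) (e : Ex) : ∀ (d : ℕ) (r : Regs w), e.Below d →
    ∃ r', Exec E (e.code d) r r' (e.code d).cost ∧ r' d = e.eval E r ∧ ∀ k < d, r' k = r k := by
  induction e with
  | reg k =>
    intro d r _
    refine ⟨_, .op r .or d k k, ?_, fun j hj => ?_⟩
    · simp [Op.eval, Ex.eval]
    · simp [Function.update_of_ne hj.ne]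
  | lit c =>
    intro d r _
    refine ⟨_, .const r d c, ?_, fun j hj => ?_⟩
    · simp [Ex.eval]
    · simp [Function.update_of_ne hj.ne]
  | bin o x y ihx ihy =>
    intro d r he
    obtain ⟨r₁, h₁, hv₁, hk₁⟩ := ihx d r he.1
    obtain ⟨r₂, h₂, hv₂, hk₂⟩ := ihy (d + 1) r₁ (he.2.mono (Nat.le_succ d))
    refine ⟨_, .seq h₁ (.seq h₂ (.op r₂ o d d (d + 1))), ?_, fun j hj => ?_⟩
    · simp only [Function.update_self, Ex.eval]
      rw [hv₂, hk₂ d (Nat.lt_succ_self d), hv₁, Ex.eval_congr hk₁ he.2]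
    · rw [Function.update_of_ne hj.ne, hk₂ j (by omega), hk₁ j hj]
  | ld x ih =>
    intro d r he
    obtain ⟨r₁, h₁, hv₁, hk₁⟩ := ih d r he
    refine ⟨_, .seq h₁ (.load r₁ d d), ?_, fun j hj => ?_⟩
    · simp [Ex.eval, hv₁]
    · rw [Function.update_of_ne hj.ne, hk₁ j hj]

/-! ### Program logic -/

/-- The variables of a program are the registers below `40`; the registers from `40` on are
scratch space for the evaluation of expressions. `Rep r ρ` says that the variables have the
values `ρ`, as natural numbers. -/
def Rep {w : ℕ} (r : Regs w) (ρ : ℕ → ℕ) : Prop := ∀ k < 40, (r k).toNat = ρ k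

/-- The expression `e` evaluates to the number `x` when the variables have the values `ρ`. -/
def Ev {w : ℕ} (E : Env w) (ρ : ℕ → ℕ) (e : Ex) (x : ℕ) : Prop :=
  e.Below 40 ∧ ∀ r, Rep r ρ → (e.eval E r).toNat = x

/-- Total correctness: started with the variables `ρ`, the program ends within time `t`, with
variables that satisfy `Q`. -/
def WP {w : ℕ} (E : Env w) (p : Program) (t : ℕ) (Q : (ℕ → ℕ) → Prop) (ρ : ℕ → ℕ) : Prop :=
  ∀ r, Rep r ρ → ∃ r' t' ρ', t' ≤ t ∧ Exec E p r r' t' ∧ Rep r' ρ' ∧ Q ρ'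

/-- The assignment `v := e`. -/
def asg (v : ℕ) (e : Ex) : Program := .seq (e.code 40) (.op .or v 40 40)

/-- The assignment `v := A[e]`, where `A` is the suffix array. -/
def acc (v : ℕ) (e : Ex) : Program := .seq (e.code 40) (.access v 40)

section Logic

variable {w : ℕ} {E : Env w} {ρ : ℕ → ℕ}

theorem Ev.reg {k x : ℕ} (hk : k < 40) (h : ρ k = x) : Ev E ρ (.reg k) x :=
  ⟨hk, fun r hr => by rw [← h]; exact hr k hk⟩

theorem Ev.num {c : ℕ} (h : c < 2 ^ w) : Ev E ρ (.lit c) c :=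
  ⟨trivial, fun r _ => by
    change (BitVec.ofNat w c).toNat = c
    simp [Nat.mod_eq_of_lt h]⟩

theorem Ev.add {a b : Ex} {x y : ℕ} (ha : Ev E ρ a x) (hb : Ev E ρ b y) (h : x + y < 2 ^ w) :
    Ev E ρ (a + b) (x + y) :=
  ⟨⟨ha.1, hb.1⟩, fun r hr => by
    change (Op.eval .add (a.eval E r) (b.eval E r)).toNat = _
    simp [Op.eval, ha.2 r hr, hb.2 r hr, Nat.mod_eq_of_lt h]⟩

theorem Ev.sub {a b : Ex} {x y : ℕ} (ha : Ev E ρ a x) (hb : Ev E ρ b y) (h : y ≤ x) :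
    Ev E ρ (a - b) (x - y) :=
  ⟨⟨ha.1, hb.1⟩, fun r hr => by
    change (Op.eval .sub (a.eval E r) (b.eval E r)).toNat = _
    simp only [Op.eval]
    rw [BitVec.toNat_sub_of_le (by rw [BitVec.le_def, ha.2 r hr, hb.2 r hr]; exact h),
      ha.2 r hr, hb.2 r hr]⟩

theorem Ev.mul {a b : Ex} {x y : ℕ} (ha : Ev E ρ a x) (hb : Ev E ρ b y) (h : x * y < 2 ^ w) :
    Ev E ρ (a * b) (x * y) :=
  ⟨⟨ha.1, hb.1⟩, fun r hr => by
    change (Op.eval .mul (a.eval E r) (b.eval E r)).toNat = _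
    simp [Op.eval, ha.2 r hr, hb.2 r hr, Nat.mod_eq_of_lt h]⟩

theorem Ev.div {a b : Ex} {x y : ℕ} (ha : Ev E ρ a x) (hb : Ev E ρ b y) :
    Ev E ρ (a / b) (x / y) :=
  ⟨⟨ha.1, hb.1⟩, fun r hr => by
    change (Op.eval .div (a.eval E r) (b.eval E r)).toNat = _
    simp [Op.eval, ha.2 r hr, hb.2 r hr]⟩

theorem Ev.mod {a b : Ex} {x y : ℕ} (ha : Ev E ρ a x) (hb : Ev E ρ b y) :
    Ev E ρ (a % b) (x % y) :=
  ⟨⟨ha.1, hb.1⟩, fun r hr => by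
    change (Op.eval .mod (a.eval E r) (b.eval E r)).toNat = _
    simp [Op.eval, ha.2 r hr, hb.2 r hr]⟩

theorem Ev.xor {a b : Ex} {x y : ℕ} (ha : Ev E ρ a x) (hb : Ev E ρ b y) :
    Ev E ρ (.bin .xor a b) (x ^^^ y) :=
  ⟨⟨ha.1, hb.1⟩, fun r hr => by
    simp [Ex.eval, Op.eval, ha.2 r hr, hb.2 r hr]⟩

theorem Ev.shl {a b : Ex} {x y : ℕ} (ha : Ev E ρ a x) (hb : Ev E ρ b y) (h : x * 2 ^ y < 2 ^ w) :
    Ev E ρ (.bin .shl a b) (x * 2 ^ y) :=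
  ⟨⟨ha.1, hb.1⟩, fun r hr => by
    simp only [Ex.eval, Op.eval]
    rw [BitVec.shiftLeft_eq', BitVec.toNat_shiftLeft, ha.2 r hr, hb.2 r hr, Nat.shiftLeft_eq,
      Nat.mod_eq_of_lt h]⟩

theorem Ev.ld {a : Ex} {x : ℕ} (ha : Ev E ρ a x) :
    Ev E ρ (.ld a) (E.mem (BitVec.ofNat w x)).toNat :=
  ⟨ha.1, fun r hr => by
    rw [Ex.eval, ← ha.2 r hr]; simp⟩

theorem Ev.cast {e : Ex} {x y : ℕ} (h : Ev E ρ e x) (hxy : x = y) : Ev E ρ e y := hxy ▸ h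

theorem Rep.update {r : Regs w} {v x : ℕ} {y : BitVec w} (hr : ∀ k < 40, k ≠ v → (r k).toNat = ρ k)
    (hy : y.toNat = x) : Rep (Function.update r v y) (Function.update ρ v x) := by
  intro k hk
  by_cases hkv : k = v
  · subst hkv; simp [hy]
  · simp [Function.update_of_ne hkv, hr k hk hkv]

theorem WP.mono {p : Program} {t t' : ℕ} {Q Q' : (ℕ → ℕ) → Prop} (h : WP E p t Q ρ)
    (ht : t ≤ t') (hQ : ∀ ρ', Q ρ' → Q' ρ') : WP E p t' Q' ρ := by
  intro r hr
  obtain ⟨r', t₁, ρ', h1, h2, h3, h4⟩ := h r hr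
  exact ⟨r', t₁, ρ', h1.trans ht, h2, h3, hQ _ h4⟩

theorem WP.seq {p q : Program} {t t' : ℕ} {Q : (ℕ → ℕ) → Prop}
    (h : WP E p t (fun ρ' => WP E q t' Q ρ') ρ) : WP E (.seq p q) (t + t') Q ρ := by
  intro r hr
  obtain ⟨r₁, t₁, ρ₁, h1, h2, h3, h4⟩ := h r hr
  obtain ⟨r₂, t₂, ρ₂, g1, g2, g3, g4⟩ := h4 r₁ h3
  exact ⟨r₂, t₁ + t₂, ρ₂, by omega, .seq h2 g2, g3, g4⟩

theorem WP.skip {Q : (ℕ → ℕ) → Prop} (h : Q ρ) : WP E .skip 1 Q ρ :=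
  fun r hr => ⟨r, 1, ρ, le_rfl, .skip r, hr, h⟩

theorem WP.asg {v x : ℕ} {e : Ex} {Q : (ℕ → ℕ) → Prop} (he : Ev E ρ e x)
    (h : Q (Function.update ρ v x)) : WP E (asg v e) (asg v e).cost Q ρ := by
  intro r hr
  obtain ⟨r₁, h1, h2, h3⟩ := e.exec_code E 40 r he.1
  refine ⟨_, _, _, le_rfl, .seq h1 (.op r₁ .or v 40 40), Rep.update (fun k hk _ => ?_) ?_, h⟩
  · rw [h3 k hk, hr k hk]
  · simp [Op.eval, h2, he.2 r hr]

theorem WP.acc {v x : ℕ} {e : Ex} {Q : (ℕ → ℕ) → Prop} (he : Ev E ρ e x)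
    (h : Q (Function.update ρ v (E.sa (BitVec.ofNat w x)).toNat)) :
    WP E (acc v e) ((acc v e).cost + E.tA) Q ρ := by
  intro r hr
  obtain ⟨r₁, h1, h2, h3⟩ := e.exec_code E 40 r he.1
  refine ⟨_, _, _, ?_, .seq h1 (.access r₁ v 40), Rep.update (fun k hk _ => ?_) ?_, h⟩
  · simp [WeeLCP.acc, Program.cost]
  · rw [h3 k hk, hr k hk]
  · rw [h2, ← he.2 r hr]; simp

theorem WP.ifLt {a b : ℕ} {p q : Program} {t t' : ℕ} {Q : (ℕ → ℕ) → Prop} (ha : a < 40)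
    (hb : b < 40) (h1 : ρ a < ρ b → WP E p t Q ρ) (h2 : ¬ ρ a < ρ b → WP E q t' Q ρ) :
    WP E (.ifLt a b p q) (t + t' + 1) Q ρ := by
  intro r hr
  by_cases h : ρ a < ρ b
  · obtain ⟨r₁, t₁, ρ₁, g1, g2, g3, g4⟩ := h1 h r hr
    refine ⟨r₁, _, ρ₁, ?_, .ifTrue ?_ g2, g3, g4⟩
    · omega
    · rw [BitVec.lt_def, hr a ha, hr b hb]; exact h
  · obtain ⟨r₁, t₁, ρ₁, g1, g2, g3, g4⟩ := h2 h r hr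
    refine ⟨r₁, _, ρ₁, ?_, .ifFalse ?_ g2, g3, g4⟩
    · omega
    · rw [BitVec.lt_def, hr a ha, hr b hb]; exact h

/-- The sequential composition of a list of programs. -/
def block : List Program → Program
  | [] => .skip
  | p :: l => .seq p (block l)

theorem WP.nil {Q : (ℕ → ℕ) → Prop} (h : Q ρ) : WP E (block []) (block []).cost Q ρ := WP.skip h

theorem WP.cons {p : Program} {l : List Program} {Q : (ℕ → ℕ) → Prop}
    (h : WP E p p.cost (fun ρ' => WP E (block l) (block l).cost Q ρ') ρ) :
    WP E (block (p :: l)) (block (p :: l)).cost Q ρ := WP.seq h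

theorem WP.asg_cons {v x : ℕ} {e : Ex} {l : List Program} {Q : (ℕ → ℕ) → Prop} (he : Ev E ρ e x)
    (h : WP E (block l) (block l).cost Q (Function.update ρ v x)) :
    WP E (block (WeeLCP.asg v e :: l)) (block (WeeLCP.asg v e :: l)).cost Q ρ :=
  WP.cons (WP.asg he h)

/-- Loop rule: every round takes time at most `c` and decreases the variant `m`. -/
theorem WP.whileLt {a b : ℕ} {p : Program} {c : ℕ} (I : (ℕ → ℕ) → Prop) (m : (ℕ → ℕ) → ℕ)
    (ha : a < 40) (hb : b < 40)
    (hp : ∀ ρ, I ρ → ρ a < ρ b → WP E p c (fun ρ' => I ρ' ∧ m ρ' < m ρ) ρ) (h : I ρ) :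
    WP E (.whileLt a b p) (m ρ * (c + 1) + 1) (fun ρ' => I ρ' ∧ ¬ ρ' a < ρ' b) ρ := by
  induction hm : m ρ using Nat.strong_induction_on generalizing ρ with
  | _ k ih =>
    intro r hr
    by_cases hlt : ρ a < ρ b
    · obtain ⟨r₁, t₁, ρ₁, g1, g2, g3, g4, g5⟩ := hp ρ h hlt r hr
      obtain ⟨r₂, t₂, ρ₂, k1, k2, k3, k4⟩ := ih (m ρ₁) (hm ▸ g5) g4 rfl r₁ g3
      refine ⟨r₂, _, ρ₂, ?_, .whileTrue ?_ g2 k2, k3, k4⟩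
      · have : (m ρ₁ + 1) * (c + 1) ≤ k * (c + 1) := Nat.mul_le_mul_right _ (by omega)
        rw [Nat.add_mul] at this
        omega
      · rw [BitVec.lt_def, hr a ha, hr b hb]; exact hlt
    · refine ⟨r, 1, ρ, by omega, .whileFalse ?_, hr, h, hlt⟩
      rw [BitVec.lt_def, hr a ha, hr b hb]; exact hlt

end Logic

/-! ### Bit strings in memory -/

/-- The `len` low bits of `x`, least significant bit first. -/
def nbits (len x : ℕ) : List Bool := (List.range len).map x.testBit

@[simp] theorem length_nbits (len x : ℕ) : (nbits len x).length = len := by simp [nbits]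

/-- The string `l` occurs in `D` at position `pos`. -/
def At (D : List Bool) (pos : ℕ) (l : List Bool) : Prop :=
  ∃ pre suf, D = pre ++ l ++ suf ∧ pre.length = pos

/-- The `len` bits of `D` from position `pos` on, read as a number, give `x`. -/
def Fld (D : List Bool) (pos len x : ℕ) : Prop :=
  ∀ j, x.testBit j = (decide (j < len) && D.getD (pos + j) false)

theorem At.left {D : List Bool} {pos : ℕ} {l m : List Bool} (h : At D pos (l ++ m)) :
    At D pos l := by
  obtain ⟨a, b, rfl, rfl⟩ := h
  exact ⟨a, m ++ b, by simp, rfl⟩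

theorem At.right {D : List Bool} {pos : ℕ} {l m : List Bool} (h : At D pos (l ++ m)) :
    At D (pos + l.length) m := by
  obtain ⟨a, b, rfl, rfl⟩ := h
  exact ⟨a ++ l, b, by simp, by simp⟩

theorem At.flatMap {D : List Bool} {pos m : ℕ} {f : ℕ → List Bool}
    (h : At D pos ((List.range m).flatMap f)) {j : ℕ} (hj : j < m) :
    At D (pos + ((List.range j).flatMap f).length) (f j) := by
  obtain ⟨d, rfl⟩ : ∃ d, m = j + 1 + d := ⟨m - (j + 1), by omega⟩
  rw [List.range_add, List.flatMap_append, List.range_succ, List.flatMap_append] at h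
  simpa using h.left.right

theorem length_flatMap_const {m R : ℕ} {f : ℕ → List Bool} (h : ∀ j, (f j).length = R) :
    ((List.range m).flatMap f).length = m * R := by
  simp [List.length_flatMap, h]

theorem length_flatMap_range (f : ℕ → List Bool) (m : ℕ) :
    ((List.range m).flatMap f).length = ∑ j ∈ Finset.range m, (f j).length := by
  induction m with
  | zero => simp
  | succ m ih => rw [List.range_succ, List.flatMap_append, Finset.sum_range_succ, ← ih]; simp

theorem flatMap_length_mono {f : ℕ → List Bool} {i j : ℕ} (h : i ≤ j) :
    ((List.range i).flatMap f).length ≤ ((List.range j).flatMap f).length := by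
  obtain ⟨d, rfl⟩ := Nat.exists_eq_add_of_le h
  rw [List.range_add, List.flatMap_append, List.length_append]
  exact Nat.le_add_right _ _

theorem At.getD {D : List Bool} {pos : ℕ} {l : List Bool} (h : At D pos l) {j : ℕ}
    (hj : j < l.length) : D.getD (pos + j) false = l[j] := by
  obtain ⟨a, b, rfl, rfl⟩ := h
  simp [List.getD_eq_getElem?_getD, List.getElem?_append, hj]

theorem At.fld_mod {D : List Bool} {pos len x : ℕ} (h : At D pos (nbits len x)) :
    Fld D pos len (x % 2 ^ len) := by
  intro j
  rw [Nat.testBit_mod_two_pow]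
  by_cases hj : j < len
  · rw [h.getD (by simpa using hj)]; simp [nbits]
  · simp [hj]

theorem At.fld {D : List Bool} {pos len x : ℕ} (h : At D pos (nbits len x)) (hx : x < 2 ^ len) :
    Fld D pos len x := by
  simpa [Nat.mod_eq_of_lt hx] using h.fld_mod

/-- The `len` bits that start `x` bits behind the start of the memory word `a`. The two shifts at
the end clear the bits behind the first `len`. -/
def readE (a x len : Ex) : Ex :=
  .bin .shr (.bin .shl
    (.bin .or (.bin .shr (.ld (a + x / .reg 2)) (x % .reg 2))
      (.bin .shl (.ld (a + x / .reg 2 + .lit 1)) (.reg 2 - x % .reg 2)))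
    (.reg 2 - len)) (.reg 2 - len)

theorem getLsbD_memory {w : ℕ} (D : List Bool) {a : ℕ} (ha : a < 2 ^ w) (j : ℕ) :
    (memory w D (BitVec.ofNat w a)).getLsbD j = (decide (j < w) && D.getD (a * w + j) false) := by
  by_cases hj : j < w
  · simp [memory, hj, Nat.mod_eq_of_lt ha]
  · simp [memory, hj, BitVec.getLsbD_ofFnLE]

/-- `readE` reads a field of the data structure: the two words that may contain it are shifted and
joined. Both of them must have valid addresses. -/
theorem Ev.read {w : ℕ} {D : List Bool} {sa : BitVec w → BitVec w} {tA : ℕ} {ρ : ℕ → ℕ}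
    {a x l : Ex} {na nx nl v : ℕ} (hw : ρ 2 = w)
    (ha : Ev ⟨memory w D, sa, tA⟩ ρ a na) (hx : Ev ⟨memory w D, sa, tA⟩ ρ x nx)
    (hl : Ev ⟨memory w D, sa, tA⟩ ρ l nl) (hlw : nl ≤ w) (hw0 : 0 < w)
    (hb : na + nx / w + 1 < 2 ^ w) (hv : Fld D (na * w + nx) nl v) :
    Ev ⟨memory w D, sa, tA⟩ ρ (readE a x l) v := by
  have b2 : (Ex.reg 2).Below 40 := by simp [Ex.Below]
  refine ⟨⟨⟨⟨⟨⟨ha.1, hx.1, b2⟩, hx.1, b2⟩, ⟨⟨ha.1, hx.1, b2⟩, trivial⟩, b2, hx.1, b2⟩, b2, hl.1⟩,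
    b2, hl.1⟩, fun r hr => ?_⟩
  set E : Env w := ⟨memory w D, sa, tA⟩
  have h2 : Ev E ρ (.reg 2) w := Ev.reg (by norm_num) hw
  have h1w : 1 < 2 ^ w := Nat.one_lt_two_pow hw0.ne'
  have hq := ha.add (hx.div h2) (by omega)
  have e1 := hq.ld.2 r hr
  have e2 := (hq.add (Ev.num h1w) hb).ld.2 r hr
  have e3 := (hx.mod h2).2 r hr
  have e4 := (h2.sub (hx.mod h2) (Nat.mod_lt _ hw0).le).2 r hr
  have e5 := (h2.sub hl hlw).2 r hr
  apply Nat.eq_of_testBit_eq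
  intro j
  rw [hv j, BitVec.testBit_toNat]
  change (E.mem ((a + x / .reg 2).eval E r)).toNat = _ at e1
  change (E.mem ((a + x / .reg 2 + .lit 1).eval E r)).toNat = _ at e2
  change (((E.mem ((a + x / .reg 2).eval E r) >>> (x % .reg 2).eval E r |||
    E.mem ((a + x / .reg 2 + .lit 1).eval E r) <<< (.reg 2 - x % .reg 2 : Ex).eval E r) <<<
      (.reg 2 - l : Ex).eval E r) >>> (.reg 2 - l : Ex).eval E r).getLsbD j = _
  rw [BitVec.ushiftRight_eq', BitVec.getLsbD_ushiftRight, BitVec.shiftLeft_eq',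
    BitVec.getLsbD_shiftLeft, BitVec.getLsbD_or, BitVec.ushiftRight_eq',
    BitVec.getLsbD_ushiftRight, BitVec.shiftLeft_eq', BitVec.getLsbD_shiftLeft, e3, e4, e5,
    BitVec.eq_of_toNat_eq e1, BitVec.eq_of_toNat_eq e2, getLsbD_memory D (by omega),
    getLsbD_memory D hb]
  have hnx : nx = w * (nx / w) + nx % w := (Nat.div_add_mod nx w).symm
  have hrw := Nat.mod_lt nx hw0
  by_cases hj : j < nl
  · have k1 : w - nl + j < w := by omega
    have k2 : ¬ (w - nl + j < w - nl) := by omega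
    have k3 : w - nl + j - (w - nl) = j := by omega
    simp only [hj, k1, k2, k3, decide_true, decide_false, Bool.true_and, Bool.not_false]
    by_cases hs : nx % w + j < w
    · have k4 : j < w - nx % w := by omega
      have k5 : (na + nx / w) * w + (nx % w + j) = na * w + nx + j := by
        conv_rhs => rw [hnx]
        ring
      simp [hs, k4, k5]
    · have k4 : ¬ j < w - nx % w := by omega
      have k6 : j < w := by omega
      have k7 : j - (w - nx % w) < w := by omega
      have k5 : (na + nx / w + 1) * w + (j - (w - nx % w)) = na * w + nx + j := by
        have : (na + nx / w + 1) * w + (j - (w - nx % w)) =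
          na * w + w * (nx / w) + (w + (j - (w - nx % w))) := by ring
        rw [this]
        conv_rhs => rw [hnx]
        omega
      simp [hs, k4, k5, k6, k7]
  · have k1 : ¬ (w - nl + j < w) := by omega
    simp [hj, k1]

/-! ### Longest common prefixes -/

theorem lcp_le_left {α : Type*} [DecidableEq α] (l m : List α) : lcp l m ≤ l.length := by
  obtain ⟨p, hp, h1, -⟩ := (lcp_isGreatest l m).1
  exact hp ▸ h1.length_le

theorem lcp_le_right {α : Type*} [DecidableEq α] (l m : List α) : lcp l m ≤ m.length := by
  obtain ⟨p, hp, -, h1⟩ := (lcp_isGreatest l m).1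
  exact hp ▸ h1.length_le

theorem getElem?_lcp_eq {α : Type*} [DecidableEq α] {l m : List α} {d : ℕ} (h : d < lcp l m) :
    l[d]? = m[d]? := by
  induction l generalizing m d with
  | nil => simp [lcp] at h
  | cons a l ih =>
    cases m with
    | nil => simp [lcp] at h
    | cons c m =>
      by_cases hac : a = c
      · subst hac
        cases d with
        | zero => simp
        | succ d =>
          simp only [lcp, if_true] at h
          simpa using ih (by omega)
      · simp [lcp, hac] at h

theorem getElem?_lcp_ne {α : Type*} [DecidableEq α] {l m : List α} (hl : lcp l m < l.length)
    (hm : lcp l m < m.length) : l[lcp l m]? ≠ m[lcp l m]? := by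
  induction l generalizing m with
  | nil => simp at hl
  | cons a l ih =>
    cases m with
    | nil => simp at hm
    | cons c m =>
      by_cases hac : a = c
      · subst hac
        simp only [lcp, if_true, List.length_cons, Nat.add_lt_add_iff_right] at hl hm ⊢
        simpa using ih hl hm
      · simp [lcp, hac]

/-! ### The layout of the data structure -/

/-- The parameters and the contents of the data structure.

The positions of the text are cut into blocks of `s` positions (for the LCP-information), into
blocks of `b` positions (for the text), and into superblocks of `b * s * M` positions. `Φ` is the
monotone function that is to be stored, `cd J` is the identifier of the `J`-th text block, and
`blk x o` is the symbol at offset `o` of the text block with identifier `x`. Short numbers take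
`g` bits, long numbers take `F` bits, and identifiers are smaller than `2 ^ β`. -/
structure Par where
  n : ℕ
  w : ℕ
  b : ℕ
  s : ℕ
  M : ℕ
  g : ℕ
  F : ℕ
  β : ℕ
  Φ : ℕ → ℕ
  cd : ℕ → ℕ
  blk : ℕ → ℕ → ℕ

namespace Par

variable (P : Par)

/-- The number of positions in a superblock. -/
def S : ℕ := P.b * P.s * P.M

/-- Identifiers are numbers below `B`. -/
def B : ℕ := 2 ^ P.β

/-- The number of superblocks. -/
def m : ℕ := P.n / P.S + 1

/-- The header. The initial run of zeros reveals the length `g` of the fields that follow. -/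
def hdr : List Bool :=
  nbits P.g 0 ++ ([true] ++ (nbits P.g P.g ++ (nbits P.g P.b ++ (nbits P.g P.s ++
    (nbits P.g P.S ++ (nbits P.g P.F ++ nbits P.g P.β))))))

/-- The number of steps for which the block `x` from offset `o` on agrees with the block `y` from
offset `o'` on, before one of the blocks ends. -/
def tabVal (x o y o' : ℕ) : ℕ :=
  lcp ((List.range (P.b - o)).map fun d => P.blk x (o + d))
    ((List.range (P.b - o')).map fun d => P.blk y (o' + d))

/-- The table of all values `tabVal x o y o'`, at index `((x * b + o) * B + y) * b + o'`. -/
def tab : List Bool :=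
  (List.range (P.B * P.b * P.B * P.b)).flatMap fun i =>
    nbits P.g (P.tabVal (i / P.b / P.B / P.b) (i / P.b / P.B % P.b) (i / P.b % P.B) (i % P.b))

/-- The width of the fields of superblock `u`: short unless `Φ` grows very much. -/
def wid (u : ℕ) : ℕ :=
  if P.Φ ((u + 1) * P.S) - P.Φ (u * P.S) < 2 ^ P.g then P.g else P.F

/-- The `j`-th `s`-block of superblock `u` is large if `Φ` grows by at least `s * b` over it. The
values of `Φ` in large blocks are stored explicitly. -/
def Large (u j : ℕ) : Prop :=
  P.s * P.b ≤ P.Φ (u * P.S + (j + 1) * P.s) - P.Φ (u * P.S + j * P.s)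

instance (u j : ℕ) : Decidable (P.Large u j) := inferInstanceAs (Decidable (_ ≤ _))

/-- The explicit values of `Φ` in the `j`-th `s`-block of superblock `u` if it is large, relative
to the start of the superblock. -/
def lst (u j : ℕ) : List Bool :=
  if P.Large u j then
    (List.range P.s).flatMap fun o =>
      nbits (P.wid u) (P.Φ (u * P.S + j * P.s + o) - P.Φ (u * P.S))
  else []

/-- The codeword of the `j`-th text block of superblock `u`: the binary representation of its
identifier without the leading one. -/
def cw (u j : ℕ) : List Bool :=
  nbits (Nat.log2 (P.cd (u * (P.s * P.M) + j))) (P.cd (u * (P.s * P.M) + j))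

/-- The number of fields of a superblock. -/
def NF : ℕ := 2 * (P.b * P.M + 1) + (P.s * P.M + 1)

/-- The start of the `j`-th list of superblock `u`, relative to the body of the superblock. -/
def ptrL (u j : ℕ) : ℕ := P.NF * P.wid u + ((List.range j).flatMap (P.lst u)).length

/-- The start of the `j`-th codeword of superblock `u`, relative to its body. -/
def ptrT (u j : ℕ) : ℕ :=
  P.NF * P.wid u + ((List.range (P.b * P.M)).flatMap (P.lst u)).length +
    ((List.range j).flatMap (P.cw u)).length

/-- The body of superblock `u`: samples of `Φ`, pointers to the lists, pointers to the codewords,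
the lists, the codewords. -/
def body (u : ℕ) : List Bool :=
  ((List.range (P.b * P.M + 1)).flatMap fun j =>
    nbits (P.wid u) (P.Φ (u * P.S + j * P.s) - P.Φ (u * P.S)) ++
      nbits (P.wid u) (P.ptrL u j)) ++
  (((List.range (P.s * P.M + 1)).flatMap fun j => nbits (P.wid u) (P.ptrT u j)) ++
  ((List.range (P.b * P.M)).flatMap (P.lst u) ++ (List.range (P.s * P.M)).flatMap (P.cw u)))

/-- The position of the table. -/
def tabPos : ℕ := 7 * P.g + 1

/-- The position of the directory of the superblocks. -/
def dirPos : ℕ := P.tabPos + P.B * P.b * P.B * P.b * P.g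

/-- The position behind the directory. -/
def dirEnd : ℕ := P.dirPos + P.m * (4 * P.F)

/-- The position of the body of superblock `u`. -/
def addr (u : ℕ) : ℕ := P.dirEnd + ((List.range u).flatMap P.body).length

/-- The directory: address (word and offset), value of `Φ` at the start, and field width of every
superblock. -/
def dir : List Bool :=
  (List.range P.m).flatMap fun u =>
    nbits P.F (P.addr u / P.w) ++ (nbits P.F (P.addr u % P.w) ++
      (nbits P.F (P.Φ (u * P.S)) ++ nbits P.F (P.wid u)))

/-- The data structure. -/
def data : List Bool :=
  P.hdr ++ (P.tab ++ (P.dir ++ (List.range P.m).flatMap P.body))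

/-- The conditions under which the data structure works on a machine of word width `w`; `X` is
the text. -/
structure Ok (X : ℕ → ℕ) : Prop where
  b_pos : 0 < P.b
  s_pos : 0 < P.s
  M_pos : 0 < P.M
  n_lt : P.n < 2 ^ P.w
  g_le : P.g ≤ P.F
  F_le : P.F ≤ P.w
  g_lt : 2 * P.g + 2 ≤ P.w
  w_ge : 4 ≤ P.w
  hg : P.g < 2 ^ P.g
  hS : P.S < 2 ^ P.g
  hF : P.F < 2 ^ P.g
  hβ : P.β < 2 ^ P.g
  front : P.dirEnd < 2 ^ P.w
  total : P.data.length / P.w + 1 < 2 ^ P.w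
  fields : ∀ x ≤ P.data.length, x / P.w < 2 ^ P.F ∧ x % P.w < 2 ^ P.F
  n_ltF : P.n < 2 ^ P.F
  body_lt : ∀ u, (P.body u).length < 2 ^ P.g
  cd_pos : ∀ J, 0 < P.cd J
  cd_lt : ∀ J, P.cd J < 2 ^ P.β
  blk_cd : ∀ J o, o < P.b → P.blk (P.cd J) o = X (J * P.b + o)
  mono : Monotone P.Φ
  Φ_le : ∀ p, P.Φ p ≤ P.n

theorem length_hdr : P.hdr.length = P.tabPos := by
  simp [hdr, tabPos]; ring

theorem length_tab : P.tab.length = P.B * P.b * P.B * P.b * P.g :=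
  length_flatMap_const fun _ => length_nbits _ _

theorem length_dir : P.dir.length = P.m * (4 * P.F) :=
  length_flatMap_const fun _ => by simp; ring

theorem length_samples (u j : ℕ) : ((List.range j).flatMap fun j =>
    nbits (P.wid u) (P.Φ (u * P.S + j * P.s) - P.Φ (u * P.S)) ++
      nbits (P.wid u) (P.ptrL u j)).length = 2 * j * P.wid u := by
  rw [length_flatMap_const (R := 2 * P.wid u) fun _ => by simp; ring]; ring

theorem length_ptrs (u j : ℕ) : ((List.range j).flatMap fun j =>
    nbits (P.wid u) (P.ptrT u j)).length = j * P.wid u :=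
  length_flatMap_const fun _ => length_nbits _ _

theorem length_body (u : ℕ) : (P.body u).length = P.ptrT u (P.s * P.M) := by
  simp only [body, List.length_append, length_samples, length_ptrs]
  rw [ptrT, NF]
  ring

theorem length_data : P.data.length = P.addr P.m := by
  simp only [data, addr, dirEnd, dirPos, List.length_append, length_hdr, length_tab, length_dir]
  ring

theorem at_data : At P.data 0 P.data := ⟨[], [], by simp, rfl⟩

theorem at_tab : At P.data P.tabPos P.tab := by
  have h := P.at_data.right.left
  rwa [length_hdr, Nat.zero_add] at h

theorem at_dir : At P.data P.dirPos P.dir := by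
  have h := P.at_data.right.right.left
  rwa [length_hdr, length_tab, Nat.zero_add] at h

theorem at_body {u : ℕ} (hu : u < P.m) : At P.data (P.addr u) (P.body u) := by
  have h := P.at_data.right.right.right.flatMap hu
  rwa [length_hdr, length_tab, length_dir, Nat.zero_add] at h

theorem ptrL_succ (u j : ℕ) : P.ptrL u (j + 1) = P.ptrL u j + (P.lst u j).length := by
  simp only [ptrL, List.range_succ, List.flatMap_append, List.length_append]
  simp; ring

theorem ptrT_succ (u j : ℕ) :
    P.ptrT u (j + 1) = P.ptrT u j + Nat.log2 (P.cd (u * (P.s * P.M) + j)) := by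
  simp only [ptrT, List.range_succ, List.flatMap_append, List.length_append]
  simp [cw]; ring

theorem at_dir_rec {u : ℕ} (hu : u < P.m) :
    At P.data (P.dirPos + u * (4 * P.F))
      (nbits P.F (P.addr u / P.w) ++ (nbits P.F (P.addr u % P.w) ++
      (nbits P.F (P.Φ (u * P.S)) ++ nbits P.F (P.wid u)))) := by
  have h := P.at_dir.flatMap hu
  rwa [length_flatMap_const (R := 4 * P.F) fun _ => by simp; ring] at h

theorem at_samples {u j : ℕ} (hu : u < P.m) (hj : j ≤ P.b * P.M) :
    At P.data (P.addr u + 2 * j * P.wid u)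
      (nbits (P.wid u) (P.Φ (u * P.S + j * P.s) - P.Φ (u * P.S)) ++
      nbits (P.wid u) (P.ptrL u j)) := by
  have h := (P.at_body hu).left.flatMap (Nat.lt_succ_of_le hj)
  rwa [length_samples] at h

theorem at_ptrT {u j : ℕ} (hu : u < P.m) (hj : j ≤ P.s * P.M) :
    At P.data (P.addr u + (2 * (P.b * P.M + 1) + j) * P.wid u)
      (nbits (P.wid u) (P.ptrT u j)) := by
  have h := (P.at_body hu).right.left.flatMap (Nat.lt_succ_of_le hj)
  rw [length_samples, length_ptrs] at h
  convert h using 1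
  ring

theorem at_lst {u j : ℕ} (hu : u < P.m) (hj : j < P.b * P.M) :
    At P.data (P.addr u + P.ptrL u j) (P.lst u j) := by
  have h := (P.at_body hu).right.right.left.flatMap hj
  rw [length_samples, length_ptrs] at h
  convert h using 1
  simp only [ptrL, NF]
  ring

theorem at_cw {u j : ℕ} (hu : u < P.m) (hj : j < P.s * P.M) :
    At P.data (P.addr u + P.ptrT u j) (P.cw u j) := by
  have h := (P.at_body hu).right.right.right.flatMap hj
  rw [length_samples, length_ptrs] at h
  convert h using 1
  simp only [ptrT, NF]
  ring

theorem ptrT_mono (u : ℕ) : Monotone (P.ptrT u) :=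
  fun _ _ h => Nat.add_le_add_left (flatMap_length_mono h) _

theorem ptrL_mono (u : ℕ) : Monotone (P.ptrL u) :=
  fun _ _ h => Nat.add_le_add_left (flatMap_length_mono h) _

theorem ptrT_le {u j : ℕ} (hj : j ≤ P.s * P.M) : P.ptrT u j ≤ (P.body u).length := by
  rw [length_body]; exact P.ptrT_mono u hj

theorem ptrL_le {u j : ℕ} (hj : j ≤ P.b * P.M) : P.ptrL u j ≤ (P.body u).length := by
  rw [length_body]
  exact (P.ptrL_mono u hj).trans (Nat.le_add_right _ _)

theorem NF_le (u : ℕ) : P.NF * P.wid u ≤ (P.body u).length := by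
  rw [length_body, ptrT, Nat.add_assoc]
  exact Nat.le_add_right _ _

theorem addr_body_le {u : ℕ} (hu : u < P.m) :
    P.addr u + (P.body u).length ≤ P.data.length := by
  rw [length_data, addr, addr]
  have := flatMap_length_mono (f := P.body) (Nat.succ_le_of_lt hu)
  rw [Nat.succ_eq_add_one, List.range_succ, List.flatMap_append, List.length_append] at this
  simp at this
  simp
  omega

variable {P} {X : ℕ → ℕ}

theorem Ok.S_pos (h : P.Ok X) : 0 < P.S :=
  Nat.mul_pos (Nat.mul_pos h.b_pos h.s_pos) h.M_pos

theorem Ok.wid_le (h : P.Ok X) (u : ℕ) : P.wid u ≤ P.F := by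
  unfold wid; split_ifs
  · exact h.g_le
  · exact le_rfl

theorem Ok.le_wid (h : P.Ok X) (u : ℕ) : P.g ≤ P.wid u := by
  unfold wid; split_ifs
  · exact le_rfl
  · exact h.g_le

theorem Ok.wid_pos (h : P.Ok X) (u : ℕ) : 0 < P.wid u := by
  have h1 := h.le_wid u
  by_contra hc
  have h2 := h.hS
  have h3 := h.S_pos
  have h4 : P.g = 0 := by omega
  rw [h4] at h2; simp at h2; omega

theorem Ok.body_lt_wid (h : P.Ok X) (u : ℕ) : (P.body u).length < 2 ^ P.wid u :=
  (h.body_lt u).trans_le (Nat.pow_le_pow_right (by norm_num) (h.le_wid u))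

theorem Ok.rel_lt (h : P.Ok X) {u p : ℕ} (hp : p ≤ (u + 1) * P.S) :
    P.Φ p - P.Φ (u * P.S) < 2 ^ P.wid u := by
  have h1 := h.mono hp
  unfold wid
  split_ifs with hc
  · omega
  · have := h.Φ_le p
    have := h.n_ltF
    omega

theorem s_mul {j : ℕ} (hj : j ≤ P.b * P.M) : j * P.s ≤ P.S := by
  calc j * P.s ≤ P.b * P.M * P.s := Nat.mul_le_mul_right _ hj
    _ = P.S := by rw [S]; ring

theorem Ok.fld_sample (h : P.Ok X) {u j : ℕ} (hu : u < P.m) (hj : j ≤ P.b * P.M) :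
    Fld P.data (P.addr u + 2 * j * P.wid u) (P.wid u)
      (P.Φ (u * P.S + j * P.s) - P.Φ (u * P.S)) := by
  refine (P.at_samples hu hj).left.fld (h.rel_lt ?_)
  have := s_mul hj
  rw [Nat.add_mul]; omega

theorem Ok.fld_ptrL (h : P.Ok X) {u j : ℕ} (hu : u < P.m) (hj : j ≤ P.b * P.M) :
    Fld P.data (P.addr u + (2 * j + 1) * P.wid u) (P.wid u) (P.ptrL u j) := by
  have h1 := (P.at_samples hu hj).right.fld ((P.ptrL_le hj).trans_lt (h.body_lt_wid u))
  convert h1 using 1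
  rw [length_nbits]; ring

theorem Ok.fld_ptrT (h : P.Ok X) {u j : ℕ} (hu : u < P.m) (hj : j ≤ P.s * P.M) :
    Fld P.data (P.addr u + (2 * (P.b * P.M + 1) + j) * P.wid u) (P.wid u) (P.ptrT u j) :=
  (P.at_ptrT hu hj).fld ((P.ptrT_le hj).trans_lt (h.body_lt_wid u))

theorem length_lst_of_large {u j : ℕ} (hl : P.Large u j) : (P.lst u j).length = P.s * P.wid u := by
  rw [lst, if_pos hl, length_flatMap_const fun _ => length_nbits _ _]

theorem length_lst_of_not_large {u j : ℕ} (hl : ¬ P.Large u j) : (P.lst u j).length = 0 := by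
  rw [lst, if_neg hl, List.length_nil]

theorem Ok.fld_lst (h : P.Ok X) {u j o : ℕ} (hu : u < P.m) (hj : j < P.b * P.M) (ho : o < P.s)
    (hl : P.Large u j) :
    Fld P.data (P.addr u + (P.ptrL u j + o * P.wid u)) (P.wid u)
      (P.Φ (u * P.S + j * P.s + o) - P.Φ (u * P.S)) := by
  have h1 := P.at_lst hu hj
  rw [lst, if_pos hl] at h1
  have h2 := h1.flatMap ho
  rw [length_flatMap_const fun _ => length_nbits _ _, Nat.add_assoc] at h2
  refine h2.fld (h.rel_lt ?_)
  have h3 := s_mul hj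
  rw [Nat.succ_eq_add_one, Nat.add_mul] at h3
  rw [Nat.add_mul]; omega

theorem Ok.fld_cw (h : P.Ok X) {u j : ℕ} (hu : u < P.m) (hj : j < P.s * P.M) :
    Fld P.data (P.addr u + P.ptrT u j) (Nat.log2 (P.cd (u * (P.s * P.M) + j)))
      (P.cd (u * (P.s * P.M) + j) - 2 ^ Nat.log2 (P.cd (u * (P.s * P.M) + j))) := by
  have h1 := (P.at_cw hu hj).fld_mod
  set x := P.cd (u * (P.s * P.M) + j) with hx
  have hx0 : x ≠ 0 := (h.cd_pos _).ne'
  have h2 : 2 ^ Nat.log2 x ≤ x := Nat.log2_self_le hx0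
  have h3 : x < 2 ^ (Nat.log2 x + 1) := Nat.lt_log2_self
  have h4 : x % 2 ^ Nat.log2 x = x - 2 ^ Nat.log2 x := by
    rw [Nat.mod_eq_sub_mod h2, Nat.mod_eq_of_lt]
    rw [pow_succ] at h3; omega
  rwa [h4] at h1

theorem Ok.fld_dir (h : P.Ok X) {u : ℕ} (hu : u < P.m) :
    Fld P.data (P.dirPos + u * (4 * P.F)) P.F (P.addr u / P.w) ∧
    Fld P.data (P.dirPos + u * (4 * P.F) + P.F) P.F (P.addr u % P.w) ∧
    Fld P.data (P.dirPos + u * (4 * P.F) + 2 * P.F) P.F (P.Φ (u * P.S)) ∧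
    Fld P.data (P.dirPos + u * (4 * P.F) + 3 * P.F) P.F (P.wid u) := by
  have h1 := P.at_dir_rec hu
  have h2 := h.fields (P.addr u) ((Nat.le_add_right _ _).trans (P.addr_body_le hu))
  have h3 := h.F_le
  have h4 : P.wid u < 2 ^ P.F := (h.wid_le u).trans_lt Nat.lt_two_pow_self
  refine ⟨h1.left.fld h2.1, ?_, ?_, ?_⟩
  · simpa using h1.right.left.fld h2.2
  · have := h1.right.right.left.fld ((h.Φ_le _).trans_lt h.n_ltF)
    convert this using 1; simp; ring
  · have := h1.right.right.right.fld h4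
    convert this using 1; simp; ring

theorem Ok.b_lt (h : P.Ok X) : P.b < 2 ^ P.g := by
  refine lt_of_le_of_lt ?_ h.hS
  rw [S, Nat.mul_assoc]
  exact Nat.le_mul_of_pos_right _ (Nat.mul_pos h.s_pos h.M_pos)

theorem Ok.s_lt (h : P.Ok X) : P.s < 2 ^ P.g := by
  refine lt_of_le_of_lt ?_ h.hS
  rw [S, Nat.mul_right_comm]
  exact Nat.le_mul_of_pos_left _ (Nat.mul_pos h.b_pos h.M_pos)

theorem Ok.fld_hdr (h : P.Ok X) :
    Fld P.data (P.g + 1) P.g P.g ∧ Fld P.data (2 * P.g + 1) P.g P.b ∧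
    Fld P.data (3 * P.g + 1) P.g P.s ∧ Fld P.data (4 * P.g + 1) P.g P.S ∧
    Fld P.data (5 * P.g + 1) P.g P.F ∧ Fld P.data (6 * P.g + 1) P.g P.β := by
  have h0 := P.at_data.left.right.right
  have h1 := h0.right
  have h2 := h1.right
  have h3 := h2.right
  have h4 := h3.right
  refine ⟨?_, ?_, ?_, ?_, ?_, ?_⟩
  · have := h0.left.fld h.hg
    convert this using 1; simp
  · have := h1.left.fld h.b_lt
    convert this using 1; simp; ring
  · have := h2.left.fld h.s_lt
    convert this using 1; simp; ring
  · have := h3.left.fld h.hS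
    convert this using 1; simp; ring
  · have := h4.left.fld h.hF
    convert this using 1; simp; ring
  · have := h4.right.fld h.hβ
    convert this using 1; simp; ring

/-- The data structure starts with `g` zeros, and a one follows them. This lets the program find `g`
without knowing the width of any field. -/
theorem getD_data_lt {j : ℕ} (hj : j < P.g) : P.data.getD j false = false := by
  have := P.at_data.left.left.getD (j := j) (by simpa using hj)
  simpa [nbits] using this

theorem getD_data_self : P.data.getD P.g false = true := by
  have := P.at_data.left.right.left.getD (j := 0) (by simp)
  simpa using this

theorem Ok.fld_tab (h : P.Ok X) {x o y o' : ℕ} (hx : x < P.B) (ho : o < P.b) (hy : y < P.B)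
    (ho' : o' < P.b) : ((x * P.b + o) * P.B + y) * P.b + o' < P.B * P.b * P.B * P.b ∧
    Fld P.data (P.tabPos + (((x * P.b + o) * P.B + y) * P.b + o') * P.g) P.g
      (P.tabVal x o y o') := by
  have key : ∀ {a c e f : ℕ}, a < c → e < f → a * f + e < c * f := by
    intro a c e f h1 h2
    calc a * f + e < a * f + f := by omega
      _ = (a + 1) * f := by ring
      _ ≤ c * f := Nat.mul_le_mul_right _ h1
  have hlt := key (key (key hx ho) hy) ho'
  refine ⟨hlt, ?_⟩
  have hB : 0 < P.B := by omega
  have hb := h.b_pos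
  have h1 := P.at_tab.flatMap hlt
  rw [length_flatMap_const fun _ => length_nbits _ _] at h1
  have e0 : ∀ {a e f : ℕ}, e < f → (a * f + e) / f = a ∧ (a * f + e) % f = e := by
    intro a e f hef
    rw [Nat.mul_comm a f, Nat.mul_add_div (by omega), Nat.mul_add_mod]
    simp [Nat.div_eq_of_lt hef, Nat.mod_eq_of_lt hef]
  rw [(e0 ho').1, (e0 ho').2, (e0 hy).1, (e0 hy).2, (e0 ho).1, (e0 ho).2] at h1
  refine h1.fld (lt_of_le_of_lt (lcp_le_left _ _) ?_)
  simp only [List.length_map, List.length_range]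
  exact (Nat.sub_le _ _).trans_lt h.b_lt

/-- The table entry for the positions `p` and `q` counts matching symbols of the text up to a mismatch
or up to the end of one of the two blocks. -/
theorem Ok.tabVal_spec (h : P.Ok X) {p q : ℕ} :
    let l := P.tabVal (P.cd (p / P.b)) (p % P.b) (P.cd (q / P.b)) (q % P.b)
    (∀ d < l, X (p + d) = X (q + d)) ∧ l ≤ P.b - p % P.b ∧ l ≤ P.b - q % P.b ∧
    (l < P.b - p % P.b → l < P.b - q % P.b → X (p + l) ≠ X (q + l)) := by
  intro l
  have hb := h.b_pos
  have key : ∀ x d, d < P.b - x % P.b → P.blk (P.cd (x / P.b)) (x % P.b + d) = X (x + d) := by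
    intro x d hd
    rw [h.blk_cd _ _ (by omega), ← Nat.add_assoc, Nat.div_add_mod']
  have h1 : l ≤ P.b - p % P.b := (lcp_le_left _ _).trans (by simp)
  have h2 : l ≤ P.b - q % P.b := (lcp_le_right _ _).trans (by simp)
  refine ⟨fun d hd => ?_, h1, h2, fun h3 h4 => ?_⟩
  · have := getElem?_lcp_eq hd
    rw [List.getElem?_map, List.getElem?_map, List.getElem?_range (by omega),
      List.getElem?_range (by omega)] at this
    simp only [Option.map_some, Option.some.injEq] at this
    rwa [key p d (by omega), key q d (by omega)] at this
  · have := getElem?_lcp_ne (l := (List.range (P.b - p % P.b)).map fun d =>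
        P.blk (P.cd (p / P.b)) (p % P.b + d)) (m := (List.range (P.b - q % P.b)).map fun d =>
        P.blk (P.cd (q / P.b)) (q % P.b + d)) (by rw [List.length_map, List.length_range]; exact h3)
        (by rw [List.length_map, List.length_range]; exact h4)
    change _[l]? ≠ _[l]? at this
    rw [List.getElem?_map, List.getElem?_map, List.getElem?_range (by omega),
      List.getElem?_range (by omega)] at this
    simp only [Option.map_some, ne_eq, Option.some.injEq] at this
    rwa [key p l h3, key q l h4] at this

end Par

/-! ### The query program -/

section Query

local notation:max "r" k:max => Ex.reg k
local notation:max "κ" k:max => Ex.lit k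

/-- Reads the header. The lowest one of the first memory word `N` is bit `g`, so that
`(N xor (N - 1)) + 1` is `2 ^ (g + 1)`, and `g` itself is in the next `g` bits. Afterwards registers `3` to `11` hold `b`, `s`, `S`, `F`, `g`, `β`, the
positions of the table and of the directory, and `1`. -/
def hdrProg : List Program :=
  [asg 20 (.ld (κ 0)), asg 21 (.bin .xor (r 20) (r 20 - κ 1) + κ 1),
   asg 7 (r 20 / r 21 % (r 21 / κ 2)),
   asg 3 (readE κ 0 (κ 2 * r 7 + κ 1) (r 7)), asg 4 (readE κ 0 (κ 3 * r 7 + κ 1) (r 7)),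
   asg 5 (readE κ 0 (κ 4 * r 7 + κ 1) (r 7)), asg 6 (readE κ 0 (κ 5 * r 7 + κ 1) (r 7)),
   asg 8 (readE κ 0 (κ 6 * r 7 + κ 1) (r 7)), asg 9 (κ 7 * r 7 + κ 1),
   asg 20 (.bin .shl κ 1 (r 8)), asg 10 (r 9 + r 20 * r 3 * r 20 * r 3 * r 7), asg 11 κ 1]

/-- Reads the directory record of the superblock of the position in register `18`, into the
registers `20` to `23`. -/
def dirProg : List Program :=
  [asg 24 (r 10 + r 18 / r 5 * (κ 4 * r 6)), asg 20 (readE κ 0 (r 24) (r 6)),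
   asg 21 (readE κ 0 (r 24 + r 6) (r 6)), asg 22 (readE κ 0 (r 24 + κ 2 * r 6) (r 6)),
   asg 23 (readE κ 0 (r 24 + κ 3 * r 6) (r 6))]

/-- The identifier of the text block of the position in register `18`, into register `30`, and
the offset in the block, into register `31`. -/
def blkProg : List Program :=
  [block dirProg, asg 25 (κ 2 * (r 5 / r 4 + κ 1) + r 18 % r 5 / r 3),
   asg 26 (readE (r 20) (r 21 + r 25 * r 23) (r 23)),
   asg 27 (readE (r 20) (r 21 + (r 25 + κ 1) * r 23) (r 23)),
   asg 28 (r 27 - r 26), asg 30 (.bin .shl κ 1 (r 28) + readE (r 20) (r 21 + r 26) (r 28)),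
   asg 31 (r 18 % r 3)]

/-- For the position in register `18` bounds of `Φ` relative to the start of the superblock: a
lower bound in register `26` and an upper bound in register `28`. -/
def phiProg : List Program :=
  [block dirProg, asg 25 (r 18 % r 5 / r 4),
   asg 26 (readE (r 20) (r 21 + κ 2 * r 25 * r 23) (r 23)),
   asg 27 (readE (r 20) (r 21 + (κ 2 * r 25 + κ 1) * r 23) (r 23)),
   asg 28 (readE (r 20) (r 21 + κ 2 * (r 25 + κ 1) * r 23) (r 23)),
   asg 29 (readE (r 20) (r 21 + (κ 2 * (r 25 + κ 1) + κ 1) * r 23) (r 23)),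
   .ifLt 27 29
    (block [asg 30 (readE (r 20) (r 21 + (r 27 + r 18 % r 4 * r 23)) (r 23)),
      asg 26 (r 30), asg 28 (r 30)])
    .skip]

/-- Bounds of the LCP-value: a lower bound in register `14` and an upper bound in register `15`. -/
def boundProg : List Program :=
  [asg 18 (r 12), block phiProg, asg 14 (r 22 + r 26),
   .ifLt 14 12 (asg 14 (r 12)) .skip, asg 14 (r 14 - r 12),
   asg 15 (r 22 + r 28 - r 12), asg 32 (r 1 - r 13), .ifLt 32 15 (asg 15 (r 32)) .skip]

/-- One round of the comparison of the two suffixes: the lower bound in register `14` increases by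
the table entry for the two current blocks, but not beyond the upper bound in register `15`. If the
entry is `0`, the symbols differ, and the upper bound becomes the lower one. -/
def stepProg : List Program :=
  [asg 18 (r 12 + r 14), block blkProg, asg 16 (r 30), asg 17 (r 31),
   asg 18 (r 13 + r 14), block blkProg,
   asg 32 (readE κ 0
    (r 9 + (((r 16 * r 3 + r 17) * .bin .shl κ 1 (r 8) + r 30) * r 3 + r 31) * r 7)
    (r 7)),
   asg 33 (r 15 - r 14), .ifLt 33 32 (asg 32 (r 33)) .skip,
   asg 14 (r 14 + r 32), .ifLt 32 11 (asg 15 (r 14)) .skip]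

/-- The smaller one of the registers `14` and `15` is the answer. -/
def outProg : Program := .ifLt 15 14 (asg 0 (r 15)) (asg 0 (r 14))

/-- The query program. It gets the index `i` in register `0`, the length of the text in register `1`
and the word width in register `2`. The entries `i` and `i - 1` of the suffix array are kept in the
registers `12` and `13`, a lower and an upper bound of the answer in the registers `14` and `15`. -/
def query : Program :=
  .seq (asg 11 κ 1) (.ifLt 0 11 .skip
    (.seq (block hdrProg) (.seq (acc 12 (r 0)) (.seq (acc 13 (r 0 - κ 1)) (.seq (block boundProg)
      (.seq (.whileLt 14 15 (block stepProg)) outProg))))))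

/-! ### Correctness of the query program -/

theorem WP.max {w : ℕ} {E : Env w} {ρ : ℕ → ℕ} {a b : ℕ} {Q : (ℕ → ℕ) → Prop} (ha : a < 40)
    (hb : b < 40) (h : Q (Function.update ρ a (max (ρ a) (ρ b)))) :
    WP E (.ifLt a b (WeeLCP.asg a (r b)) .skip) (Program.ifLt a b (WeeLCP.asg a (r b)) .skip).cost
      Q ρ := by
  refine WP.ifLt ha hb (fun h1 => WP.asg (Ev.reg hb rfl) ?_) fun h1 => WP.skip ?_
  · rwa [max_eq_right h1.le] at h
  · rwa [max_eq_left (not_lt.mp h1), Function.update_eq_self] at h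

theorem WP.min {w : ℕ} {E : Env w} {ρ : ℕ → ℕ} {a b : ℕ} {Q : (ℕ → ℕ) → Prop} (ha : a < 40)
    (hb : b < 40) (h : Q (Function.update ρ a (min (ρ a) (ρ b)))) :
    WP E (.ifLt b a (WeeLCP.asg a (r b)) .skip) (Program.ifLt b a (WeeLCP.asg a (r b)) .skip).cost
      Q ρ := by
  refine WP.ifLt hb ha (fun h1 => WP.asg (Ev.reg hb rfl) ?_) fun h1 => WP.skip ?_
  · rwa [min_eq_right h1.le] at h
  · rwa [min_eq_left (not_lt.mp h1), Function.update_eq_self] at h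

namespace Par

/-- The values of the registers that stay constant after the header has been read. -/
structure Consts (P : Par) (ρ : ℕ → ℕ) : Prop where
  n_eq : ρ 1 = P.n
  w_eq : ρ 2 = P.w
  b_eq : ρ 3 = P.b
  s_eq : ρ 4 = P.s
  S_eq : ρ 5 = P.S
  F_eq : ρ 6 = P.F
  g_eq : ρ 7 = P.g
  β_eq : ρ 8 = P.β
  tabPos_eq : ρ 9 = P.tabPos
  dirPos_eq : ρ 10 = P.dirPos
  one_eq : ρ 11 = 1

theorem Consts.congr {P : Par} {ρ ρ' : ℕ → ℕ} (h : P.Consts ρ) (hk : ∀ k < 12, ρ' k = ρ k) :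
    P.Consts ρ' := by
  refine ⟨?_, ?_, ?_, ?_, ?_, ?_, ?_, ?_, ?_, ?_, ?_⟩ <;> rw [hk _ (by norm_num)]
  exacts [h.n_eq, h.w_eq, h.b_eq, h.s_eq, h.S_eq, h.F_eq, h.g_eq, h.β_eq, h.tabPos_eq, h.dirPos_eq, h.one_eq]

/-- The environment of the query program: the data structure in memory, and access to the suffix
array. -/
def env (P : Par) (sa : BitVec P.w → BitVec P.w) (tA : ℕ) : Env P.w := ⟨memory P.w P.data, sa, tA⟩

variable {P : Par} {X : ℕ → ℕ} {sa : BitVec P.w → BitVec P.w} {tA : ℕ} {ρ : ℕ → ℕ}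

theorem Ok.pow_le (h : P.Ok X) : 4 * 2 ^ P.g ≤ 2 ^ P.w := by
  rw [show 4 * 2 ^ P.g = 2 ^ (P.g + 2) by ring]
  exact Nat.pow_le_pow_right (by norm_num) (by have := h.g_lt; omega)

theorem Ok.w_lt (h : P.Ok X) : P.w + 2 ^ P.g < 2 ^ P.w := by
  have h1 := h.pow_le
  have h2 := two_mul_le_two_pow h.w_ge
  omega

/-- Fields of the header, of the table and of the directory have positions that fit into a word. -/
theorem Ok.read_front (h : P.Ok X) {x l : Ex} {nx nl v : ℕ} (hw : ρ 2 = P.w)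
    (hx : Ev (P.env sa tA) ρ x nx) (hl : Ev (P.env sa tA) ρ l nl) (hlw : nl ≤ P.w)
    (hxw : nx < 2 ^ P.w) (hv : Fld P.data nx nl v) :
    Ev (P.env sa tA) ρ (readE κ 0 x l) v := by
  have h0 := h.w_ge
  have h2 := two_mul_le_two_pow h0
  refine Ev.read hw (Ev.num (by positivity)) hx hl hlw (by omega) ?_ (by simpa using hv)
  have : nx / P.w ≤ nx / 4 := Nat.div_le_div_left h0 (by norm_num)
  omega

/-- Positions in the bodies of the superblocks may exceed the word size. They are given by the
address of a memory word, in register `20`, and an offset that fits into a word, in register `21`. -/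
theorem Ok.read_body (h : P.Ok X) {u : ℕ} (hu : u < P.m) {x l : Ex} {nx nl v : ℕ}
    (hw : ρ 2 = P.w) (h20 : ρ 20 = P.addr u / P.w) (h21 : ρ 21 = P.addr u % P.w)
    (hx : Ev (P.env sa tA) ρ x nx) (hl : Ev (P.env sa tA) ρ l nl) (hlw : nl ≤ P.w)
    (hb : nx ≤ (P.body u).length) (hv : Fld P.data (P.addr u + nx) nl v) :
    Ev (P.env sa tA) ρ (readE (r 20) (r 21 + x) l) v := by
  have h0 := h.w_ge
  have h1 := h.w_lt
  have h2 := h.body_lt u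
  have h3 : P.addr u % P.w < P.w := Nat.mod_lt _ (by omega)
  have h4 := P.addr_body_le hu
  have h5 := h.total
  have h6 := Nat.div_add_mod (P.addr u) P.w
  have h7 : P.addr u / P.w * P.w + (P.addr u % P.w + nx) = P.addr u + nx := by
    rw [← Nat.add_assoc, Nat.div_add_mod']
  refine Ev.read hw (Ev.reg (by norm_num) h20)
    ((Ev.reg (by norm_num) h21).add hx (by omega)) hl hlw (by omega) ?_ ?_
  · refine lt_of_le_of_lt (Nat.add_le_add_right ?_ 1) h5
    rw [← Nat.mul_add_div (by omega : P.w > 0), Nat.mul_comm, h7]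
    exact Nat.div_le_div_right (by omega)
  · rwa [h7]

theorem Ok.dirPos_add_le (h : P.Ok X) {u : ℕ} (hu : u < P.m) :
    P.dirPos + u * (4 * P.F) + 4 * P.F < 2 ^ P.w := by
  refine lt_of_le_of_lt ?_ h.front
  rw [dirEnd, Nat.add_assoc, ← Nat.succ_mul]
  exact Nat.add_le_add_left (Nat.mul_le_mul_right _ hu) _

theorem Ok.wp_dir (h : P.Ok X) (hc : P.Consts ρ) {x : ℕ} (h18 : ρ 18 = x) (hx : x / P.S < P.m) :
    WP (P.env sa tA) (block dirProg) (block dirProg).cost (fun ρ' => (∀ k < 20, ρ' k = ρ k) ∧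
      ρ' 20 = P.addr (x / P.S) / P.w ∧ ρ' 21 = P.addr (x / P.S) % P.w ∧
      ρ' 22 = P.Φ (x / P.S * P.S) ∧ ρ' 23 = P.wid (x / P.S)) ρ := by
  obtain ⟨f0, f1, f2, f3⟩ := h.fld_dir hx
  have hF := h.F_le
  have hb := h.dirPos_add_le hx
  have hw := two_mul_le_two_pow h.w_ge
  have h4 : 4 < 2 ^ P.w := by have := h.w_ge; omega
  have hF4 : 4 * P.F < 2 ^ P.w := by omega
  refine WP.asg_cons (x := P.dirPos + x / P.S * (4 * P.F)) ?_ ?_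
  · exact (Ev.reg (by norm_num) hc.dirPos_eq).add (((Ev.reg (by norm_num) h18).div
      (Ev.reg (by norm_num) hc.S_eq)).mul ((Ev.num (by omega)).mul (Ev.reg (by norm_num) hc.F_eq) hF4)
      (by omega)) (by omega)
  refine WP.asg_cons (x := P.addr (x / P.S) / P.w) ?_ ?_
  · exact h.read_front (by simp [hc.w_eq]) (Ev.reg (by norm_num) (by simp))
      (Ev.reg (by norm_num) (by simp [hc.F_eq])) hF (by omega) f0
  refine WP.asg_cons (x := P.addr (x / P.S) % P.w) ?_ ?_
  · exact h.read_front (by simp [hc.w_eq]) ((Ev.reg (by norm_num) (by simp)).add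
      (Ev.reg (by norm_num) (by simp [hc.F_eq])) (by omega))
      (Ev.reg (by norm_num) (by simp [hc.F_eq])) hF (by omega) f1
  refine WP.asg_cons (x := P.Φ (x / P.S * P.S)) ?_ ?_
  · exact h.read_front (by simp [hc.w_eq]) ((Ev.reg (by norm_num) (by simp)).add
      ((Ev.num (by omega)).mul (Ev.reg (by norm_num) (by simp [hc.F_eq])) (by omega)) (by omega))
      (Ev.reg (by norm_num) (by simp [hc.F_eq])) hF (by omega) f2
  refine WP.asg_cons (x := P.wid (x / P.S)) ?_ ?_
  · exact h.read_front (by simp [hc.w_eq]) ((Ev.reg (by norm_num) (by simp)).add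
      ((Ev.num (by omega)).mul (Ev.reg (by norm_num) (by simp [hc.F_eq])) (by omega)) (by omega))
      (Ev.reg (by norm_num) (by simp [hc.F_eq])) hF (by omega) f3
  refine WP.nil ⟨fun k hk => ?_, ?_, ?_, ?_, ?_⟩
  · simp only [Function.update_apply]
    repeat rw [if_neg (by omega)]
  all_goals simp

theorem Ok.tab_lt (h : P.Ok X) :
    P.tabPos + P.B * P.b * P.B * P.b * P.g < 2 ^ P.w ∧
    P.B * P.b * P.B * P.b ≤ P.B * P.b * P.B * P.b * P.g ∧
    P.B * P.b * P.B ≤ P.B * P.b * P.B * P.b ∧ P.B * P.b ≤ P.B * P.b * P.B ∧ P.B ≤ P.B * P.b := by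
  have hB : 0 < P.B := by simp [B]
  have hg : 0 < P.g := by
    by_contra hc
    have h3 : P.g = 0 := by omega
    have h4 := h.hS
    have := h.S_pos
    rw [h3] at h4; simp at h4; omega
  exact ⟨lt_of_le_of_lt (Nat.le_add_right _ _) h.front, Nat.le_mul_of_pos_right _ hg,
    Nat.le_mul_of_pos_right _ h.b_pos, Nat.le_mul_of_pos_right _ hB,
    Nat.le_mul_of_pos_right _ h.b_pos⟩

theorem Ok.wp_hdr (h : P.Ok X) (h1 : ρ 1 = P.n) (h2 : ρ 2 = P.w) :
    WP (P.env sa tA) (block hdrProg) (block hdrProg).cost (fun ρ' => P.Consts ρ' ∧ ρ' 0 = ρ 0)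
      ρ := by
  have hw := h.w_ge
  have hwl := h.w_lt
  have hgl := h.g_lt
  have hF := h.F_le
  have hg := h.g_le
  have hw2 := two_mul_le_two_pow hw
  have h2g : 2 ^ (P.g + 1) < 2 ^ P.w := Nat.pow_lt_pow_right (by norm_num) (by omega)
  obtain ⟨f0, f1, f2, f3, f4, f5⟩ := h.fld_hdr
  have hgw : P.g < 2 ^ P.w := by omega
  have htab : P.tabPos < 2 ^ P.w := by
    have := h.front; simp only [dirEnd, dirPos] at this; omega
  have htab' : 7 * P.g + 1 < 2 ^ P.w := htab
  set N := ((P.env sa tA).mem (BitVec.ofNat P.w 0)).toNat with hN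
  have hbit : ∀ j < P.w, N.testBit j = P.data.getD j false := by
    intro j hj
    rw [hN, BitVec.testBit_toNat]
    change (memory _ _ _).getLsbD j = _
    rw [getLsbD_memory _ (by positivity)]
    simp [hj]
  have hxor : N ^^^ (N - 1) = 2 ^ (P.g + 1) - 1 := testBit_xor_pred
    (fun j hj => (hbit j (by omega)).trans (getD_data_lt hj))
    ((hbit _ (by omega)).trans getD_data_self)
  have hN0 : 1 ≤ N := by
    by_contra hc
    have : N = 0 := by omega
    have h3 := (hbit P.g (by omega)).trans getD_data_self
    rw [this] at h3; simp at h3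
  have hp1 : 0 < 2 ^ (P.g + 1) := by positivity
  have hgv : N / 2 ^ (P.g + 1) % (2 ^ (P.g + 1) / 2) = P.g := by
    rw [pow_succ 2 P.g, Nat.mul_div_cancel _ (by norm_num), ← pow_succ]
    apply Nat.eq_of_testBit_eq
    intro j
    rw [Nat.testBit_mod_two_pow, Nat.testBit_div_two_pow, f0 j]
    by_cases hj : j < P.g
    · rw [hbit _ (by omega), Nat.add_comm j]
    · simp [hj]
  refine WP.asg_cons (x := N) (Ev.ld (Ev.num (by positivity))) ?_
  refine WP.asg_cons (x := 2 ^ (P.g + 1)) ?_ ?_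
  · have e1 : Ev (P.env sa tA) (Function.update ρ 20 N) (r 20) N :=
      Ev.reg (by norm_num) (by simp)
    have e2 := (e1.xor (e1.sub (Ev.num (by omega)) hN0)).cast hxor
    exact (e2.add (Ev.num (by omega)) (by omega)).cast (by omega)
  refine WP.asg_cons (x := P.g) ?_ ?_
  · have e1 : Ev (P.env sa tA) (Function.update (Function.update ρ 20 N) 21 (2 ^ (P.g + 1)))
      (r 21) (2 ^ (P.g + 1)) := Ev.reg (by norm_num) (by simp)
    exact (((Ev.reg (by norm_num) (by simp)).div e1).mod
      (e1.div (Ev.num (by omega)))).cast hgv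
  have rd : ∀ {c v : ℕ} {ρ : ℕ → ℕ}, c ≤ 7 → ρ 2 = P.w → ρ 7 = P.g →
      Fld P.data (c * P.g + 1) P.g v →
      Ev (P.env sa tA) ρ (readE κ 0 (κ c * r 7 + κ 1) (r 7)) v := by
    intro c v ρ hc h2 h7 hf
    have : c * P.g ≤ 7 * P.g := Nat.mul_le_mul_right _ hc
    exact h.read_front h2 (((Ev.num (by omega)).mul (Ev.reg (by norm_num) h7) (by omega)).add
      (Ev.num (by omega)) (by omega)) (Ev.reg (by norm_num) h7) (by omega) (by omega) hf
  refine WP.asg_cons (x := P.b) (rd (c := 2) (by norm_num) (by simp [h2]) (by simp) f1) ?_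
  refine WP.asg_cons (x := P.s) (rd (c := 3) (by norm_num) (by simp [h2]) (by simp) f2) ?_
  refine WP.asg_cons (x := P.S) (rd (c := 4) (by norm_num) (by simp [h2]) (by simp) f3) ?_
  refine WP.asg_cons (x := P.F) (rd (c := 5) (by norm_num) (by simp [h2]) (by simp) f4) ?_
  refine WP.asg_cons (x := P.β) (rd (c := 6) (by norm_num) (by simp [h2]) (by simp) f5) ?_
  refine WP.asg_cons (x := P.tabPos) ?_ ?_
  · exact ((Ev.num (by omega)).mul (Ev.reg (by norm_num) (by simp)) (by omega)).add
      (Ev.num (by omega)) htab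
  obtain ⟨hd, m4, m3, m2, m1⟩ := h.tab_lt
  refine WP.asg_cons (x := P.B) ?_ ?_
  · refine ((Ev.num (c := 1) (by omega)).shl (Ev.reg (x := P.β) (by norm_num) (by simp)) ?_).cast
      (by rw [Nat.one_mul, B])
    rw [Nat.one_mul]
    change P.B < _
    omega
  refine WP.asg_cons (x := P.dirPos) ?_ ?_
  · exact (Ev.reg (by norm_num) (by simp)).add ((((((Ev.reg (by norm_num) (by simp)).mul
      (Ev.reg (by norm_num) (by simp)) (by omega)).mul (Ev.reg (by norm_num) (by simp))
      (by omega)).mul (Ev.reg (by norm_num) (by simp)) (by omega))).mul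
      (Ev.reg (by norm_num) (by simp)) (by omega)) (by omega)
  refine WP.asg_cons (x := 1) (Ev.num (by omega)) ?_
  refine WP.nil ⟨⟨?_, ?_, ?_, ?_, ?_, ?_, ?_, ?_, ?_, ?_, ?_⟩, ?_⟩
  all_goals simp [h1, h2]

theorem Ok.S_div_s (h : P.Ok X) : P.S / P.s = P.b * P.M := by
  rw [S, Nat.mul_right_comm]
  exact Nat.mul_div_cancel _ h.s_pos

theorem Ok.div_b (h : P.Ok X) (x : ℕ) :
    x / P.S * (P.s * P.M) + x % P.S / P.b = x / P.b ∧ x % P.S / P.b < P.s * P.M ∧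
      x % P.S % P.b = x % P.b := by
  have hS : P.S = P.b * (P.s * P.M) := by rw [S, Nat.mul_assoc]
  refine ⟨?_, ?_, ?_⟩
  · conv_rhs => rw [← Nat.div_add_mod x P.S, hS, Nat.mul_assoc, Nat.mul_add_div h.b_pos]
    rw [hS, Nat.mul_comm (P.s * P.M)]
  · rw [Nat.div_lt_iff_lt_mul h.b_pos, Nat.mul_comm, ← hS]
    exact Nat.mod_lt _ h.S_pos
  · rw [hS, Nat.mod_mul_right_mod]

theorem Ok.div_s (h : P.Ok X) (x : ℕ) :
    x / P.S * P.S + x % P.S / P.s * P.s + x % P.s = x ∧ x % P.S / P.s < P.b * P.M := by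
  have hS : P.S = P.s * (P.b * P.M) := by rw [S]; ring
  have h1 : x % P.S % P.s = x % P.s := by rw [hS, Nat.mod_mul_right_mod]
  refine ⟨?_, ?_⟩
  · rw [← h1, Nat.add_assoc, Nat.div_add_mod', Nat.div_add_mod']
  · rw [Nat.div_lt_iff_lt_mul h.s_pos, Nat.mul_comm, ← hS]
    exact Nat.mod_lt _ h.S_pos

theorem Ok.wp_blk (h : P.Ok X) (hc : P.Consts ρ) {x : ℕ} (h18 : ρ 18 = x) (hx : x ≤ P.n) :
    WP (P.env sa tA) (block blkProg) (block blkProg).cost (fun ρ' => (∀ k < 20, ρ' k = ρ k) ∧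
      ρ' 30 = P.cd (x / P.b) ∧ ρ' 31 = x % P.b) ρ := by
  have hu : x / P.S < P.m := Nat.lt_succ_of_le (Nat.div_le_div_right hx)
  refine WP.cons ((h.wp_dir hc h18 hu).mono le_rfl ?_)
  rintro ρ₁ ⟨hk, h20, h21, h22, h23⟩
  replace hc := hc.congr (ρ' := ρ₁) fun k hk' => hk k (by omega)
  replace h18 : ρ₁ 18 = x := (hk 18 (by norm_num)).trans h18
  obtain ⟨e1, hj, -⟩ := h.div_b x
  generalize hud : x / P.S = u at *
  generalize hjd : x % P.S / P.b = j at *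
  have hw := h.w_ge
  have hwl := h.w_lt
  have hww := two_mul_le_two_pow hw
  have hbl := h.body_lt u
  have hSs := h.S_div_s
  have hNF := P.NF_le u
  have hwid := h.wid_le u
  have hF := h.F_le
  have hF' := h.hF
  have k1 : (2 * (P.b * P.M + 1) + j + 1) * P.wid u ≤ P.NF * P.wid u :=
    Nat.mul_le_mul_right _ (by rw [NF]; omega)
  have k0 : (2 * (P.b * P.M + 1) + j) * P.wid u ≤
    (2 * (P.b * P.M + 1) + j + 1) * P.wid u := Nat.mul_le_mul_right _ (by omega)
  have k2 : 2 * (P.b * P.M + 1) + j + 1 ≤ (2 * (P.b * P.M + 1) + j + 1) * P.wid u :=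
    Nat.le_mul_of_pos_right _ (h.wid_pos u)
  have hp1 := P.ptrT_le (u := u) hj.le
  have hp2 := P.ptrT_le (u := u) (Nat.succ_le_of_lt hj)
  have hps := P.ptrT_succ u j
  rw [e1] at hps
  have hlog : 2 ^ Nat.log2 (P.cd (x / P.b)) ≤ P.cd (x / P.b) :=
    Nat.log2_self_le (h.cd_pos _).ne'
  have hcd := h.cd_lt (x / P.b)
  obtain ⟨hd, m4, m3, m2, m1⟩ := h.tab_lt
  have hB : 2 ^ P.β < 2 ^ P.w := by change P.B < _; omega
  have hlw : Nat.log2 (P.cd (x / P.b)) < P.w :=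
    (Nat.pow_lt_pow_iff_right (by norm_num : 1 < 2)).mp ((hlog.trans_lt hcd).trans hB)
  have hSp := h.hS
  have hS2 : P.b * P.M ≤ P.S := by rw [← hSs]; exact Nat.div_le_self _ _
  refine WP.asg_cons (x := 2 * (P.b * P.M + 1) + j) ?_ ?_
  · exact (((Ev.num (by omega)).mul ((((Ev.reg (by norm_num) hc.S_eq).div
      (Ev.reg (by norm_num) hc.s_eq)).cast hSs).add (Ev.num (by omega)) (by omega)) (by omega)).add
      ((((Ev.reg (by norm_num) h18).mod (Ev.reg (by norm_num) hc.S_eq)).div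
      (Ev.reg (by norm_num) hc.b_eq)).cast hjd) (by omega))
  refine WP.asg_cons (x := P.ptrT u j) ?_ ?_
  · exact h.read_body hu (by simp [hc.w_eq]) (by simp [h20]) (by simp [h21])
      ((Ev.reg (x := 2 * (P.b * P.M + 1) + j) (by norm_num) (by simp)).mul
      (Ev.reg (x := P.wid u) (by norm_num) (by simp [h23]))
      (by omega)) (Ev.reg (by norm_num) (by simp [h23])) (by omega) (by omega)
      (h.fld_ptrT hu hj.le)
  refine WP.asg_cons (x := P.ptrT u (j + 1)) ?_ ?_
  · exact h.read_body hu (by simp [hc.w_eq]) (by simp [h20]) (by simp [h21])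
      (((Ev.reg (x := 2 * (P.b * P.M + 1) + j) (by norm_num) (by simp)).add
      (Ev.num (by omega)) (by omega)).mul (Ev.reg (x := P.wid u) (by norm_num) (by simp [h23]))
      (by omega)) (Ev.reg (by norm_num) (by simp [h23])) (by omega) (by omega)
      (h.fld_ptrT hu hj)
  refine WP.asg_cons (x := Nat.log2 (P.cd (x / P.b))) ?_ ?_
  · exact ((Ev.reg (x := P.ptrT u (j + 1)) (by norm_num) (by simp)).sub
      (Ev.reg (x := P.ptrT u j) (by norm_num) (by simp))
      (by omega)).cast (by omega)
  refine WP.asg_cons (x := P.cd (x / P.b)) ?_ ?_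
  · have e2 := h.fld_cw hu hj
    rw [e1] at e2
    have e3 : 1 * 2 ^ Nat.log2 (P.cd (x / P.b)) < 2 ^ P.w := by omega
    refine (((Ev.num (by omega)).shl (Ev.reg (x := Nat.log2 (P.cd (x / P.b))) (by norm_num)
      (by simp)) e3).add (h.read_body hu (nl := Nat.log2 (P.cd (x / P.b))) (by simp [hc.w_eq])
      (by simp [h20]) (by simp [h21])
      (Ev.reg (x := P.ptrT u j) (by norm_num) (by simp)) (Ev.reg (by norm_num) (by simp))
      hlw.le hp1 e2) (by omega)).cast (by omega)
  refine WP.asg_cons (x := x % P.b) ?_ ?_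
  · exact (Ev.reg (by norm_num) (by simp [h18])).mod (Ev.reg (by norm_num) (by simp [hc.b_eq]))
  refine WP.nil ⟨fun k hk' => ?_, ?_, ?_⟩
  · simp only [Function.update_apply]
    repeat rw [if_neg (by omega)]
    exact hk k hk'
  all_goals simp

/-- `phiProg` bounds `Φ x` from both sides, with a gap smaller than `s * b`. It recognizes a large
`s`-block by its nonempty list, and then the bounds are equal. -/
theorem Ok.wp_phi (h : P.Ok X) (hc : P.Consts ρ) {x : ℕ} (h18 : ρ 18 = x) (hx : x ≤ P.n) :
    WP (P.env sa tA) (block phiProg) (block phiProg).cost (fun ρ' => (∀ k < 18, ρ' k = ρ k) ∧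
      ρ' 22 + ρ' 26 ≤ P.Φ x ∧ P.Φ x ≤ ρ' 22 + ρ' 28 ∧ ρ' 22 + ρ' 28 ≤ P.n ∧
      ρ' 28 < ρ' 26 + P.s * P.b) ρ := by
  have hu : x / P.S < P.m := Nat.lt_succ_of_le (Nat.div_le_div_right hx)
  refine WP.cons ((h.wp_dir hc h18 hu).mono le_rfl ?_)
  rintro ρ₁ ⟨hk, h20, h21, h22, h23⟩
  replace hc := hc.congr (ρ' := ρ₁) fun k hk' => hk k (by omega)
  replace h18 : ρ₁ 18 = x := (hk 18 (by norm_num)).trans h18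
  obtain ⟨e1, hj⟩ := h.div_s x
  have ho : x % P.s < P.s := Nat.mod_lt _ h.s_pos
  generalize hud : x / P.S = u at *
  generalize hjd : x % P.S / P.s = j at *
  generalize hod : x % P.s = o at *
  have hw := h.w_ge
  have hwl := h.w_lt
  have hww := two_mul_le_two_pow hw
  have hbl := h.body_lt u
  have hNF := P.NF_le u
  have hwid := h.wid_le u
  have hF := h.F_le
  have k1 : (2 * (j + 1) + 1) * P.wid u ≤ P.NF * P.wid u :=
    Nat.mul_le_mul_right _ (by rw [NF]; omega)
  have k2 : 2 * (j + 1) * P.wid u ≤ (2 * (j + 1) + 1) * P.wid u :=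
    Nat.mul_le_mul_right _ (by omega)
  have k3 : (2 * j + 1) * P.wid u ≤ 2 * (j + 1) * P.wid u := Nat.mul_le_mul_right _ (by omega)
  have k4 : 2 * j * P.wid u ≤ (2 * j + 1) * P.wid u := Nat.mul_le_mul_right _ (by omega)
  have k5 : 2 * (j + 1) + 1 ≤ (2 * (j + 1) + 1) * P.wid u := Nat.le_mul_of_pos_right _ (h.wid_pos u)
  have hp2 := P.ptrL_le (u := u) (Nat.succ_le_of_lt hj)
  have hps := P.ptrL_succ u j
  have hsb : 0 < P.s * P.b := Nat.mul_pos h.s_pos h.b_pos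
  have hs1 := P.s_mul (Nat.succ_le_of_lt hj)
  rw [Nat.succ_eq_add_one] at hs1 hp2
  have hadd : (j + 1) * P.s = j * P.s + P.s := by ring
  have m0 : P.Φ (u * P.S) ≤ P.Φ (u * P.S + j * P.s) := h.mono (by omega)
  have m1 : P.Φ (u * P.S + j * P.s) ≤ P.Φ x := h.mono (by omega)
  have m2 : P.Φ x ≤ P.Φ (u * P.S + (j + 1) * P.s) := h.mono (by omega)
  have m3 := h.Φ_le (u * P.S + (j + 1) * P.s)
  refine WP.asg_cons (x := j) ?_ ?_
  · exact (((Ev.reg (by norm_num) h18).mod (Ev.reg (by norm_num) hc.S_eq)).div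
      (Ev.reg (by norm_num) hc.s_eq)).cast hjd
  refine WP.asg_cons (x := P.Φ (u * P.S + j * P.s) - P.Φ (u * P.S)) ?_ ?_
  · exact h.read_body hu (by simp [hc.w_eq]) (by simp [h20]) (by simp [h21])
      (((Ev.num (by omega)).mul (Ev.reg (x := j) (by norm_num) (by simp)) (by omega)).mul
        (Ev.reg (x := P.wid u) (by norm_num) (by simp [h23])) (by omega))
      (Ev.reg (by norm_num) (by simp [h23])) (by omega) (by omega) (h.fld_sample hu hj.le)
  refine WP.asg_cons (x := P.ptrL u j) ?_ ?_
  · exact h.read_body hu (by simp [hc.w_eq]) (by simp [h20]) (by simp [h21])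
      ((((Ev.num (by omega)).mul (Ev.reg (x := j) (by norm_num) (by simp)) (by omega)).add
        (Ev.num (by omega)) (by omega)).mul
        (Ev.reg (x := P.wid u) (by norm_num) (by simp [h23])) (by omega))
      (Ev.reg (by norm_num) (by simp [h23])) (by omega) (by omega) (h.fld_ptrL hu hj.le)
  refine WP.asg_cons (x := P.Φ (u * P.S + (j + 1) * P.s) - P.Φ (u * P.S)) ?_ ?_
  · exact h.read_body hu (by simp [hc.w_eq]) (by simp [h20]) (by simp [h21])
      (((Ev.num (by omega)).mul ((Ev.reg (x := j) (by norm_num) (by simp)).add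
        (Ev.num (by omega)) (by omega)) (by omega)).mul
        (Ev.reg (x := P.wid u) (by norm_num) (by simp [h23])) (by omega))
      (Ev.reg (by norm_num) (by simp [h23])) (by omega) (by omega) (h.fld_sample hu hj)
  refine WP.asg_cons (x := P.ptrL u (j + 1)) ?_ ?_
  · exact h.read_body hu (by simp [hc.w_eq]) (by simp [h20]) (by simp [h21])
      ((((Ev.num (by omega)).mul ((Ev.reg (x := j) (by norm_num) (by simp)).add
        (Ev.num (by omega)) (by omega)) (by omega)).add (Ev.num (by omega)) (by omega)).mul
        (Ev.reg (x := P.wid u) (by norm_num) (by simp [h23])) (by omega))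
      (Ev.reg (by norm_num) (by simp [h23])) (by omega) (by omega) (h.fld_ptrL hu hj)
  refine WP.cons (WP.ifLt (by norm_num) (by norm_num) (fun hlt => ?_) fun hlt => ?_)
  · have hlt' : P.ptrL u j < P.ptrL u (j + 1) := by simpa using hlt
    have hL : P.Large u j := by
      by_contra hL
      rw [length_lst_of_not_large hL] at hps; omega
    rw [length_lst_of_large hL] at hps
    have k6 : o * P.wid u ≤ P.s * P.wid u := Nat.mul_le_mul_right _ ho.le
    have m4 : P.Φ (u * P.S) ≤ P.Φ x := m0.trans m1
    have hf := h.fld_lst hu hj ho hL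
    rw [e1] at hf
    refine WP.asg_cons (x := P.Φ x - P.Φ (u * P.S)) ?_ ?_
    · exact h.read_body hu (by simp [hc.w_eq]) (by simp [h20]) (by simp [h21])
        ((Ev.reg (x := P.ptrL u j) (by norm_num) (by simp)).add
          ((((Ev.reg (x := x) (by norm_num) (by simp [h18])).mod
            (Ev.reg (x := P.s) (by norm_num) (by simp [hc.s_eq]))).cast hod).mul
            (Ev.reg (x := P.wid u) (by norm_num) (by simp [h23])) (by omega)) (by omega))
        (Ev.reg (by norm_num) (by simp [h23])) (by omega) (by omega) hf
    refine WP.asg_cons (x := P.Φ x - P.Φ (u * P.S)) (Ev.reg (by norm_num) (by simp)) ?_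
    refine WP.asg_cons (x := P.Φ x - P.Φ (u * P.S)) (Ev.reg (by norm_num) (by simp)) ?_
    refine WP.nil (WP.nil ⟨fun k hk' => ?_, ?_⟩)
    · simp only [Function.update_apply]
      repeat rw [if_neg (by omega)]
      exact hk k (by omega)
    · have := h.Φ_le x
      simp [h22]
      have := h.s_pos
      have := h.b_pos
      omega
  · have hlt' : ¬ P.ptrL u j < P.ptrL u (j + 1) := by simpa using hlt
    have hL : ¬ P.Large u j := by
      intro hL
      rw [length_lst_of_large hL] at hps
      have := Nat.mul_pos h.s_pos (h.wid_pos u)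
      omega
    unfold Large at hL
    refine WP.skip (WP.nil ⟨fun k hk' => ?_, ?_⟩)
    · simp only [Function.update_apply]
      repeat rw [if_neg (by omega)]
      exact hk k (by omega)
    · simp [h22]
      omega

/-- `boundProg` bounds the LCP-value `v`. The lower bound on `Φ p` is raised to `p` if it is smaller,
and the upper bound on `v` is lowered to `n - q`, so that the comparison stays inside the text. -/
theorem Ok.wp_bound (h : P.Ok X) (hc : P.Consts ρ) {p q v : ℕ} (h12 : ρ 12 = p) (h13 : ρ 13 = q)
    (hp : p < P.n) (hq : q < P.n) (hv : P.Φ p = v + p) (hvq : v ≤ P.n - q) :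
    WP (P.env sa tA) (block boundProg) (block boundProg).cost (fun ρ' => P.Consts ρ' ∧
      ρ' 12 = p ∧ ρ' 13 = q ∧ ρ' 14 ≤ v ∧ v ≤ ρ' 15 ∧ ρ' 15 ≤ P.n - p ∧ ρ' 15 ≤ P.n - q ∧
      ρ' 15 < ρ' 14 + P.s * P.b) ρ := by
  have hn := h.n_lt
  refine WP.asg_cons (x := p) (Ev.reg (by norm_num) h12) ?_
  refine WP.cons ((h.wp_phi (x := p) (hc.congr fun k hk => ?_) (by simp) hp.le).mono le_rfl ?_)
  · simp only [Function.update_apply]; rw [if_neg (by omega)]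
  rintro ρ₁ ⟨hk, b1, b2, b3, b4⟩
  replace hk : ∀ k < 18, ρ₁ k = ρ k := fun k hk' => by
    rw [hk k hk', Function.update_of_ne (by omega)]
  replace hc := hc.congr (ρ' := ρ₁) fun k hk' => hk k (by omega)
  replace h12 : ρ₁ 12 = p := (hk 12 (by norm_num)).trans h12
  replace h13 : ρ₁ 13 = q := (hk 13 (by norm_num)).trans h13
  refine WP.asg_cons (x := ρ₁ 22 + ρ₁ 26) ((Ev.reg (by norm_num) rfl).add (Ev.reg (by norm_num) rfl)
    (by omega)) ?_
  refine WP.cons (WP.max (by norm_num) (by norm_num) ?_)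
  refine WP.asg_cons (x := max (ρ₁ 22 + ρ₁ 26) p - p) ?_ ?_
  · exact (Ev.reg (by norm_num) (by simp [h12])).sub (Ev.reg (by norm_num) (by simp [h12]))
      (le_max_right _ _)
  refine WP.asg_cons (x := ρ₁ 22 + ρ₁ 28 - p) ?_ ?_
  · exact ((Ev.reg (by norm_num) (by simp)).add (Ev.reg (by norm_num) (by simp)) (by omega)).sub
      (Ev.reg (by norm_num) (by simp [h12])) (by omega)
  refine WP.asg_cons (x := P.n - q) ?_ ?_
  · exact (Ev.reg (by norm_num) (by simp [hc.n_eq])).sub (Ev.reg (by norm_num) (by simp [h13])) hq.le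
  refine WP.cons (WP.min (by norm_num) (by norm_num) (WP.nil ⟨hc.congr fun k hk => ?_, ?_⟩))
  · simp only [Function.update_apply]
    repeat rw [if_neg (by omega)]
  · simp [h12, h13]
    omega

/-- The effect of one round of the comparison, where `t` symbols are known to agree, `U` is the upper
bound, and `l` is the entry of the table. -/
theorem Ok.wp_step (h : P.Ok X) (hc : P.Consts ρ) {p q t : ℕ} (h12 : ρ 12 = p) (h13 : ρ 13 = q)
    (h14 : ρ 14 = t) {U : ℕ} (h15 : ρ 15 = U) (htU : t < U) (hU : U ≤ P.n)
    (hp : p + t ≤ P.n) (hq : q + t ≤ P.n) {l : ℕ}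
    (hl : l = P.tabVal (P.cd ((p + t) / P.b)) ((p + t) % P.b) (P.cd ((q + t) / P.b))
      ((q + t) % P.b)) :
    WP (P.env sa tA) (block stepProg) (block stepProg).cost (fun ρ' => P.Consts ρ' ∧
      ρ' 12 = p ∧ ρ' 13 = q ∧ ρ' 14 = t + min l (U - t) ∧ ρ' 15 = if l < 1 then t else U) ρ := by
  have hn := h.n_lt
  have hbS : P.b ≤ P.S := by
    rw [S, Nat.mul_assoc]; exact Nat.le_mul_of_pos_right _ (Nat.mul_pos h.s_pos h.M_pos)
  have hSw := h.hS
  have hwl := h.w_lt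
  have hgw : P.g ≤ P.w := by have := h.g_lt; omega
  refine WP.asg_cons (x := p + t) ((Ev.reg (by norm_num) h12).add (Ev.reg (by norm_num) h14)
    (by omega)) ?_
  refine WP.cons ((h.wp_blk (x := p + t) (hc.congr fun k hk => ?_) (by simp) hp).mono le_rfl ?_)
  · simp only [Function.update_apply]; rw [if_neg (by omega)]
  rintro ρ₁ ⟨hk, b1, b2⟩
  replace hk : ∀ k < 18, ρ₁ k = ρ k := fun k hk' => by
    rw [hk k (by omega), Function.update_of_ne (by omega)]
  refine WP.asg_cons (x := P.cd ((p + t) / P.b)) (Ev.reg (by norm_num) b1) ?_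
  refine WP.asg_cons (x := (p + t) % P.b) (Ev.reg (by norm_num) (by simp [b2])) ?_
  refine WP.asg_cons (x := q + t) ((Ev.reg (by norm_num) (by simp [hk, h13])).add
    (Ev.reg (by norm_num) (by simp [hk, h14])) (by omega)) ?_
  refine WP.cons ((h.wp_blk (x := q + t) (hc.congr fun k hk' => ?_) (by simp) hq).mono le_rfl ?_)
  · simp only [Function.update_apply]
    repeat rw [if_neg (by omega)]
    exact hk k (by omega)
  rintro ρ₂ ⟨hk₂, c1, c2⟩
  have g16 : ρ₂ 16 = P.cd ((p + t) / P.b) := by rw [hk₂ 16 (by norm_num)]; simp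
  have g17 : ρ₂ 17 = (p + t) % P.b := by rw [hk₂ 17 (by norm_num)]; simp
  replace hk₂ : ∀ k < 16, ρ₂ k = ρ k := fun k hk' => by
    rw [hk₂ k (by omega), Function.update_of_ne (by omega), Function.update_of_ne (by omega),
      Function.update_of_ne (by omega), hk k (by omega)]
  have hc₂ := hc.congr (ρ' := ρ₂) fun k hk' => hk₂ k (by omega)
  have hcd₁ : P.cd ((p + t) / P.b) < P.B := h.cd_lt _
  have hcd₂ : P.cd ((q + t) / P.b) < P.B := h.cd_lt _
  have ho₁ := Nat.mod_lt (p + t) h.b_pos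
  have ho₂ := Nat.mod_lt (q + t) h.b_pos
  obtain ⟨hlt, hf⟩ := h.fld_tab hcd₁ ho₁ hcd₂ ho₂
  obtain ⟨hd, m4, m3, m2, m1⟩ := h.tab_lt
  rw [← hl] at hf
  generalize P.cd ((p + t) / P.b) = x at *
  generalize P.cd ((q + t) / P.b) = y at *
  generalize (p + t) % P.b = o at *
  generalize (q + t) % P.b = o' at *
  have l1 : x * P.b + o ≤ (x * P.b + o) * P.B := Nat.le_mul_of_pos_right _ (by omega)
  have l2 : (x * P.b + o) * P.B + y ≤ ((x * P.b + o) * P.B + y) * P.b :=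
    Nat.le_mul_of_pos_right _ h.b_pos
  have l3 : (((x * P.b + o) * P.B + y) * P.b + o') * P.g ≤ P.B * P.b * P.B * P.b * P.g :=
    Nat.mul_le_mul_right _ hlt.le
  refine WP.asg_cons (x := l) ?_ ?_
  · refine h.read_front hc₂.w_eq ((Ev.reg (x := P.tabPos) (by norm_num) hc₂.tabPos_eq).add
      ((((((((Ev.reg (x := x) (by norm_num) g16).mul (Ev.reg (x := P.b) (by norm_num) hc₂.b_eq)
        (by omega)).add (Ev.reg (x := o) (by norm_num) g17) (by omega)).mul
        (((Ev.num (c := 1) (by omega)).shl (Ev.reg (x := P.β) (by norm_num) hc₂.β_eq) ?_).cast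
        (y := P.B) ?_) (by omega)).add (Ev.reg (x := y) (by norm_num) c1) (by omega)).mul
        (Ev.reg (x := P.b) (by norm_num) hc₂.b_eq) (by omega)).add
        (Ev.reg (x := o') (by norm_num) c2) (by omega)).mul
        (Ev.reg (x := P.g) (by norm_num) hc₂.g_eq) (by omega)) (by omega))
      (Ev.reg (by norm_num) hc₂.g_eq) hgw (by omega) hf
    · rw [Nat.one_mul]; change P.B < _; omega
    · rw [Nat.one_mul]; rfl
  have ht14 : ρ₂ 14 = t := (hk₂ 14 (by norm_num)).trans h14
  have ht15 : ρ₂ 15 = U := (hk₂ 15 (by norm_num)).trans h15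
  refine WP.asg_cons (x := U - t) ((Ev.reg (by norm_num) (by simp [ht15])).sub
    (Ev.reg (by norm_num) (by simp [ht14])) htU.le) ?_
  refine WP.cons (WP.min (by norm_num) (by norm_num) ?_)
  -- the sum stays below `U`, so that it cannot overflow
  refine WP.asg_cons (x := t + min l (U - t)) ((Ev.reg (by norm_num) (by simp [ht14])).add
    (Ev.reg (by norm_num) (by simp)) (by omega)) ?_
  have h11 := hc₂.one_eq
  have fin : ∀ {ρ' : ℕ → ℕ}, (∀ k < 14, ρ' k = ρ₂ k) → ρ' 14 = t + min l (U - t) →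
      ρ' 15 = (if l < 1 then t else U) → P.Consts ρ' ∧ ρ' 12 = p ∧ ρ' 13 = q ∧
      ρ' 14 = t + min l (U - t) ∧ ρ' 15 = if l < 1 then t else U := fun e1 e2 e3 =>
    ⟨hc₂.congr fun k hk' => e1 k (by omega),
      by rw [e1 12 (by norm_num), hk₂ 12 (by norm_num), h12],
      by rw [e1 13 (by norm_num), hk₂ 13 (by norm_num), h13], e2, e3⟩
  refine WP.cons (WP.ifLt (by norm_num) (by norm_num) (fun h1 => ?_) fun h1 => ?_)
  · have h1' : l < 1 := by simp [h11] at h1; omega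
    refine WP.asg (x := t) (Ev.reg (by norm_num) (by simp; omega))
      (WP.nil (fin (fun k hk' => ?_) ?_ ?_))
    · simp only [Function.update_apply]
      repeat rw [if_neg (by omega)]
    · simp
    · rw [if_pos h1']; simp
  · have h1' : ¬ l < 1 := by simp [h11] at h1; omega
    refine WP.skip (WP.nil (fin (fun k hk' => ?_) ?_ ?_))
    · simp only [Function.update_apply]
      repeat rw [if_neg (by omega)]
    · simp
    · rw [if_neg h1']; simp [ht15]

/-- The invariant of the loop, where `v` is the LCP-value that is to be computed and `U` is the
upper bound known at the start. Either the loop has ended with the right value, or the suffixes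
agree on the symbols that have been compared. -/
def LoopInv (P : Par) (X : ℕ → ℕ) (p q v U : ℕ) (ρ : ℕ → ℕ) : Prop :=
  P.Consts ρ ∧ ρ 12 = p ∧ ρ 13 = q ∧
    ((min (ρ 14) (ρ 15) = v ∧ ¬ ρ 14 < ρ 15) ∨
      (ρ 15 = U ∧ 1 < P.s * P.b ∧ ∀ d < ρ 14, X (p + d) = X (q + d)))

open Classical in
/-- The variant of the loop. Every round that does not end the loop moves on to a new block in
one of the two suffixes, or finds the next two symbols to be different. -/
noncomputable def variant (P : Par) (X : ℕ → ℕ) (p q U : ℕ) (ρ : ℕ → ℕ) : ℕ :=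
  if ρ 14 < ρ 15 then
    2 * ((p + U) / P.b + (q + U) / P.b - ((p + ρ 14) / P.b + (q + ρ 14) / P.b)) +
      if X (p + ρ 14) = X (q + ρ 14) then 2 else 1
  else 0

/-- One round of the loop keeps the invariant and decreases the variant. If the table entry is
positive, then the symbols at the current positions agree. The comparison then stops at the end of
a block, which increases the number of the block, or at a mismatch, which removes the last unit from
the variant. -/
theorem Ok.wp_loop_body (h : P.Ok X) {p q v U : ℕ} (hvU : v ≤ U) (hUp : U ≤ P.n - p)
    (hUq : U ≤ P.n - q) (hX : 1 < P.s * P.b → (∀ d < v, X (p + d) = X (q + d)) ∧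
      (v < P.n - p → v < P.n - q → X (p + v) ≠ X (q + v)))
    (hI : P.LoopInv X p q v U ρ) (hlt : ρ 14 < ρ 15) :
    WP (P.env sa tA) (block stepProg) (block stepProg).cost (fun ρ' => P.LoopInv X p q v U ρ' ∧
      P.variant X p q U ρ' < P.variant X p q U ρ) ρ := by
  classical
  obtain ⟨hc, h12, h13, ⟨-, hI⟩ | ⟨h15, hsb, hm⟩⟩ := hI
  · exact absurd hlt hI
  generalize ht : ρ 14 = t at *
  rw [h15] at hlt
  obtain ⟨x1, x2⟩ := hX hsb
  have tv : t ≤ v := by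
    by_contra hc
    exact x2 (by omega) (by omega) (hm v (by omega))
  obtain ⟨t1, t2, t3, t4⟩ := h.tabVal_spec (p := p + t) (q := q + t)
  refine (h.wp_step hc h12 h13 ht h15 hlt (by omega) (by omega) (by omega) rfl).mono le_rfl ?_
  generalize P.tabVal (P.cd ((p + t) / P.b)) ((p + t) % P.b) (P.cd ((q + t) / P.b))
      ((q + t) % P.b) = l at *
  have hb := h.b_pos
  have hpm := Nat.mod_lt (p + t) hb
  have hqm := Nat.mod_lt (q + t) hb
  rintro ρ' ⟨c0, c12, c13, c14, c15⟩
  have hpos : 0 < P.variant X p q U ρ := by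
    unfold variant; rw [ht, h15, if_pos hlt]; split_ifs <;> omega
  by_cases hl : l < 1
  · rw [if_pos hl] at c15
    have hl0 : l = 0 := by omega
    subst hl0
    have hne := t4 (by omega) (by omega)
    rw [Nat.add_zero, Nat.add_zero] at hne
    have hv : v = t := by
      by_contra hc
      exact hne (x1 t (by omega))
    refine ⟨⟨c0, c12, c13, .inl ⟨by rw [c14, c15]; simp [hv], by rw [c14, c15]; simp⟩⟩, ?_⟩
    unfold variant at hpos ⊢
    rwa [if_neg (by rw [c14, c15]; simp)]
  · rw [if_neg hl] at c15
    refine ⟨⟨c0, c12, c13, .inr ⟨c15, hsb, fun d hd => ?_⟩⟩, ?_⟩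
    · by_cases hdt : d < t
      · exact hm d hdt
      · have := t1 (d - t) (by omega)
        rwa [Nat.add_assoc, Nat.add_assoc, Nat.add_sub_cancel' (by omega)] at this
    · unfold variant at hpos ⊢
      by_cases hlt' : ρ' 14 < ρ' 15
      swap
      · rwa [if_neg hlt']
      rw [if_pos hlt', ht, h15, if_pos hlt]
      have e14 : ρ' 14 = t + l := by omega
      rw [e14, ← Nat.add_assoc, ← Nat.add_assoc]
      have m1 : (p + t) / P.b ≤ (p + t + l) / P.b := Nat.div_le_div_right (by omega)
      have m2 : (q + t) / P.b ≤ (q + t + l) / P.b := Nat.div_le_div_right (by omega)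
      have m3 : (p + t + l) / P.b ≤ (p + U) / P.b := Nat.div_le_div_right (by omega)
      have m4 : (q + t + l) / P.b ≤ (q + U) / P.b := Nat.div_le_div_right (by omega)
      have hXt : X (p + t) = X (q + t) := by simpa using t1 0 (by omega)
      rw [if_pos hXt]
      by_cases f1 : l < P.b - (p + t) % P.b
      · by_cases f2 : l < P.b - (q + t) % P.b
        · rw [if_neg (t4 f1 f2)]
          omega
        · have e1 : (q + t + l) / P.b = (q + t) / P.b + 1 := by
            rw [← div_add_sub_mod hb, show l = P.b - (q + t) % P.b by omega]
          split_ifs <;> omega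
      · have e1 : (p + t + l) / P.b = (p + t) / P.b + 1 := by
          rw [← div_add_sub_mod hb, show l = P.b - (p + t) % P.b by omega]
        split_ifs <;> omega

/-- The constant in the running time of the query program. -/
def timeConst : ℕ :=
  (asg 11 (κ 1)).cost + (block hdrProg).cost + (acc 12 (r 0)).cost + (acc 13 (r 0 - κ 1)).cost +
    (block boundProg).cost + outProg.cost + (block stepProg).cost + 10

/-- The symbols between the two bounds meet at most `s` block boundaries in each suffix. -/
theorem variant_le (h : P.Ok X) {p q U : ℕ} (hU : U < ρ 14 + P.s * P.b) (h15 : ρ 15 = U) :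
    P.variant X p q U ρ ≤ 4 * P.s + 2 := by
  have hb := h.b_pos
  have key : ∀ x, (x + U) / P.b ≤ (x + ρ 14) / P.b + P.s := by
    intro x
    rw [← Nat.add_mul_div_right _ _ hb]
    exact Nat.div_le_div_right (by omega)
  have := key p
  have := key q
  unfold variant
  split_ifs <;> omega

/-- The query program is correct and fast: for a position `i > 0` it computes `v`, where the
neighbouring suffixes start at `q` and `p`, and where `Φ p = v + p`. The symbols of the text matter
only if `s * b > 1`. -/
theorem Ok.wp_query (h : P.Ok X) (h1 : ρ 1 = P.n) (h2 : ρ 2 = P.w) {i p q v : ℕ} (h0 : ρ 0 = i)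
    (hi : i < P.n) (hv0 : i = 0 → v = 0)
    (hq : 0 < i → (sa (BitVec.ofNat P.w i)).toNat = p ∧
      (sa (BitVec.ofNat P.w (i - 1))).toNat = q ∧ p < P.n ∧ q < P.n ∧ P.Φ p = v + p ∧ v ≤ P.n - q ∧
      (1 < P.s * P.b → (∀ d < v, X (p + d) = X (q + d)) ∧
        (v < P.n - p → v < P.n - q → X (p + v) ≠ X (q + v)))) :
    WP (P.env sa tA) query (timeConst * (4 * P.s + 4) + 2 * tA) (fun ρ' => ρ' 0 = v) ρ := by
  have hn := h.n_lt
  set c := (block stepProg).cost with hcdef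
  have hw1 : 1 < 2 ^ P.w := by omega
  refine WP.mono (WP.seq (t' := 1 + ((block hdrProg).cost + (((acc 12 (r 0)).cost + tA) +
    (((acc 13 (r 0 - κ 1)).cost + tA) + ((block boundProg).cost + (((4 * P.s + 2) * (c + 1) + 1) +
      outProg.cost))))) + 1) (WP.asg (v := 11) (Ev.num hw1) ?_)) ?_ (fun _ h => h)
  swap
  · have : timeConst * (4 * P.s + 4) = timeConst * (4 * P.s + 3) + timeConst := by ring
    have h3 : (c + 10) * (4 * P.s + 3) ≤ timeConst * (4 * P.s + 3) :=
      Nat.mul_le_mul_right _ (by unfold timeConst; omega)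
    have h4 : (c + 10) * (4 * P.s + 3) = (4 * P.s + 2) * (c + 1) + c + 36 * P.s + 28 := by ring
    rw [this]
    have h5 : timeConst = (asg 11 (κ 1)).cost + (block hdrProg).cost + (acc 12 (r 0)).cost +
      (acc 13 (r 0 - κ 1)).cost + (block boundProg).cost + outProg.cost + c + 10 := rfl
    omega
  refine WP.ifLt (by norm_num) (by norm_num) (fun hlt => WP.skip ?_) fun hlt => ?_
  · simp [h0] at hlt
    simp [h0, hlt, hv0]
  · simp [h0] at hlt
    obtain ⟨a1, a2, hp, hq', hv, hvq, hX⟩ := hq (by omega)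
    refine WP.seq ((h.wp_hdr (by simp [h1]) (by simp [h2])).mono le_rfl ?_)
    rintro ρ₁ ⟨hc, b0⟩
    replace b0 : ρ₁ 0 = i := by rw [b0]; simp [h0]
    refine WP.seq (WP.acc (x := i) (Ev.reg (by norm_num) b0) ?_)
    refine WP.seq (WP.acc (x := i - 1) ((Ev.reg (by norm_num) (by simp [b0])).sub (Ev.num hw1)
      (by omega)) ?_)
    refine WP.seq ((h.wp_bound (p := p) (q := q) (v := v) (hc.congr fun k hk => ?_) ?_ ?_ hp hq' hv
      hvq).mono le_rfl ?_)
    · simp only [Function.update_apply]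
      repeat rw [if_neg (by omega)]
    · simp [env, a1]
    · simp [env, a2]
    rintro ρ₂ ⟨hc₂, d12, d13, d14, d15, dp, dq, dsb⟩
    have hI : P.LoopInv X p q v (ρ₂ 15) ρ₂ := by
      refine ⟨hc₂, d12, d13, ?_⟩
      by_cases hsb : 1 < P.s * P.b
      · exact .inr ⟨rfl, hsb, fun d hd => (hX hsb).1 d (by omega)⟩
      · exact .inl ⟨by omega, by omega⟩
    refine WP.seq ((WP.whileLt (P.LoopInv X p q v (ρ₂ 15)) (P.variant X p q (ρ₂ 15)) (c := c)
      (by norm_num) (by norm_num) (fun ρ' hI' hl => h.wp_loop_body d15 dp dq hX hI' hl) hI).mono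
      ?_ ?_)
    · exact Nat.add_le_add_right (Nat.mul_le_mul_right _ (variant_le h dsb rfl)) _
    · rintro ρ₃ ⟨⟨-, -, -, hI₃⟩, hge⟩
      have hfin : min (ρ₃ 14) (ρ₃ 15) = v := by
        rcases hI₃ with ⟨h3, -⟩ | ⟨e15, hsb, hm⟩
        · exact h3
        · obtain ⟨x1, x2⟩ := hX hsb
          have hvU : v = ρ₂ 15 := by
            by_contra hne
            exact x2 (by omega) (by omega) (hm v (by omega))
          omega
      refine WP.ifLt (by norm_num) (by norm_num)
        (fun hl => WP.asg (x := ρ₃ 15) (Ev.reg (by norm_num) rfl) ?_)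
        (fun hl => WP.asg (x := ρ₃ 14) (Ev.reg (by norm_num) rfl) ?_)
      · simp; omega
      · simp; omega

end Par

end Query

/-! ### The LCP-array in text order -/

/-- If `l ≤ m ≤ k` lexicographically, then `m` shares at least as long a prefix with `k` as `l`
does. -/
theorem lcp_le_lcp_of_le {α : Type*} [LinearOrder α] {l m k : List α} (h1 : l ≤ m) (h2 : m ≤ k) :
    lcp l k ≤ lcp m k := by
  induction k generalizing l m with
  | nil => cases l <;> simp [lcp]
  | cons c k ih =>
    cases l with
    | nil => simp [lcp]
    | cons a l =>
      by_cases hac : a = c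
      · subst hac
        cases m with
        | nil => exact absurd (List.nil_lt_cons a l) (not_lt.mpr h1)
        | cons b m =>
          rw [← not_lt, List.cons_lt_cons_iff, not_or] at h1 h2
          have hab : a = b := le_antisymm (not_lt.mp h1.1) (not_lt.mp h2.1)
          subst hab
          simp only [lcp, if_true, Nat.add_le_add_iff_right]
          exact ih (not_lt.mp fun h => h1.2 ⟨rfl, h⟩) (not_lt.mp fun h => h2.2 ⟨rfl, h⟩)
      · simp [lcp, hac]

section Phi

variable {n σ : ℕ} (T : Fin n → Fin σ)

theorem length_suffix (i : Fin n) : (suffix T i).length = n - i := by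
  simp [suffix]

theorem getElem?_suffix (i : Fin n) {d : ℕ} (h : i + d < n) :
    (suffix T i)[d]? = some (T ⟨i + d, h⟩) := by
  simp [suffix, h]

theorem suffix_eq_cons {p : ℕ} (h : p + 1 < n) :
    suffix T ⟨p, Nat.lt_of_succ_lt h⟩ = T ⟨p, Nat.lt_of_succ_lt h⟩ :: suffix T ⟨p + 1, h⟩ := by
  unfold suffix
  rw [List.drop_eq_getElem_cons (by simpa using Nat.lt_of_succ_lt h)]
  simp

theorem lcpArray_le (i : Fin n) : lcpArray T i + suffixArray T i ≤ n := by
  have h1 := (suffixArray T i).isLt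
  obtain ⟨i, hi⟩ := i
  cases i with
  | zero => simp [lcpArray]
  | succ m =>
    have h2 := lcp_le_right (suffix T (suffixArray T ⟨m, Nat.lt_of_succ_lt hi⟩))
      (suffix T (suffixArray T ⟨m + 1, hi⟩))
    rw [length_suffix] at h2
    simp only [lcpArray]
    omega

/-- The LCP-values in text order, plus the position. -/
def phi (p : ℕ) : ℕ :=
  if h : p < n then lcpArray T ((suffixArray T).symm ⟨p, h⟩) + p else n

theorem phi_le (p : ℕ) : phi T p ≤ n := by
  unfold phi
  split_ifs with h
  · simpa using lcpArray_le T ((suffixArray T).symm ⟨p, h⟩)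
  · exact le_rfl

theorem phi_suffixArray (i : Fin n) :
    phi T (suffixArray T i) = lcpArray T i + suffixArray T i := by
  simp [phi]

/-- If the suffixes at `q` and `p` are neighbours in the suffix array and agree in their first
symbol, then the suffix at `q + 1` is smaller than the one at `p + 1`, so the predecessor of the
latter shares with it all but one of the symbols shared by the suffixes at `q` and `p`. -/
theorem lcpArray_symm_le {p : ℕ} (h : p + 1 < n) :
    lcpArray T ((suffixArray T).symm ⟨p, Nat.lt_of_succ_lt h⟩) ≤
      lcpArray T ((suffixArray T).symm ⟨p + 1, h⟩) + 1 := by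
  have hmono := suffixArray_strictMono T
  obtain ⟨⟨i, hi⟩, hi'⟩ : ∃ i, i = (suffixArray T).symm ⟨p, Nat.lt_of_succ_lt h⟩ := ⟨_, rfl⟩
  rw [← hi']
  replace hi' := ((suffixArray T).eq_symm_apply.mp hi')
  cases i with
  | zero => simp [lcpArray]
  | succ m =>
    simp only [lcpArray]
    rw [hi']
    have hlt : suffix T (suffixArray T ⟨m, Nat.lt_of_succ_lt hi⟩) <
        suffix T (suffixArray T ⟨m + 1, hi⟩) :=
      hmono (show (⟨m, Nat.lt_of_succ_lt hi⟩ : Fin n) < ⟨m + 1, hi⟩ from Nat.lt_succ_self m)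
    rw [hi'] at hlt
    generalize suffixArray T ⟨m, Nat.lt_of_succ_lt hi⟩ = q at hlt ⊢
    obtain ⟨q, hq⟩ := q
    by_cases hqn : q + 1 < n
    swap
    · have := lcp_le_left (suffix T ⟨q, hq⟩) (suffix T ⟨p, Nat.lt_of_succ_lt h⟩)
      rw [length_suffix] at this
      simp only at this
      omega
    rw [suffix_eq_cons T hqn, suffix_eq_cons T h] at hlt ⊢
    by_cases hT : T ⟨q, hq⟩ = T ⟨p, Nat.lt_of_succ_lt h⟩
    swap
    · simp [lcp, hT]
    simp only [lcp, hT, if_true, Nat.add_le_add_iff_right]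
    rw [hT, List.cons_lt_cons_iff] at hlt
    replace hlt := (hlt.resolve_left (lt_irrefl _)).2
    obtain ⟨⟨j, hj⟩, hj'⟩ : ∃ j, j = (suffixArray T).symm ⟨p + 1, h⟩ := ⟨_, rfl⟩
    obtain ⟨⟨k, hk⟩, hk'⟩ : ∃ k, k = (suffixArray T).symm ⟨q + 1, hqn⟩ := ⟨_, rfl⟩
    rw [← hj']
    replace hj' := ((suffixArray T).eq_symm_apply.mp hj')
    replace hk' := ((suffixArray T).eq_symm_apply.mp hk')
    rw [← hj', ← hk'] at hlt
    have hkj : k < j := hmono.lt_iff_lt.mp hlt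
    cases j with
    | zero => omega
    | succ j =>
      simp only
      rw [← hj', ← hk']
      refine lcp_le_lcp_of_le ?_ ?_
      · exact hmono.monotone (show (⟨k, hk⟩ : Fin n) ≤ ⟨j, _⟩ from Nat.le_of_lt_succ hkj)
      · exact hmono.monotone (show (⟨j, _⟩ : Fin n) ≤ ⟨j + 1, hj⟩ from Nat.le_succ j)

theorem phi_mono : Monotone (phi T) := by
  refine monotone_nat_of_le_succ fun p => ?_
  by_cases h : p + 1 < n
  · have := lcpArray_symm_le T h
    simp only [phi, h, Nat.lt_of_succ_lt h, dif_pos]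
    omega
  · refine (phi_le T p).trans ?_
    simp [phi, h]

/-- The text as a sequence of numbers, continued by zeros. -/
def text (p : ℕ) : ℕ := if h : p < n then T ⟨p, h⟩ else 0

theorem lcp_suffix_spec (q p : Fin n) :
    let v := lcp (suffix T q) (suffix T p)
    v ≤ n - q ∧ (∀ d < v, text T (p + d) = text T (q + d)) ∧
      (v < n - p → v < n - q → text T (p + v) ≠ text T (q + v)) := by
  intro v
  have h1 : v ≤ n - q := by simpa [length_suffix] using lcp_le_left (suffix T q) (suffix T p)
  have h2 : v ≤ n - p := by simpa [length_suffix] using lcp_le_right (suffix T q) (suffix T p)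
  refine ⟨h1, fun d hd => ?_, fun h3 h4 => ?_⟩
  · have := getElem?_lcp_eq hd
    have e1 : q + d < n := by omega
    have e2 : p + d < n := by omega
    rw [getElem?_suffix T q e1, getElem?_suffix T p e2, Option.some.injEq] at this
    simp [text, e1, e2, this]
  · have := getElem?_lcp_ne (l := suffix T q) (m := suffix T p) (by rwa [length_suffix])
      (by rwa [length_suffix])
    have e1 : q + v < n := by omega
    have e2 : p + v < n := by omega
    change (suffix T q)[v]? ≠ (suffix T p)[v]? at this
    rw [getElem?_suffix T q e1, getElem?_suffix T p e2, ne_eq, Option.some.injEq] at this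
    simp only [text, e1, e2, dif_pos]
    exact fun h => this (Fin.ext h.symm)

/-- Correctness and running time of the query program for the LCP-array of a text. -/
theorem Par.Ok.answers {P : Par} {X : ℕ → ℕ} (h : P.Ok X) {T : Fin P.n → Fin σ}
    (hΦ : P.Φ = phi T) (hX : 1 < P.s * P.b → ∀ p < P.n, X p = text T p) (i : Fin P.n) (tA : ℕ) :
    ∃ t, Answers query P.w T P.data tA i (lcpArray T i) t ∧
      t ≤ timeConst * (4 * P.s + 4) + 2 * tA := by
  have hn := h.n_lt
  have hww := two_mul_le_two_pow h.w_ge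
  have hsa : ∀ j : Fin P.n, (suffixArrayWords P.w T (BitVec.ofNat P.w j)).toNat =
      suffixArray T j := by
    intro j
    have e1 : (j : ℕ) < 2 ^ P.w := by omega
    have e2 : (suffixArray T j : ℕ) < 2 ^ P.w := by omega
    simp [suffixArrayWords, Nat.mod_eq_of_lt e1, Nat.mod_eq_of_lt e2]
  set ρ : ℕ → ℕ := fun k => (initRegs P.w P.n i k).toNat with hρ
  have hwp := h.wp_query (sa := suffixArrayWords P.w T) (tA := tA) (ρ := ρ) (i := i)
    (p := suffixArray T i) (q := suffixArray T ⟨i - 1, by omega⟩) (v := lcpArray T i)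
    (by simp [hρ, initRegs, Nat.mod_eq_of_lt hn])
    (by simp [hρ, initRegs])
    (by simp [hρ, initRegs, Nat.mod_eq_of_lt (i.isLt.trans hn)])
    i.isLt ?_ ?_
  · obtain ⟨r', t, ρ', h1, h2, h3, h4⟩ := hwp (initRegs P.w P.n i) fun k _ => rfl
    exact ⟨t, ⟨r', h2, (h3 0 (by norm_num)).trans h4⟩, h1⟩
  · intro hi
    obtain ⟨i, hi'⟩ := i
    simp only at hi
    subst hi
    rfl
  · intro hi
    obtain ⟨v1, v2, v3⟩ := lcp_suffix_spec T (suffixArray T ⟨i - 1, by omega⟩) (suffixArray T i)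
    have hv : lcpArray T i = lcp (suffix T (suffixArray T ⟨i - 1, by omega⟩))
        (suffix T (suffixArray T i)) := by
      obtain ⟨i, hi'⟩ := i
      cases i with
      | zero => exact absurd hi (lt_irrefl _)
      | succ m => rfl
    rw [hv]
    have hle := lcp_le_right (suffix T (suffixArray T ⟨i - 1, by omega⟩))
        (suffix T (suffixArray T i))
    rw [length_suffix] at hle
    refine ⟨hsa i, hsa ⟨i - 1, by omega⟩, Fin.isLt _, Fin.isLt _, ?_, v1, fun hsb =>
      ⟨fun d hd => ?_, fun h3 h4 => ?_⟩⟩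
    · rw [hΦ, phi_suffixArray, hv]
    · rw [hX hsb _ (by omega), hX hsb _ (by omega)]
      exact v2 d hd
    · rw [hX hsb _ (by omega), hX hsb _ (by omega)]
      exact v3 h3 h4

end Phi

/-! ### Codes for text blocks and the empirical entropy -/

theorem sum_list_map_filter {ι : Type*} (l : List ι) (p : ι → Bool) (f : ι → ℝ) :
    ((l.filter p).map f).sum = (l.map fun i => if p i then f i else 0).sum := by
  induction l with
  | nil => simp
  | cons a l ih => by_cases h : p a <;> simp [h, ih]

theorem sum_count_mul {A : Type*} [Fintype A] [DecidableEq A] (l : List A) (g : A → ℝ) :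
    ∑ a, (l.count a : ℝ) * g a = (l.map g).sum := by
  induction l with
  | nil => simp
  | cons c l ih =>
    simp only [List.count_cons, List.map_cons, List.sum_cons, ← ih]
    push_cast
    simp only [add_mul, Finset.sum_add_distrib]
    rw [add_comm]
    congr 1
    simp

/-- Symbols can be ranked by decreasing frequency: the frequency of the symbol of rank `i`
(counted from `0`) is at most a fraction `1 / (i + 1)` of the total. -/
theorem exists_rank {A : Type*} [Fintype A] (f : A → ℕ) :
    ∃ rk : A → ℕ, Function.Injective rk ∧ (∀ x, rk x < Fintype.card A) ∧
      ∀ x, (rk x + 1) * f x ≤ ∑ y, f y := by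
  classical
  let e := Fintype.equivFin A
  let f' : Fin (Fintype.card A) → ℕᵒᵈ := fun i => OrderDual.toDual (f (e.symm i))
  let π := Tuple.sort f'
  have hπ : Monotone (f' ∘ π) := Tuple.monotone_sort f'
  refine ⟨fun x => π.symm (e x), fun x y h => ?_, fun x => Fin.isLt _, fun x => ?_⟩
  · exact e.injective (π.symm.injective (Fin.ext h))
  · have h1 : ∑ y, f y = ∑ j, f (e.symm (π j)) :=
      (Equiv.sum_comp (π.trans e.symm) f).symm
    rw [h1]
    calc ((π.symm (e x) : ℕ) + 1) * f x
        = ∑ _j ∈ Finset.Iic (π.symm (e x)), f x := by simp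
      _ ≤ ∑ j ∈ Finset.Iic (π.symm (e x)), f (e.symm (π j)) := by
          refine Finset.sum_le_sum fun j hj => ?_
          have := hπ (Finset.mem_Iic.mp hj)
          simpa [f'] using this
      _ ≤ _ := Finset.sum_le_univ_sum_of_nonneg fun _ => Nat.zero_le _

/-- Gibbs' inequality: the empirical distribution of a sequence gives the shortest ideal code
lengths. -/
theorem sum_log_le {A : Type*} [Fintype A] [DecidableEq A] (N : ℕ) (x : ℕ → A) (p : A → ℝ)
    (hp : ∀ a, 0 ≤ p a) (hp1 : ∑ a, p a ≤ 1) (hx : ∀ J < N, 0 < p (x J)) :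
    ∑ J ∈ Finset.range N,
      Real.logb 2 ((N : ℝ) / ((Finset.range N).filter fun I => x I = x J).card) ≤
    ∑ J ∈ Finset.range N, -Real.logb 2 (p (x J)) := by
  set f : A → ℕ := fun a => ((Finset.range N).filter fun I => x I = a).card with hf
  have hfpos : ∀ J ∈ Finset.range N, 0 < f (x J) := fun J hJ =>
    Finset.card_pos.mpr ⟨J, by simpa using hJ⟩
  have key : ∑ J ∈ Finset.range N, Real.log (N * p (x J) / f (x J)) ≤ 0 := by
    calc ∑ J ∈ Finset.range N, Real.log (N * p (x J) / f (x J))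
        ≤ ∑ J ∈ Finset.range N, (N * p (x J) / f (x J) - 1) := by
          refine Finset.sum_le_sum fun J hJ => Real.log_le_sub_one_of_pos ?_
          have h1 := hfpos J hJ
          have h2 := hx J (Finset.mem_range.mp hJ)
          have h3 : 0 < N := (Nat.zero_le J).trans_lt (Finset.mem_range.mp hJ)
          positivity
      _ = ∑ J ∈ Finset.range N, N * p (x J) / f (x J) - N := by simp
      _ ≤ 0 := by
          rw [Finset.sum_comp (fun a => N * p a / f a) x, sub_nonpos]
          calc ∑ a ∈ (Finset.range N).image x,
                ((Finset.range N).filter fun I => x I = a).card • (N * p a / f a)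
              = ∑ a ∈ (Finset.range N).image x, N * p a := by
                refine Finset.sum_congr rfl fun a ha => ?_
                obtain ⟨J, hJ, rfl⟩ := Finset.mem_image.mp ha
                have h1 : (f (x J) : ℝ) ≠ 0 := by exact_mod_cast (hfpos J hJ).ne'
                change f (x J) • _ = _
                rw [nsmul_eq_mul]
                field_simp
            _ ≤ ∑ a, N * p a := Finset.sum_le_univ_sum_of_nonneg fun a => by
                have := hp a; positivity
            _ = N * ∑ a, p a := by rw [Finset.mul_sum]
            _ ≤ N * 1 := by gcongr
            _ = N := mul_one _
  have h2 : 0 < Real.log 2 := Real.log_pos (by norm_num)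
  rw [← sub_nonpos, ← Finset.sum_sub_distrib]
  calc ∑ J ∈ Finset.range N, (Real.logb 2 ((N : ℝ) / f (x J)) - -Real.logb 2 (p (x J)))
      = ∑ J ∈ Finset.range N, Real.log (N * p (x J) / f (x J)) / Real.log 2 := by
        refine Finset.sum_congr rfl fun J hJ => ?_
        have h1 : (f (x J) : ℝ) ≠ 0 := by exact_mod_cast (hfpos J hJ).ne'
        have h3 := hx J (Finset.mem_range.mp hJ)
        have h4 : (N : ℝ) ≠ 0 := by
          have : 0 < N := (Nat.zero_le J).trans_lt (Finset.mem_range.mp hJ)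
          positivity
        rw [sub_neg_eq_add, ← Real.logb_mul (by positivity) h3.ne', Real.logb]
        congr 2
        ring
    _ = (∑ J ∈ Finset.range N, Real.log (N * p (x J) / f (x J))) / Real.log 2 := by
        rw [Finset.sum_div]
    _ ≤ 0 := div_nonpos_of_nonpos_of_nonneg key h2.le

/-- The probability of the string `l` after the history `h`, if `q h a` is the probability of the
symbol `a` after the history `h`. -/
def strProb {A : Type*} (q : List A → A → ℝ) : List A → List A → ℝ
  | _, [] => 1
  | h, a :: l => q h a * strProb q (h ++ [a]) l

theorem strProb_nonneg {A : Type*} {q : List A → A → ℝ} (hq : ∀ h a, 0 ≤ q h a) :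
    ∀ (l h : List A), 0 ≤ strProb q h l
  | [], _ => zero_le_one
  | a :: l, h => mul_nonneg (hq h a) (strProb_nonneg hq l _)

theorem sum_strProb_le {A : Type*} [Fintype A] {q : List A → A → ℝ} (hq : ∀ h a, 0 ≤ q h a)
    (hq1 : ∀ h, ∑ a, q h a ≤ 1) (b : ℕ) : ∀ h : List A,
    ∑ x : Fin b → A, strProb q h (List.ofFn x) ≤ 1 := by
  induction b with
  | zero => intro h; simp [strProb]
  | succ b ih =>
    intro h
    rw [← (Fin.consEquiv fun _ => A).sum_comp, Fintype.sum_prod_type]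
    calc ∑ a, ∑ x : Fin b → A, strProb q h (List.ofFn (Fin.consEquiv (fun _ => A) (a, x)))
        = ∑ a, q h a * ∑ x : Fin b → A, strProb q (h ++ [a]) (List.ofFn x) := by
          refine Finset.sum_congr rfl fun a _ => ?_
          rw [Finset.mul_sum]
          refine Finset.sum_congr rfl fun x _ => ?_
          simp [Fin.consEquiv, List.ofFn_succ, strProb]
      _ ≤ ∑ a, q h a * 1 := Finset.sum_le_sum fun a _ =>
          mul_le_mul_of_nonneg_left (ih _) (hq h a)
      _ ≤ 1 := by simpa using hq1 h

/-- The `m` terms of the sequence `t` from position `i` on. -/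
def seg {A : Type*} (t : ℕ → A) (i m : ℕ) : List A := (List.range m).map fun o => t (i + o)

@[simp] theorem length_seg {A : Type*} (t : ℕ → A) (i m : ℕ) : (seg t i m).length = m := by
  simp [seg]

theorem seg_succ {A : Type*} (t : ℕ → A) (i m : ℕ) : seg t i (m + 1) = t i :: seg t (i + 1) m := by
  simp only [seg, List.range_succ_eq_map, List.map_cons, List.map_map, Nat.add_zero]
  congr 1
  refine List.map_congr_left fun o _ => ?_
  simp only [Function.comp_apply]
  congr 1
  omega

theorem seg_append {A : Type*} (t : ℕ → A) (i m : ℕ) :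
    seg t i m ++ [t (i + m)] = seg t i (m + 1) := by
  simp [seg, List.range_succ]

theorem drop_seg {A : Type*} (t : ℕ → A) (i j m : ℕ) :
    (seg t i (j + m)).drop j = seg t (i + j) m := by
  induction j generalizing i with
  | zero => simp
  | succ j ih =>
    rw [show j + 1 + m = (j + m) + 1 by ring, seg_succ, List.drop_succ_cons, ih]
    congr 1
    ring

/-- The ideal code length of a string is the sum of those of its symbols. The string is the segment
of `t` from position `i₀ + j` on, with the segment from `i₀` to `i₀ + j` as its history. -/
theorem neg_logb_strProb_seg {A : Type*} {q : List A → A → ℝ} (t : ℕ → A) (i₀ : ℕ) (m : ℕ) :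
    ∀ j, (∀ o < m, 0 < q (seg t i₀ (j + o)) (t (i₀ + (j + o)))) →
      0 < strProb q (seg t i₀ j) (seg t (i₀ + j) m) ∧
      -Real.logb 2 (strProb q (seg t i₀ j) (seg t (i₀ + j) m)) =
        ∑ o ∈ Finset.range m, -Real.logb 2 (q (seg t i₀ (j + o)) (t (i₀ + (j + o)))) := by
  induction m with
  | zero => intro j _; simp [seg, strProb]
  | succ m ih =>
    intro j h
    have h0 := h 0 (Nat.succ_pos _)
    obtain ⟨h1, h2⟩ := ih (j + 1) fun o ho => by
      have := h (o + 1) (by omega)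
      rwa [show j + 1 + o = j + (o + 1) by ring]
    rw [seg_succ, strProb, seg_append, Nat.add_assoc i₀ j 1]
    rw [Nat.add_zero] at h0
    refine ⟨mul_pos h0 h1, ?_⟩
    rw [Real.logb_mul h0.ne' h1.ne', neg_add, h2, Finset.sum_range_succ', Nat.add_zero, add_comm]
    congr 1
    refine Finset.sum_congr rfl fun o _ => ?_
    rw [show j + 1 + o = j + (o + 1) by ring]

section Entropy

variable {n σ : ℕ} (T : Fin n → Fin σ)

/-- The symbols of `T` that are immediately preceded by the string `c`. -/
def followersList (c : List (Fin σ)) : List (Fin σ) :=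
  ((List.finRange n).filter fun i : Fin n => decide (c <:+ (List.ofFn T).take i)).map T

theorem followers_eq {k : ℕ} (c : Fin k → Fin σ) : followers T c = followersList T (List.ofFn c) :=
  rfl

theorem logb_length_div_count_nonneg {A : Type*} [DecidableEq A] (l : List A) (a : A) :
    0 ≤ Real.logb 2 ((l.length : ℝ) / l.count a) := by
  rcases Nat.eq_zero_or_pos (l.count a) with h | h
  · simp [h]
  · refine Real.logb_nonneg (by norm_num) ?_
    rw [one_le_div (by exact_mod_cast h)]
    exact_mod_cast List.count_le_length

theorem length_mul_entropyZero (s : List (Fin σ)) :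
    (s.length : ℝ) * entropyZero s =
      (s.map fun a => Real.logb 2 ((s.length : ℝ) / s.count a)).sum := by
  rw [← sum_count_mul, entropyZero, Finset.mul_sum]
  refine Finset.sum_congr rfl fun a _ => ?_
  rcases Nat.eq_zero_or_pos s.length with h | h
  · rw [List.length_eq_zero_iff] at h; simp [h]
  · have : (s.length : ℝ) ≠ 0 := by positivity
    field_simp

theorem entropyZero_nonneg (s : List (Fin σ)) : 0 ≤ entropyZero s :=
  Finset.sum_nonneg fun _ _ => mul_nonneg (by positivity) (logb_length_div_count_nonneg _ _)

theorem entropy_nonneg (k : ℕ) : 0 ≤ entropy T k :=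
  div_nonneg (Finset.sum_nonneg fun _ _ => mul_nonneg (by positivity) (entropyZero_nonneg _))
    (by positivity)

/-- The ideal code length of the symbol at position `i` after the `k` symbols before it, for the
empirical conditional distribution. Here `t` extends the text to all positions. -/
noncomputable def symCost (t : ℕ → Fin σ) (k i : ℕ) : ℝ :=
  Real.logb 2 (((followersList T (seg t (i - k) k)).length : ℝ) /
    (followersList T (seg t (i - k) k)).count (t i))

variable {T} {t : ℕ → Fin σ} (ht : ∀ i : Fin n, t i = T i)

include ht in
theorem seg_suffix_take {k : ℕ} {i : Fin n} (hk : k ≤ i) :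
    seg t (i - k) k <:+ (List.ofFn T).take i := by
  have h1 : (List.ofFn T).take i = seg t 0 i := by
    apply List.ext_getElem
    · simp
    · intro j h1 h2
      simp only [List.length_take, List.length_ofFn, lt_min_iff] at h1
      have := ht ⟨j, h1.2⟩
      simp [seg, this]
  have h2 := drop_seg t 0 (i - k) k
  rw [Nat.sub_add_cancel hk, Nat.zero_add] at h2
  rw [h1, ← h2]
  exact List.drop_suffix _ _

include ht in
theorem mem_followersList {k : ℕ} {i : Fin n} (hk : k ≤ i) :
    T i ∈ followersList T (seg t (i - k) k) := by
  refine List.mem_map.mpr ⟨i, ?_, rfl⟩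
  simpa using seg_suffix_take ht hk

include ht in
/-- The symbols of the text, coded one by one with the empirical distribution of the followers of
the `k` preceding symbols, need at most `n * entropy T k` bits. -/
theorem sum_symCost_le (k : ℕ) :
    ∑ i ∈ Finset.range n, (if k ≤ i then symCost T t k i else 0) ≤ n * entropy T k := by
  rcases Nat.eq_zero_or_pos n with rfl | hn
  · simp
  have hn' : (n : ℝ) ≠ 0 := by positivity
  rw [entropy, mul_div_cancel₀ _ hn']
  set g : (Fin k → Fin σ) → Fin n → ℝ := fun c i =>
    Real.logb 2 (((followers T c).length : ℝ) / (followers T c).count (T i)) with hg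
  have h1 : ∀ c : Fin k → Fin σ, ((followers T c).length : ℝ) * entropyZero (followers T c) =
      ∑ i : Fin n, if List.ofFn c <:+ (List.ofFn T).take i then g c i else 0 := by
    intro c
    rw [length_mul_entropyZero]
    conv_lhs => enter [1, 2]; rw [followers]
    rw [List.map_map, sum_list_map_filter, Fin.sum_univ_def]
    simp [hg]
  simp only [h1]
  rw [Finset.sum_comm, Finset.sum_range]
  refine Finset.sum_le_sum fun i _ => ?_
  have hnn : ∀ c : Fin k → Fin σ,
      0 ≤ if List.ofFn c <:+ (List.ofFn T).take i then g c i else 0 := by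
    intro c
    split_ifs
    · exact logb_length_div_count_nonneg _ _
    · exact le_rfl
  split_ifs with hk
  · have h2 : List.ofFn (fun j : Fin k => t (i - k + j)) = seg t (i - k) k := by
      apply List.ext_getElem <;> simp [seg]
    refine le_trans (le_of_eq ?_) (Finset.single_le_sum (fun c _ => hnn c)
      (Finset.mem_univ fun j : Fin k => t (i - k + j)))
    rw [h2, if_pos (seg_suffix_take ht hk)]
    simp only [hg, symCost, followers_eq, h2, ht i]
  · exact Finset.sum_nonneg fun c _ => hnn c

theorem sum_range_mul (f : ℕ → ℝ) (N b : ℕ) :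
    ∑ J ∈ Finset.range N, ∑ o ∈ Finset.range b, f (J * b + o) = ∑ i ∈ Finset.range (N * b), f i := by
  induction N with
  | zero => simp
  | succ N ih => rw [Finset.sum_range_succ, ih, Nat.succ_mul, Finset.sum_range_add]

include ht in
/-- A model of order `k` for the blocks of length `b`: the first `k` symbols of a block are
uniformly distributed, every other one follows the empirical distribution of the followers of the
`k` symbols before it. -/
theorem exists_blockProb (hσ : 1 ≤ σ) {b : ℕ} (k : ℕ) :
    ∃ p : (Fin b → Fin σ) → ℝ, (∀ x, 0 ≤ p x) ∧ ∑ x, p x ≤ 1 ∧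
      (∀ J < n / b, 0 < p fun o => t (J * b + o)) ∧
      ∑ J ∈ Finset.range (n / b), -Real.logb 2 (p fun o => t (J * b + o)) ≤
        n * entropy T k + (n / b : ℕ) * (k * Real.logb 2 σ) := by
  classical
  set q : List (Fin σ) → Fin σ → ℝ := fun h a => if h.length < k then 1 / σ else
    ((followersList T (h.drop (h.length - k))).count a : ℝ) /
      (followersList T (h.drop (h.length - k))).length with hq
  have hq0 : ∀ h a, 0 ≤ q h a := fun h a => by simp only [hq]; split_ifs <;> positivity
  have hq1 : ∀ h, ∑ a, q h a ≤ 1 := by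
    intro h
    simp only [hq]
    split_ifs
    · have : (σ : ℝ) ≠ 0 := by positivity
      simp [this]
    · rw [← Finset.sum_div]
      have := sum_count_mul (followersList T (h.drop (h.length - k))) (fun _ => (1 : ℝ))
      simp only [mul_one] at this
      rw [this]
      simp only [List.map_const', List.sum_replicate, nsmul_eq_mul, mul_one]
      exact div_self_le_one _
  have hofn : ∀ J : ℕ, (List.ofFn fun o : Fin b => t (J * b + o)) = seg t (J * b) b := fun J => by
    apply List.ext_getElem <;> simp [seg]
  have hσ' : 0 ≤ Real.logb 2 σ := Real.logb_nonneg (by norm_num) (by exact_mod_cast hσ)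
  have hsymn : ∀ i, 0 ≤ if k ≤ i then symCost T t k i else 0 := by
    intro i
    split_ifs
    · exact logb_length_div_count_nonneg _ _
    · exact le_rfl
  -- the probability of the symbol at offset `o` of block `J`
  have hsym : ∀ J < n / b, ∀ o < b, 0 < q (seg t (J * b) o) (t (J * b + o)) ∧
      -Real.logb 2 (q (seg t (J * b) o) (t (J * b + o))) ≤
        (if o < k then Real.logb 2 σ else 0) +
          if k ≤ J * b + o then symCost T t k (J * b + o) else 0 := by
    intro J hJ o ho
    have hn : J * b + o < n := by
      calc J * b + o < (J + 1) * b := by rw [Nat.add_mul]; omega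
        _ ≤ n / b * b := Nat.mul_le_mul_right _ hJ
        _ ≤ n := Nat.div_mul_le_self _ _
    by_cases hok : o < k
    · have e : q (seg t (J * b) o) (t (J * b + o)) = 1 / σ := by simp [hq, hok]
      rw [e, if_pos hok]
      refine ⟨by positivity, ?_⟩
      rw [one_div, Real.logb_inv, neg_neg]
      exact le_add_of_nonneg_right (hsymn _)
    · have hk : k ≤ J * b + o := by omega
      have e1 : (seg t (J * b) o).drop (o - k) = seg t (J * b + o - k) k := by
        have := drop_seg t (J * b) (o - k) k
        rw [Nat.sub_add_cancel (by omega)] at this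
        rw [this]; congr 1; omega
      have e : q (seg t (J * b) o) (t (J * b + o)) =
          ((followersList T (seg t (J * b + o - k) k)).count (t (J * b + o)) : ℝ) /
            (followersList T (seg t (J * b + o - k) k)).length := by
        simp only [hq, length_seg, if_neg hok, e1]
      have hmem := mem_followersList ht (i := ⟨J * b + o, hn⟩) (k := k) hk
      rw [← ht] at hmem
      have hcnt : 0 < (followersList T (seg t (J * b + o - k) k)).count (t (J * b + o)) :=
        List.count_pos_iff.mpr hmem
      have hlen : 0 < (followersList T (seg t (J * b + o - k) k)).length :=
        hcnt.trans_le List.count_le_length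
      rw [e, if_neg hok, if_pos hk]
      refine ⟨by positivity, ?_⟩
      rw [← Real.logb_inv, inv_div, zero_add, symCost]
  have hall : ∀ J < n / b, 0 < strProb q [] (seg t (J * b) b) ∧
      -Real.logb 2 (strProb q [] (seg t (J * b) b)) =
        ∑ o ∈ Finset.range b, -Real.logb 2 (q (seg t (J * b) o) (t (J * b + o))) := by
    intro J hJ
    have := neg_logb_strProb_seg (q := q) t (J * b) b 0 fun o ho => by
      simpa using (hsym J hJ o ho).1
    simpa [seg] using this
  refine ⟨fun x => strProb q [] (List.ofFn x), fun x => strProb_nonneg hq0 _ _,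
    sum_strProb_le hq0 hq1 b [], fun J hJ => by simp only [hofn]; exact (hall J hJ).1, ?_⟩
  simp only [hofn]
  calc ∑ J ∈ Finset.range (n / b), -Real.logb 2 (strProb q [] (seg t (J * b) b))
      ≤ ∑ J ∈ Finset.range (n / b), (k * Real.logb 2 σ +
        ∑ o ∈ Finset.range b, if k ≤ J * b + o then symCost T t k (J * b + o) else 0) := by
        refine Finset.sum_le_sum fun J hJ => ?_
        have hJ' := Finset.mem_range.mp hJ
        rw [(hall J hJ').2]
        refine (Finset.sum_le_sum fun o ho => (hsym J hJ' o (Finset.mem_range.mp ho)).2).trans ?_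
        rw [Finset.sum_add_distrib]
        refine add_le_add_left ?_ _
        rw [← Finset.sum_filter, Finset.sum_const, nsmul_eq_mul]
        refine mul_le_mul_of_nonneg_right ?_ hσ'
        have : ((Finset.range b).filter fun o => o < k) ⊆ Finset.range k := fun o ho => by
          simp at ho ⊢; omega
        exact_mod_cast (Finset.card_le_card this).trans (Finset.card_range k).le
    _ = (n / b : ℕ) * (k * Real.logb 2 σ) +
        ∑ i ∈ Finset.range (n / b * b), if k ≤ i then symCost T t k i else 0 := by
        rw [Finset.sum_add_distrib, sum_range_mul (fun i => if k ≤ i then symCost T t k i else 0)]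
        simp
    _ ≤ (n / b : ℕ) * (k * Real.logb 2 σ) + n * entropy T k := by
        refine add_le_add_right ((Finset.sum_le_sum_of_subset_of_nonneg
          (Finset.range_mono (Nat.div_mul_le_self n b)) fun i _ _ => hsymn i).trans
          (sum_symCost_le ht k)) _
    _ = _ := add_comm _ _

end Entropy

/-- The blocks of length `b` of a text can be coded with `n * entropy T k + (n / b) * k * log σ`
bits in total, for all `k` at once: the identifier of a block is its rank by frequency, and its
codeword is the binary representation of the identifier without the leading one. -/
theorem exists_code {n σ : ℕ} (T : Fin n → Fin σ) (hσ : 1 ≤ σ) (b : ℕ) :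
    ∃ (cd : ℕ → ℕ) (blk : ℕ → ℕ → ℕ), (∀ J, 0 < cd J) ∧ (∀ J, cd J ≤ σ ^ b) ∧
      (∀ J o, o < b → blk (cd J) o = text T (J * b + o)) ∧
      ∀ k : ℕ, ∑ J ∈ Finset.range (n / b), (Nat.log2 (cd J) : ℝ) ≤
        n * entropy T k + (n / b : ℕ) * (k * Real.logb 2 σ) := by
  classical
  set t : ℕ → Fin σ := fun p => if h : p < n then T ⟨p, h⟩ else ⟨0, hσ⟩ with htdef
  have ht : ∀ i : Fin n, t i = T i := fun i => by simp [htdef]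
  have htext : ∀ p, text T p = t p := fun p => by
    simp only [text, htdef]; split_ifs <;> rfl
  set x : ℕ → (Fin b → Fin σ) := fun J o => t (J * b + o) with hx
  set f : (Fin b → Fin σ) → ℕ := fun y =>
    ((Finset.range (n / b)).filter fun I => x I = y).card with hf
  obtain ⟨rk, hinj, hlt, hrk⟩ := exists_rank f
  have hsum : ∑ y, f y = n / b := by
    have := Finset.card_eq_sum_card_fiberwise (s := Finset.range (n / b)) (t := Finset.univ)
      (f := x) fun _ _ => Finset.mem_coe.mpr (Finset.mem_univ _)
    rw [Finset.card_range] at this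
    exact this.symm
  rw [hsum] at hrk
  refine ⟨fun J => rk (x J) + 1, fun i o => if h : o < b then
    if h' : ∃ y, rk y + 1 = i then h'.choose ⟨o, h⟩ else 0 else 0, fun J => Nat.succ_pos _,
    fun J => ?_, fun J o ho => ?_, fun k => ?_⟩
  · have := hlt (x J)
    simp only [Fintype.card_pi, Fintype.card_fin, Finset.prod_const, Finset.card_univ] at this
    exact this
  · have h' : ∃ y, rk y + 1 = rk (x J) + 1 := ⟨_, rfl⟩
    have h2 : h'.choose = x J := hinj (Nat.succ_injective h'.choose_spec)
    beta_reduce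
    rw [dif_pos ho, dif_pos h', h2, htext]
  · obtain ⟨p, hp0, hp1, hpos, hle⟩ := exists_blockProb ht hσ (b := b) k
    refine le_trans ?_ ((sum_log_le (n / b) x p hp0 hp1 hpos).trans hle)
    refine Finset.sum_le_sum fun J hJ => ?_
    have hfpos : 0 < f (x J) := Finset.card_pos.mpr ⟨J, by simpa using hJ⟩
    have h1 : (2 : ℝ) ^ (Nat.log2 (rk (x J) + 1)) ≤ (rk (x J) + 1 : ℕ) := by
      exact_mod_cast Nat.log2_self_le (Nat.succ_ne_zero _)
    have h2 : ((rk (x J) + 1 : ℕ) : ℝ) ≤ (n / b : ℕ) / f (x J) := by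
      rw [le_div_iff₀ (by exact_mod_cast hfpos)]
      exact_mod_cast hrk (x J)
    rw [Real.le_logb_iff_rpow_le (by norm_num) (lt_of_lt_of_le (by positivity) h2),
      Real.rpow_natCast]
    exact h1.trans h2

/-! ### The size of the data structure -/

namespace Par
variable {P : Par}

open Classical in
/-- The superblocks over which `Φ` grows by at least `2 ^ g`. -/
noncomputable def bigSupers (P : Par) : Finset ℕ :=
  (Finset.range P.m).filter fun u => 2 ^ P.g ≤ P.Φ ((u + 1) * P.S) - P.Φ (u * P.S)

/-- The number of large `s`-blocks in superblock `u`. -/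
def numLarge (P : Par) (u : ℕ) : ℕ := ((Finset.range (P.b * P.M)).filter fun j => P.Large u j).card

/-- `Φ` grows by at most `n` in total, so it grows much over few superblocks only. -/
theorem card_bigSupers_mul_le (hm : Monotone P.Φ) (hn : ∀ p, P.Φ p ≤ P.n) :
    P.bigSupers.card * 2 ^ P.g ≤ P.n := by
  classical
  calc P.bigSupers.card * 2 ^ P.g = ∑ _u ∈ P.bigSupers, 2 ^ P.g := by simp
    _ ≤ ∑ u ∈ P.bigSupers, (P.Φ ((u + 1) * P.S) - P.Φ (u * P.S)) :=
        Finset.sum_le_sum fun u hu => (Finset.mem_filter.mp hu).2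
    _ ≤ ∑ u ∈ Finset.range P.m, (P.Φ ((u + 1) * P.S) - P.Φ (u * P.S)) :=
        Finset.sum_le_sum_of_subset (Finset.filter_subset _ _)
    _ = P.Φ (P.m * P.S) - P.Φ (0 * P.S) :=
        Finset.sum_range_tsub (f := fun u => P.Φ (u * P.S))
          (fun _ _ h => hm (Nat.mul_le_mul_right _ h)) _
    _ ≤ P.n := (Nat.sub_le _ _).trans (hn _)

/-- `Φ` grows by at most `n` in total, so there are few large `s`-blocks. -/
theorem sum_numLarge_mul_le (hm : Monotone P.Φ) (hn : ∀ p, P.Φ p ≤ P.n) :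
    (∑ u ∈ Finset.range P.m, P.numLarge u) * (P.s * P.b) ≤ P.n := by
  rw [Finset.sum_mul]
  calc ∑ u ∈ Finset.range P.m, P.numLarge u * (P.s * P.b)
      ≤ ∑ u ∈ Finset.range P.m, (P.Φ ((u + 1) * P.S) - P.Φ (u * P.S)) := by
        refine Finset.sum_le_sum fun u _ => ?_
        calc P.numLarge u * (P.s * P.b)
            = ∑ _j ∈ (Finset.range (P.b * P.M)).filter fun j => P.Large u j, P.s * P.b := by
              simp [numLarge]
          _ ≤ ∑ j ∈ (Finset.range (P.b * P.M)).filter fun j => P.Large u j,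
              (P.Φ (u * P.S + (j + 1) * P.s) - P.Φ (u * P.S + j * P.s)) :=
              Finset.sum_le_sum fun j hj => (Finset.mem_filter.mp hj).2
          _ ≤ ∑ j ∈ Finset.range (P.b * P.M),
              (P.Φ (u * P.S + (j + 1) * P.s) - P.Φ (u * P.S + j * P.s)) :=
              Finset.sum_le_sum_of_subset (Finset.filter_subset _ _)
          _ = P.Φ (u * P.S + P.b * P.M * P.s) - P.Φ (u * P.S + 0 * P.s) :=
              Finset.sum_range_tsub (f := fun j => P.Φ (u * P.S + j * P.s))
                (fun _ _ h => hm (Nat.add_le_add_left (Nat.mul_le_mul_right _ h) _)) _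
          _ = P.Φ ((u + 1) * P.S) - P.Φ (u * P.S) := by
              congr 2
              · rw [S]; ring
              · ring
    _ = P.Φ (P.m * P.S) - P.Φ (0 * P.S) :=
        Finset.sum_range_tsub (f := fun u => P.Φ (u * P.S))
          (fun _ _ h => hm (Nat.mul_le_mul_right _ h)) _
    _ ≤ P.n := (Nat.sub_le _ _).trans (hn _)

theorem length_lists (u : ℕ) :
    ((List.range (P.b * P.M)).flatMap (P.lst u)).length = P.numLarge u * (P.s * P.wid u) := by
  rw [length_flatMap_range, numLarge, Finset.card_filter, Finset.sum_mul]
  refine Finset.sum_congr rfl fun j _ => ?_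
  by_cases h : P.Large u j
  · rw [length_lst_of_large h, if_pos h, Nat.one_mul]
  · rw [length_lst_of_not_large h, if_neg h, Nat.zero_mul]

theorem numLarge_le (u : ℕ) : P.numLarge u ≤ P.b * P.M :=
  (Finset.card_filter_le _ _).trans (Finset.card_range _).le

theorem length_body_eq (u : ℕ) : (P.body u).length = P.NF * P.wid u +
    P.numLarge u * (P.s * P.wid u) +
      ∑ j ∈ Finset.range (P.s * P.M), Nat.log2 (P.cd (u * (P.s * P.M) + j)) := by
  rw [length_body, ptrT, length_lists, length_flatMap_range]
  simp [cw]

theorem NF_le_S (hb : 0 < P.b) (hs : 0 < P.s) (hM : 0 < P.M) :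
    P.NF ≤ 5 * (P.b * P.M) + P.s * P.M ∧ P.NF ≤ 6 * P.S := by
  have h1 : 0 < P.b * P.M := Nat.mul_pos hb hM
  have h2 : P.b * P.M ≤ P.S := by
    rw [S, Nat.mul_right_comm]; exact Nat.le_mul_of_pos_right _ hs
  have h3 : P.s * P.M ≤ P.S := by
    rw [S, Nat.mul_assoc]; exact Nat.le_mul_of_pos_left _ hb
  unfold NF
  constructor <;> omega

theorem length_body_le (hb : 0 < P.b) (hs : 0 < P.s) (hM : 0 < P.M) (hg : P.g ≤ P.F)
    (hβ : ∀ J, Nat.log2 (P.cd J) ≤ P.β) (u : ℕ) :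
    (P.body u).length ≤ 7 * P.S * P.F + P.S * P.β := by
  have hw : P.wid u ≤ P.F := by unfold wid; split_ifs <;> omega
  have h3 : P.s * P.M ≤ P.S := by
    rw [S, Nat.mul_assoc]; exact Nat.le_mul_of_pos_left _ hb
  have e1 : P.NF * P.wid u ≤ 6 * P.S * P.F := Nat.mul_le_mul (NF_le_S hb hs hM).2 hw
  have e2 : P.numLarge u * (P.s * P.wid u) ≤ P.S * P.F := by
    calc P.numLarge u * (P.s * P.wid u) ≤ (P.b * P.M) * (P.s * P.F) :=
          Nat.mul_le_mul (numLarge_le u) (Nat.mul_le_mul_left _ hw)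
      _ = P.S * P.F := by rw [S]; ring
  have e3 : ∑ j ∈ Finset.range (P.s * P.M), Nat.log2 (P.cd (u * (P.s * P.M) + j)) ≤ P.S * P.β := by
    calc _ ≤ ∑ _j ∈ Finset.range (P.s * P.M), P.β := Finset.sum_le_sum fun j _ => hβ _
      _ = P.s * P.M * P.β := by simp
      _ ≤ _ := Nat.mul_le_mul_right _ h3
  rw [length_body_eq]
  have : 7 * P.S * P.F = 6 * P.S * P.F + P.S * P.F := by ring
  omega

/-- The contributions to the total size: header, table and directory; the short fields; the long
fields of the superblocks over which `Φ` grows much; the lists of explicit values; and the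
codewords, including those of the blocks behind the end of the text that fill the last superblock. -/
theorem length_data_le (hb : 0 < P.b) (hs : 0 < P.s) (hM : 0 < P.M)
    (hβ : ∀ J, Nat.log2 (P.cd J) ≤ P.β) :
    P.data.length ≤ P.dirEnd + P.m * P.NF * P.g + P.bigSupers.card * (7 * P.S * P.F) +
      (∑ u ∈ Finset.range P.m, P.numLarge u) * (P.s * P.g) +
      (∑ J ∈ Finset.range (P.n / P.b), Nat.log2 (P.cd J) + P.s * P.M * P.β) := by
  classical
  have hwid : ∀ u, P.wid u ≤ P.g + if 2 ^ P.g ≤ P.Φ ((u + 1) * P.S) - P.Φ (u * P.S) then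
      P.F else 0 := by
    intro u; unfold wid; split_ifs <;> omega
  have hbody : ∀ u, (P.body u).length ≤ P.NF * P.g + P.numLarge u * (P.s * P.g) +
      (if 2 ^ P.g ≤ P.Φ ((u + 1) * P.S) - P.Φ (u * P.S) then 7 * P.S * P.F else 0) +
      ∑ j ∈ Finset.range (P.s * P.M), Nat.log2 (P.cd (u * (P.s * P.M) + j)) := by
    intro u
    rw [length_body_eq]
    refine Nat.add_le_add_right ?_ _
    have h1 : P.NF * P.wid u + P.numLarge u * (P.s * P.wid u) ≤
        (P.NF + P.numLarge u * P.s) * (P.g +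
          if 2 ^ P.g ≤ P.Φ ((u + 1) * P.S) - P.Φ (u * P.S) then P.F else 0) := by
      rw [← Nat.mul_assoc, ← Nat.add_mul]
      exact Nat.mul_le_mul_left _ (hwid u)
    have h2 : P.NF + P.numLarge u * P.s ≤ 7 * P.S := by
      have e2 : P.numLarge u * P.s ≤ P.S := by
        calc P.numLarge u * P.s ≤ (P.b * P.M) * P.s := Nat.mul_le_mul_right _ (numLarge_le u)
          _ = P.S := by rw [S]; ring
      have := (NF_le_S hb hs hM).2
      omega
    refine h1.trans ?_
    rw [Nat.mul_add, Nat.add_mul, Nat.mul_assoc (P.numLarge u)]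
    refine Nat.add_le_add_left ?_ _
    split_ifs
    · exact Nat.mul_le_mul_right _ h2
    · simp
  have hcw : ∑ u ∈ Finset.range P.m, ∑ j ∈ Finset.range (P.s * P.M),
      Nat.log2 (P.cd (u * (P.s * P.M) + j)) ≤
      ∑ J ∈ Finset.range (P.n / P.b), Nat.log2 (P.cd J) + P.s * P.M * P.β := by
    have e1 : ∀ N b : ℕ, ∑ J ∈ Finset.range N, ∑ o ∈ Finset.range b, Nat.log2 (P.cd (J * b + o)) =
        ∑ i ∈ Finset.range (N * b), Nat.log2 (P.cd i) := by
      intro N b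
      induction N with
      | zero => simp
      | succ N ih => rw [Finset.sum_range_succ, ih, Nat.succ_mul, Finset.sum_range_add]
    rw [e1]
    have e2 : P.m * (P.s * P.M) ≤ P.n / P.b + P.s * P.M := by
      rw [m, Nat.add_mul, Nat.one_mul]
      refine Nat.add_le_add_right ?_ _
      rw [Nat.le_div_iff_mul_le hb]
      calc P.n / P.S * (P.s * P.M) * P.b = P.n / P.S * P.S := by rw [S]; ring
        _ ≤ P.n := Nat.div_mul_le_self _ _
    calc ∑ i ∈ Finset.range (P.m * (P.s * P.M)), Nat.log2 (P.cd i)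
        ≤ ∑ i ∈ Finset.range (P.n / P.b + P.s * P.M), Nat.log2 (P.cd i) :=
          Finset.sum_le_sum_of_subset (Finset.range_mono e2)
      _ = ∑ i ∈ Finset.range (P.n / P.b), Nat.log2 (P.cd i) +
          ∑ i ∈ Finset.range (P.s * P.M), Nat.log2 (P.cd (P.n / P.b + i)) :=
          Finset.sum_range_add _ _ _
      _ ≤ _ := by
          refine Nat.add_le_add_left ?_ _
          calc _ ≤ ∑ _j ∈ Finset.range (P.s * P.M), P.β := Finset.sum_le_sum fun j _ => hβ _
            _ = P.s * P.M * P.β := by simp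
  rw [length_data, addr, length_flatMap_range]
  have h1 := (Finset.sum_le_sum fun u (_ : u ∈ Finset.range P.m) => hbody u)
  simp only [Finset.sum_add_distrib, Finset.sum_const, Finset.card_range, smul_eq_mul,
    ← Finset.sum_mul] at h1
  rw [← Finset.sum_filter, Finset.sum_const, smul_eq_mul] at h1
  change _ ≤ _ + _ + P.bigSupers.card * _ + _ at h1
  rw [← Nat.mul_assoc P.m] at h1
  omega

end Par

/-! ### The choice of the parameters -/

/-- The parameters for a text of length `n`, when `Φ` is to be stored and text blocks of length `b`
have identifiers at most `R`. Superblocks are so long that `O(log n)` bits for each of them are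
negligible, and `2 ^ g` is a polynomial in `log n` that exceeds all sizes inside a superblock. -/
def mkPar (n w b s R : ℕ) (Φ cd : ℕ → ℕ) (blk : ℕ → ℕ → ℕ) : Par where
  n := n
  w := w
  b := b
  s := s
  M := n.size ^ 2
  g := 7 * n.size.size + 8
  F := min w (2 * n.size)
  β := R.size
  Φ := Φ
  cd := cd
  blk := blk

/-- The text length is large enough for the estimates: short fields are much shorter than `log n`,
and a power of `log n` is negligible against `n`. The length `n.size` of the binary representation
stands for `log n`. -/
structure Big (n : ℕ) : Prop where
  size_size_le : 100 * (7 * n.size.size + 8) ≤ n.size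
  pow_size_le : 10 ^ 4 * n.size ^ 12 ≤ n

/-- The conditions on the contents of the data structure, where `X` is the text. The bound `R ^ 4 ≤ n`
on the number of identifiers keeps the table, of order `R ^ 2` entries, small. -/
structure Adm (n b s R : ℕ) (Φ cd : ℕ → ℕ) (blk : ℕ → ℕ → ℕ) (X : ℕ → ℕ) : Prop where
  b_pos : 0 < b
  s_pos : 0 < s
  b_le : b ≤ n.size
  s_le : s ≤ n.size
  R_pos : 0 < R
  R_le : R ^ 4 ≤ n
  cd_pos : ∀ J, 0 < cd J
  cd_le : ∀ J, cd J ≤ R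
  blk_cd : ∀ J o, o < b → blk (cd J) o = X (J * b + o)
  mono : Monotone Φ
  Φ_le : ∀ p, Φ p ≤ n

section Choice

variable {n w b s R : ℕ} {Φ cd : ℕ → ℕ} {blk : ℕ → ℕ → ℕ} {X : ℕ → ℕ}

theorem Adm.log2_le (h : Adm n b s R Φ cd blk X) (J : ℕ) : Nat.log2 (cd J) ≤ R.size := by
  have h1 : 2 ^ Nat.log2 (cd J) ≤ cd J := Nat.log2_self_le (h.cd_pos J).ne'
  have h2 : R < 2 ^ R.size := Nat.lt_size_self R
  exact ((Nat.pow_lt_pow_iff_right (by norm_num : 1 < 2)).mp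
    ((h1.trans (h.cd_le J)).trans_lt h2)).le

theorem Adm.size_R_le (h : Adm n b s R Φ cd blk X) : 4 * R.size ≤ n.size + 3 := by
  have h1 : 0 < R.size := Nat.size_pos.mpr h.R_pos
  have h2 : 2 ^ (R.size - 1) ≤ R := Nat.lt_size.mp (by omega)
  have h3 : (2 ^ (R.size - 1)) ^ 4 ≤ n := (Nat.pow_le_pow_left h2 4).trans h.R_le
  rw [← pow_mul] at h3
  have := Nat.lt_size.mpr h3
  omega

theorem pow_lt_two_pow_size (x k : ℕ) (hx : 0 < k) : x ^ k < 2 ^ (k * x.size) := by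
  rw [Nat.mul_comm, pow_mul]
  exact Nat.pow_lt_pow_left (Nat.lt_size_self x) hx.ne'

theorem Big.size_pos (hB : Big n) : 800 ≤ n.size := by have := hB.size_size_le; omega

theorem Adm.S_le (h : Adm n b s R Φ cd blk X) :
    (mkPar n w b s R Φ cd blk).S ≤ n.size ^ 4 ∧ n.size ^ 2 ≤ (mkPar n w b s R Φ cd blk).S := by
  change b * s * n.size ^ 2 ≤ _ ∧ _ ≤ b * s * n.size ^ 2
  constructor
  · calc b * s * n.size ^ 2 ≤ n.size * n.size * n.size ^ 2 :=
        Nat.mul_le_mul_right _ (Nat.mul_le_mul h.b_le h.s_le)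
      _ = n.size ^ 4 := by ring
  · exact Nat.le_mul_of_pos_left _ (Nat.mul_pos h.b_pos h.s_pos)

theorem two_pow_g (n : ℕ) : 2 ^ 8 * n.size ^ 7 ≤ 2 ^ (7 * n.size.size + 8) := by
  rw [pow_add, Nat.mul_comm]
  exact Nat.mul_le_mul_right _ (pow_lt_two_pow_size n.size 7 (by norm_num)).le

/-- The table, the directory and the header are small. -/
theorem Adm.dirEnd_le (h : Adm n b s R Φ cd blk X) (hB : Big n) :
    (mkPar n w b s R Φ cd blk).dirEnd * n.size ≤ 11 * n := by
  obtain ⟨hS1, hS2⟩ := h.S_le (w := w)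
  set P := mkPar n w b s R Φ cd blk with hP
  have h1 := hB.size_size_le
  have h2 := hB.pow_size_le
  have h800 := hB.size_pos
  set l := n.size with hl
  have hR2 : (R ^ 2 * (100 * l ^ 6)) ≤ n := by
    have : (R ^ 2 * (100 * l ^ 6)) ^ 2 ≤ n ^ 2 := by
      calc (R ^ 2 * (100 * l ^ 6)) ^ 2 = R ^ 4 * (10 ^ 4 * l ^ 12) := by ring
        _ ≤ n * n := Nat.mul_le_mul h.R_le h2
        _ = n ^ 2 := by ring
    exact (Nat.pow_le_pow_iff_left (by norm_num)).mp this
  have hR1 : 1 ≤ R ^ 2 := Nat.one_le_pow _ _ h.R_pos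
  have hg : P.g ≤ l := by change 7 * l.size + 8 ≤ l; omega
  have hBR : P.B ≤ 2 * R := two_pow_size_le h.R_pos
  have hF : P.F ≤ 2 * l := min_le_right _ _
  have etab : P.B * P.b * P.B * P.b * P.g ≤ 4 * R ^ 2 * l ^ 3 := by
    calc P.B * P.b * P.B * P.b * P.g ≤ (2 * R) * l * (2 * R) * l * l := by
          gcongr
          · exact h.b_le
          · exact h.b_le
      _ = 4 * R ^ 2 * l ^ 3 := by ring
  have edir : P.m * (4 * P.F) * l ≤ 8 * n + 8 * l ^ 2 := by
    have e1 : P.m * l ^ 2 ≤ n + l ^ 2 := by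
      have e2 : P.n / P.S * P.S ≤ n := Nat.div_mul_le_self _ _
      have e3 : P.n / P.S * l ^ 2 ≤ P.n / P.S * P.S := Nat.mul_le_mul_left _ hS2
      rw [Par.m, Nat.add_mul, Nat.one_mul]
      omega
    calc P.m * (4 * P.F) * l ≤ P.m * (4 * (2 * l)) * l := by gcongr
      _ = 8 * (P.m * l ^ 2) := by ring
      _ ≤ 8 * (n + l ^ 2) := by gcongr
      _ = _ := by ring
  have hl2 : l ^ 2 ≤ l ^ 6 := Nat.pow_le_pow_right (by omega) (by norm_num)
  have hl4 : R ^ 2 * l ^ 4 ≤ R ^ 2 * l ^ 6 :=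
    Nat.mul_le_mul_left _ (Nat.pow_le_pow_right (by omega) (by norm_num))
  have hl6 : l ^ 6 ≤ R ^ 2 * l ^ 6 := Nat.le_mul_of_pos_left _ hR1
  have e4 : R ^ 2 * (100 * l ^ 6) = 100 * (R ^ 2 * l ^ 6) := by ring
  have e5 : (P.tabPos) * l ≤ 8 * l ^ 2 := by
    calc P.tabPos * l ≤ (8 * l) * l := by
          refine Nat.mul_le_mul_right _ ?_
          change 7 * P.g + 1 ≤ _; omega
      _ = _ := by ring
  calc P.dirEnd * l = P.tabPos * l + (P.B * P.b * P.B * P.b * P.g) * l + P.m * (4 * P.F) * l := by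
        rw [Par.dirEnd, Par.dirPos]; ring
    _ ≤ 8 * l ^ 2 + 4 * R ^ 2 * l ^ 3 * l + (8 * n + 8 * l ^ 2) := by gcongr
    _ = 8 * l ^ 2 + 4 * (R ^ 2 * l ^ 4) + (8 * n + 8 * l ^ 2) := by ring
    _ ≤ 11 * n := by omega

theorem Adm.bigSupers_le (h : Adm n b s R Φ cd blk X) :
    (mkPar n w b s R Φ cd blk).bigSupers.card * (7 * (mkPar n w b s R Φ cd blk).S *
      (mkPar n w b s R Φ cd blk).F) * n.size ^ 2 ≤ n := by
  obtain ⟨hS1, hS2⟩ := h.S_le (w := w)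
  set P := mkPar n w b s R Φ cd blk with hP
  set l := n.size with hl
  have hF : P.F ≤ 2 * l := min_le_right _ _
  calc P.bigSupers.card * (7 * P.S * P.F) * l ^ 2
      ≤ P.bigSupers.card * (7 * l ^ 4 * (2 * l)) * l ^ 2 := by gcongr
    _ = P.bigSupers.card * (14 * l ^ 7) := by ring
    _ ≤ P.bigSupers.card * 2 ^ P.g := by
        refine Nat.mul_le_mul_left _ (le_trans ?_ (two_pow_g n))
        exact Nat.mul_le_mul_right _ (by norm_num)
    _ ≤ P.n := Par.card_bigSupers_mul_le h.mono h.Φ_le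

theorem Adm.rest_le (h : Adm n b s R Φ cd blk X) (hB : Big n) :
    s * n.size ^ 2 * R.size * n.size ≤ n := by
  have h1 := h.size_R_le
  have h800 := hB.size_pos
  have h2 := hB.pow_size_le
  set l := n.size with hl
  have hR : R.size ≤ l := by omega
  calc s * l ^ 2 * R.size * l ≤ l * l ^ 2 * l * l := by
        gcongr; exact h.s_le
    _ = l ^ 5 := by ring
    _ ≤ l ^ 12 := Nat.pow_le_pow_right (by omega) (by norm_num)
    _ ≤ n := by omega

theorem Adm.m_mul_le (h : Adm n b s R Φ cd blk X) (hB : Big n) :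
    (mkPar n w b s R Φ cd blk).m * (mkPar n w b s R Φ cd blk).S ≤ 2 * n := by
  obtain ⟨hS1, hS2⟩ := h.S_le (w := w)
  set P := mkPar n w b s R Φ cd blk with hP
  have h800 := hB.size_pos
  have h2 := hB.pow_size_le
  have h3 : n.size ^ 4 ≤ n.size ^ 12 := Nat.pow_le_pow_right (by omega) (by norm_num)
  have e2 : P.n / P.S * P.S ≤ n := Nat.div_mul_le_self _ _
  rw [Par.m, Nat.add_mul, Nat.one_mul]
  omega

/-- A crude bound of the total size. It shows that the data structure fits into the memory. -/
theorem Adm.two_mul_length_le (h : Adm n b s R Φ cd blk X) (hB : Big n) (hw : n < 2 ^ w) :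
    2 * (mkPar n w b s R Φ cd blk).data.length ≤ n * n.size := by
  have hlw : n.size ≤ w := Nat.size_le.mpr hw
  have k1 := h.dirEnd_le (w := w) hB
  have k2 := h.bigSupers_le (w := w)
  have k3 := h.rest_le hB
  have k4 := h.m_mul_le (w := w) hB
  have k5 := h.size_R_le
  have h1 := hB.size_size_le
  have h800 := hB.size_pos
  set P := mkPar n w b s R Φ cd blk with hP
  have hl2 : 0 < n.size ^ 2 := by positivity
  have hM : P.M = n.size ^ 2 := rfl
  have hgF : P.g ≤ P.F := by
    change 7 * n.size.size + 8 ≤ min w (2 * n.size)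
    rw [le_min_iff]; omega
  have hlen := P.length_data_le h.b_pos h.s_pos hl2 h.log2_le
  have hNF := (P.NF_le_S h.b_pos h.s_pos hl2).2
  have hKL := P.sum_numLarge_mul_le h.mono h.Φ_le
  set l := n.size with hl
  have a1 : P.dirEnd ≤ n := by nlinarith
  have a2 : P.bigSupers.card * (7 * P.S * P.F) ≤ n := by nlinarith
  have a3 : P.s * P.M * P.β ≤ n := by
    change s * l ^ 2 * R.size ≤ n; nlinarith
  have a4 : P.m * P.NF * P.g ≤ 12 * n * P.g := by
    refine Nat.mul_le_mul_right _ ?_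
    calc P.m * P.NF ≤ P.m * (6 * P.S) := Nat.mul_le_mul_left _ hNF
      _ = 6 * (P.m * P.S) := by ring
      _ ≤ 12 * n := by omega
  have a5 : (∑ u ∈ Finset.range P.m, P.numLarge u) * (P.s * P.g) ≤ n * P.g := by
    rw [← Nat.mul_assoc]
    refine Nat.mul_le_mul_right _ (le_trans ?_ hKL)
    exact Nat.mul_le_mul_left _ (Nat.le_mul_of_pos_right _ h.b_pos)
  have a6 : ∑ J ∈ Finset.range (P.n / P.b), Nat.log2 (P.cd J) ≤ n * R.size := by
    calc _ ≤ ∑ _J ∈ Finset.range (P.n / P.b), R.size := Finset.sum_le_sum fun J _ => h.log2_le J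
      _ = P.n / P.b * R.size := by simp
      _ ≤ n * R.size := Nat.mul_le_mul_right _ (Nat.div_le_self _ _)
  have hg : 100 * P.g ≤ l := h1
  have b1 : n * (100 * P.g) ≤ n * l := Nat.mul_le_mul_left _ hg
  have b2 : n * (4 * R.size) ≤ n * (l + 3) := Nat.mul_le_mul_left _ k5
  have b3 : n * 800 ≤ n * l := Nat.mul_le_mul_left _ h800
  have e1 : n * (100 * P.g) = 100 * (n * P.g) := by ring
  have e2 : n * (4 * R.size) = 4 * (n * R.size) := by ring
  have e3 : n * (l + 3) = n * l + 3 * n := by ring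
  have e4 : 12 * n * P.g = 12 * (n * P.g) := by ring
  omega

theorem Adm.ok (h : Adm n b s R Φ cd blk X) (hB : Big n) (hw : n < 2 ^ w) :
    (mkPar n w b s R Φ cd blk).Ok X := by
  have hlw : n.size ≤ w := Nat.size_le.mpr hw
  have k1 := h.dirEnd_le (w := w) hB
  have k5 := h.size_R_le
  have k6 := h.two_mul_length_le hB hw
  obtain ⟨hS1, hS2⟩ := h.S_le (w := w)
  have h1 := hB.size_size_le
  have h800 := hB.size_pos
  have h2g := two_pow_g n
  set P := mkPar n w b s R Φ cd blk with hP
  have hl2 : 0 < n.size ^ 2 := by positivity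
  have hF2 : P.F ≤ 2 * n.size := min_le_right _ _
  have hlF : n.size ≤ P.F := le_min hlw (by omega)
  have hFw : P.F ≤ w := min_le_left _ _
  have hg : 100 * P.g ≤ n.size := h1
  have hgF : P.g ≤ P.F := by omega
  have hn2 : n < 2 ^ n.size := Nat.lt_size_self n
  have hl7 : n.size ^ 5 ≤ n.size ^ 7 := Nat.pow_le_pow_right (by omega) (by norm_num)
  have hl4 : n.size ^ 4 ≤ n.size ^ 7 := Nat.pow_le_pow_right (by omega) (by norm_num)
  have hl1 : n.size ≤ n.size ^ 7 := Nat.le_self_pow (by norm_num) _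
  have hlw2 : 2 * w + 2 ≤ 2 ^ w := two_mul_le_two_pow (by omega)
  have hdw : P.data.length / w ≤ n / 2 := by
    rw [Nat.div_le_iff_le_mul_add_pred (by omega)]
    have e1 : n * n.size ≤ n * w := Nat.mul_le_mul_left _ hlw
    have e2 : w * (n / 2 * 2 + 1) ≥ w * n := Nat.mul_le_mul_left _ (by omega)
    have e3 : w * (n / 2 * 2 + 1) = 2 * (w * (n / 2)) + w := by ring
    have e4 : w * n = n * w := Nat.mul_comm _ _
    omega
  have hg2 : P.g < 2 ^ P.g := Nat.lt_two_pow_self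
  change 2 ^ 8 * n.size ^ 7 ≤ 2 ^ P.g at h2g
  refine ⟨h.b_pos, h.s_pos, hl2, hw, hgF, hFw, ?_, ?_, hg2, ?_, ?_, ?_, ?_, ?_, ?_, ?_, ?_,
    h.cd_pos, fun J => (h.cd_le J).trans_lt (Nat.lt_size_self R), h.blk_cd, h.mono, h.Φ_le⟩
  · change 2 * P.g + 2 ≤ w; omega
  · change 4 ≤ w; omega
  · omega
  · omega
  · change R.size < _; omega
  · refine lt_of_le_of_lt ?_ hw
    nlinarith
  · change P.data.length / w + 1 < 2 ^ w; omega
  · intro x hx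
    change x / w < 2 ^ P.F ∧ x % w < 2 ^ P.F
    have hxw : x / w ≤ P.data.length / w := Nat.div_le_div_right hx
    have hnF : n < 2 ^ P.F := hn2.trans_le (Nat.pow_le_pow_right (by norm_num) hlF)
    refine ⟨by omega, ?_⟩
    rcases le_total w (2 * n.size) with hc | hc
    · have hFe : P.F = w := min_eq_left hc
      have := Nat.mod_lt x (show 0 < w by omega)
      rw [hFe]
      omega
    · have hFe : P.F = 2 * n.size := min_eq_right hc
      have e1 : x % w ≤ x := Nat.mod_le _ _
      rw [hFe, Nat.mul_comm, pow_mul]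
      have e2 : n * n.size < 2 ^ n.size * 2 ^ n.size :=
        Nat.mul_lt_mul_of_lt_of_le hn2 Nat.lt_two_pow_self.le (by positivity)
      have e3 : (2 ^ n.size) ^ 2 = 2 ^ n.size * 2 ^ n.size := sq _
      omega
  · exact hn2.trans_le (Nat.pow_le_pow_right (by norm_num) hlF)
  · intro u
    refine lt_of_le_of_lt (P.length_body_le h.b_pos h.s_pos hl2 hgF h.log2_le u) ?_
    have hβ : P.β ≤ n.size := by change R.size ≤ _; omega
    calc 7 * P.S * P.F + P.S * P.β ≤ 7 * n.size ^ 4 * (2 * n.size) + n.size ^ 4 * n.size := by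
          gcongr
      _ = 15 * n.size ^ 5 := by ring
      _ < 2 ^ P.g := by
          have : 0 < n.size ^ 5 := by positivity
          omega

end Choice

/-! ### Estimates in terms of the text length -/

/-- The size of the data structure apart from terms of order `n / log n`: the short fields and the
codewords. -/
theorem Adm.length_le_real {n w b s R : ℕ} {Φ cd : ℕ → ℕ} {blk : ℕ → ℕ → ℕ} {X : ℕ → ℕ}
    (h : Adm n b s R Φ cd blk X) (hB : Big n) :
    ((mkPar n w b s R Φ cd blk).data.length : ℝ) ≤
      13 * (n / n.size) + 10 * (n * (7 * n.size.size + 8 : ℕ) / s) +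
        3 * (n * (7 * n.size.size + 8 : ℕ) / b) +
        ∑ J ∈ Finset.range (n / b), (Nat.log2 (cd J) : ℝ) := by
  have k1 := h.dirEnd_le (w := w) hB
  have k2 := h.bigSupers_le (w := w)
  have k3 := h.rest_le hB
  have k4 := h.m_mul_le (w := w) hB
  have h800 := hB.size_pos
  have hl2 : 0 < n.size ^ 2 := by positivity
  set P := mkPar n w b s R Φ cd blk with hP
  have hlen := P.length_data_le h.b_pos h.s_pos hl2 h.log2_le
  have hNF := (P.NF_le_S h.b_pos h.s_pos hl2).1
  have hKL := P.sum_numLarge_mul_le h.mono h.Φ_le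
  set l := n.size with hl
  have hl0 : (0 : ℝ) < l := by exact_mod_cast (by omega : 0 < l)
  have hb0 : (0 : ℝ) < b := by exact_mod_cast h.b_pos
  have hs0 : (0 : ℝ) < s := by exact_mod_cast h.s_pos
  have a1 : (P.dirEnd : ℝ) ≤ 11 * (n / l) := by
    rw [← mul_div_assoc, le_div_iff₀ hl0]; exact_mod_cast k1
  have a2 : ((P.bigSupers.card * (7 * P.S * P.F) : ℕ) : ℝ) ≤ n / l := by
    rw [le_div_iff₀ hl0]
    have : P.bigSupers.card * (7 * P.S * P.F) * l ≤ n :=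
      (Nat.mul_le_mul_left _ (Nat.le_self_pow (by norm_num) l)).trans k2
    exact_mod_cast this
  have a3 : ((P.s * P.M * P.β : ℕ) : ℝ) ≤ n / l := by
    rw [le_div_iff₀ hl0]
    exact_mod_cast k3
  have hg0 : (0 : ℝ) ≤ P.g := Nat.cast_nonneg _
  have a4 : ((P.m * P.NF * P.g : ℕ) : ℝ) ≤ 10 * (n * P.g / s) + 2 * (n * P.g / b) := by
    have e1 : (P.m : ℝ) * (b * P.M) ≤ 2 * n / s := by
      rw [le_div_iff₀ hs0]
      have : P.m * (b * P.M) * s ≤ 2 * n := by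
        refine le_of_eq_of_le ?_ k4
        change _ = P.m * (b * s * P.M); ring
      exact_mod_cast this
    have e2 : (P.m : ℝ) * (s * P.M) ≤ 2 * n / b := by
      rw [le_div_iff₀ hb0]
      have : P.m * (s * P.M) * b ≤ 2 * n := by
        refine le_of_eq_of_le ?_ k4
        change _ = P.m * (b * s * P.M); ring
      exact_mod_cast this
    calc ((P.m * P.NF * P.g : ℕ) : ℝ) ≤ ((P.m * (5 * (b * P.M) + s * P.M) * P.g : ℕ) : ℝ) := by
          exact_mod_cast Nat.mul_le_mul_right _ (Nat.mul_le_mul_left _ hNF)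
      _ = (5 * (P.m * (b * P.M)) + P.m * (s * P.M)) * P.g := by push_cast; ring
      _ ≤ (5 * (2 * n / s) + 2 * n / b) * P.g := by gcongr
      _ = _ := by ring
  have a5 : (((∑ u ∈ Finset.range P.m, P.numLarge u) * (P.s * P.g) : ℕ) : ℝ) ≤ n * P.g / b := by
    rw [le_div_iff₀ hb0]
    have : (∑ u ∈ Finset.range P.m, P.numLarge u) * (P.s * P.g) * P.b ≤ P.n * P.g := by
      calc _ = (∑ u ∈ Finset.range P.m, P.numLarge u) * (P.s * P.b) * P.g := by ring
        _ ≤ _ := Nat.mul_le_mul_right _ hKL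
    exact_mod_cast this
  have hlen' : (P.data.length : ℝ) ≤ P.dirEnd + ((P.m * P.NF * P.g : ℕ) : ℝ) +
      ((P.bigSupers.card * (7 * P.S * P.F) : ℕ) : ℝ) +
      (((∑ u ∈ Finset.range P.m, P.numLarge u) * (P.s * P.g) : ℕ) : ℝ) +
      ((∑ J ∈ Finset.range (n / b), Nat.log2 (cd J) : ℕ) + ((P.s * P.M * P.β : ℕ) : ℝ)) := by
    exact_mod_cast hlen
  have hcast : ((∑ J ∈ Finset.range (n / b), Nat.log2 (cd J) : ℕ) : ℝ) =
      ∑ J ∈ Finset.range (n / b), (Nat.log2 (cd J) : ℝ) := by push_cast; rfl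
  rw [hcast] at hlen'
  change (P.data.length : ℝ) ≤ 13 * (n / l) + 10 * (n * (P.g : ℕ) / s) + 3 * (n * (P.g : ℕ) / b) + _
  linarith

theorem size_le_logb {n : ℕ} (hn : 0 < n) :
    Real.logb 2 n ≤ n.size ∧ (n.size : ℝ) ≤ Real.logb 2 n + 1 := by
  have hn' : (0 : ℝ) < n := by exact_mod_cast hn
  constructor
  · rw [Real.logb_le_iff_le_rpow (by norm_num) hn', Real.rpow_natCast]
    exact_mod_cast (Nat.lt_size_self n).le
  · have h1 : 0 < n.size := Nat.size_pos.mpr hn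
    have h2 : 2 ^ (n.size - 1) ≤ n := Nat.lt_size.mp (by omega)
    have h3 : ((n.size - 1 : ℕ) : ℝ) ≤ Real.logb 2 n := by
      rw [Real.le_logb_iff_rpow_le (by norm_num) hn', Real.rpow_natCast]
      exact_mod_cast h2
    rw [Nat.cast_sub h1] at h3
    push_cast at h3
    linarith

open Filter in
theorem eventually_big (δ : ℝ) (hδ : 0 < δ) : ∃ n₀ : ℕ, ∀ n, n₀ ≤ n → Big n ∧
    1 ≤ Real.logb 2 (Real.logb 2 n) ∧
    Real.logb 2 (Real.logb 2 n) ^ 2 ≤ Real.logb 2 n ^ δ := by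
  have hx : Tendsto (fun n : ℕ => Real.logb 2 n) atTop atTop :=
    (Real.tendsto_logb_atTop (by norm_num)).comp tendsto_natCast_atTop_atTop
  have h1 : ∀ᶠ x : ℝ in atTop, 1 ≤ Real.logb 2 x :=
    (Real.tendsto_logb_atTop (by norm_num)).eventually_ge_atTop 1
  have h2 : ∀ᶠ x : ℝ in atTop, Real.logb 2 x ^ 2 ≤ x ^ δ := by
    have hlog2 : 0 < Real.log 2 := Real.log_pos (by norm_num)
    filter_upwards [(isLittleO_log_rpow_atTop (half_pos hδ)).bound hlog2, h1,
      eventually_gt_atTop 0] with x hx1 hx2 hx0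
    have h3 : Real.logb 2 x ≤ x ^ (δ / 2) := by
      rw [Real.logb, div_le_iff₀ hlog2, mul_comm]
      refine (le_abs_self _).trans (hx1.trans ?_)
      rw [Real.norm_of_nonneg (by positivity)]
    calc Real.logb 2 x ^ 2 ≤ (x ^ (δ / 2)) ^ 2 := by gcongr
      _ = x ^ δ := by rw [← Real.rpow_natCast, ← Real.rpow_mul hx0.le]; congr 1; push_cast; ring
  have hsize : Tendsto Nat.size atTop atTop := by
    refine tendsto_atTop.mpr fun k => ?_
    filter_upwards [eventually_ge_atTop (2 ^ k)] with n hn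
    exact (Nat.lt_size.mpr hn).le
  have h3 : ∀ᶠ m : ℕ in atTop, 10 ^ 4 * m ^ 12 * 2 ≤ 2 ^ m := by
    have := (tendsto_pow_const_div_const_pow_of_one_lt 12
      (by norm_num : (1 : ℝ) < 2)).eventually_le_const (by norm_num : (0 : ℝ) < 1 / 20000)
    filter_upwards [this] with m hm
    rw [div_le_iff₀ (by positivity)] at hm
    have : (10 : ℝ) ^ 4 * m ^ 12 * 2 ≤ 2 ^ m := by linarith
    exact_mod_cast this
  have h4 : ∀ᶠ m : ℕ in atTop, 100 * (7 * m + 8) * 2 ≤ 2 ^ m := by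
    filter_upwards [eventually_ge_atTop 16] with m hm
    induction m, hm using Nat.le_induction with
    | base => norm_num
    | succ k hk ih =>
      rw [pow_succ]
      generalize 2 ^ k = q at ih ⊢
      linarith
  obtain ⟨n₀, hn₀⟩ := eventually_atTop.mp ((hx.eventually (h1.and h2)).and
    ((hsize.eventually h3).and (((hsize.comp hsize).eventually h4).and (eventually_gt_atTop 0))))
  refine ⟨n₀, fun n hn => ?_⟩
  obtain ⟨⟨e1, e2⟩, e3, e4, hn0⟩ := hn₀ n hn
  have key : ∀ {m : ℕ}, 0 < m → 2 ^ m.size ≤ 2 * m := fun h => two_pow_size_le h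
  refine ⟨⟨?_, ?_⟩, e1, e2⟩
  · have := key (Nat.size_pos.mpr hn0)
    simp only [Function.comp_apply] at e4
    generalize 2 ^ n.size.size = q at e4 this
    linarith
  · have := key hn0
    generalize 2 ^ n.size = q at e3 this
    linarith

/-- For every long enough text there is a bit string of the required length with which the query
program works. -/
theorem exists_data (δ : ℝ) (hδ : 0 < δ) (hδ1 : δ ≤ 1) {n σ : ℕ} (T : Fin n → Fin σ) (w : ℕ)
    (hB : Big n) (hy : 1 ≤ Real.logb 2 (Real.logb 2 n))
    (hyx : Real.logb 2 (Real.logb 2 n) ^ 2 ≤ Real.logb 2 n ^ δ) (hσ : 2 ≤ σ) (hw : n < 2 ^ w) :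
    ∃ D : List Bool, (∀ k : ℕ, (D.length : ℝ) ≤ n * entropy T k +
        (12 * Par.timeConst + 2000 : ℕ) * (n * (k * Real.logb 2 σ + Real.logb 2 (Real.logb 2 n)) /
          Real.logb σ n + n / Real.logb 2 (Real.logb 2 n))) ∧
      ∀ (i : Fin n) (tA : ℕ), ∃ t : ℕ, Answers query w T D tA i (lcpArray T i) t ∧
        (t : ℝ) ≤ (12 * Par.timeConst + 2000 : ℕ) * (tA + Real.logb 2 n ^ δ) := by
  have h800 := hB.size_pos
  have hn0 : 0 < n := by
    by_contra hc
    have : n = 0 := by omega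
    subst this; simp at h800
  have hn1 : (1 : ℝ) < n := by
    have : 1 < n := by
      have := hB.pow_size_le
      have h2 : 0 < n.size ^ 12 := by positivity
      omega
    exact_mod_cast this
  obtain ⟨hx1, hx2⟩ := size_le_logb hn0
  set x := Real.logb 2 n with hx
  set y := Real.logb 2 x with hydef
  have hx799 : 799 ≤ x := by
    have : (800 : ℝ) ≤ n.size := by exact_mod_cast h800
    linarith
  have hxδ : x ^ δ ≤ x := by
    calc x ^ δ ≤ x ^ (1 : ℝ) := Real.rpow_le_rpow_of_exponent_le (by linarith) hδ1
      _ = x := Real.rpow_one x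
  have hxδ1 : 1 ≤ x ^ δ := Real.one_le_rpow (by linarith) hδ.le
  have hyx' : y ≤ x := by nlinarith
  set lam := Real.logb σ n with hlam
  have hσ1 : (1 : ℝ) < σ := by exact_mod_cast hσ
  have hlam0 : 0 < lam := Real.logb_pos hσ1 hn1
  have hσ2 : 0 ≤ Real.logb 2 σ := Real.logb_nonneg (by norm_num) hσ1.le
  -- the width of the short fields is `O(log log n)`
  have hg : ((7 * n.size.size + 8 : ℕ) : ℝ) ≤ 29 * y := by
    have h1 := (size_le_logb (n := n.size) (by omega)).2
    have h2 : Real.logb 2 n.size ≤ y + 1 := by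
      calc Real.logb 2 n.size ≤ Real.logb 2 (x * 2) :=
            Real.logb_le_logb_of_le (by norm_num) (by exact_mod_cast (by omega : 0 < n.size))
              (by linarith)
        _ = y + 1 := by
            rw [Real.logb_mul (by linarith) (by norm_num), Real.logb_self_eq_one (by norm_num)]
    push_cast
    linarith
  have hny : (n : ℝ) / n.size ≤ n / y :=
    div_le_div_of_nonneg_left (by positivity) (by linarith) (hyx'.trans hx1)
  have hnypos : 0 ≤ (n : ℝ) / y := by positivity
  -- `12` bounds `(4 * s + 4) / log ^ δ n`, and `2000` is more than the sum of the constants in the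
  -- estimates of the space
  set C : ℕ := 12 * Par.timeConst + 2000 with hC
  -- it suffices to have the contents of the data structure
  have main : ∀ {b s R : ℕ} {cd : ℕ → ℕ} {blk : ℕ → ℕ → ℕ} {X : ℕ → ℕ},
      Adm n b s R (phi T) cd blk X → (1 < s * b → ∀ p < n, X p = text T p) →
      (s : ℝ) ≤ 2 * x ^ δ →
      (∀ k : ℕ, 10 * (n * (7 * n.size.size + 8 : ℕ) / (s : ℝ)) +
        3 * (n * (7 * n.size.size + 8 : ℕ) / (b : ℝ)) +
        ∑ J ∈ Finset.range (n / b), (Nat.log2 (cd J) : ℝ) ≤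
          n * entropy T k + 1900 * (n * (k * Real.logb 2 σ + y) / lam + n / y)) →
      ∃ D : List Bool, (∀ k : ℕ, (D.length : ℝ) ≤ n * entropy T k +
        C * (n * (k * Real.logb 2 σ + y) / lam + n / y)) ∧
      ∀ (i : Fin n) (tA : ℕ), ∃ t : ℕ, Answers query w T D tA i (lcpArray T i) t ∧
        (t : ℝ) ≤ C * (tA + x ^ δ) := by
    intro b s R cd blk X hA hX hs hsp
    refine ⟨(mkPar n w b s R (phi T) cd blk).data, fun k => ?_, fun i tA => ?_⟩
    · have h1 := hA.length_le_real (w := w) hB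
      have h2 := hsp k
      have h3 : 0 ≤ n * (k * Real.logb 2 σ + y) / lam := by positivity
      have h4 : (2000 : ℝ) ≤ C := by exact_mod_cast (by omega : 2000 ≤ C)
      have h5 : 2000 * (n * (k * Real.logb 2 σ + y) / lam + n / y) ≤
          C * (n * (k * Real.logb 2 σ + y) / lam + n / y) :=
        mul_le_mul_of_nonneg_right h4 (add_nonneg h3 hnypos)
      linarith
    · obtain ⟨t, ht1, ht2⟩ := (hA.ok hB hw).answers (T := T) rfl hX i tA
      refine ⟨t, ht1, ?_⟩
      have h1 : (t : ℝ) ≤ Par.timeConst * (4 * s + 4) + 2 * tA := by exact_mod_cast ht2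
      have h2 : (Par.timeConst : ℝ) * (4 * s + 4) ≤ Par.timeConst * (12 * x ^ δ) := by
        gcongr; linarith
      have h3 : (0 : ℝ) ≤ Par.timeConst := Nat.cast_nonneg _
      have h4 : (0 : ℝ) ≤ tA := Nat.cast_nonneg _
      have h5 : (C : ℝ) = 12 * Par.timeConst + 2000 := by rw [hC]; push_cast; ring
      rw [h5]
      nlinarith [mul_nonneg h3 h4]
  have hng : ∀ c : ℝ, 0 ≤ c → n * ((7 * n.size.size + 8 : ℕ) : ℝ) * c ≤ n * (29 * y) * c :=
    fun c hc => by gcongr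
  by_cases hlarge : σ ^ 4 ≤ n
  · -- blocks of `b = ⌊log_σ n / 4⌋` symbols, and a sample of `Φ` every `log^δ n` positions
    set b := Nat.log σ n / 4 with hb
    have hlog4 : 4 ≤ Nat.log σ n := Nat.le_log_of_pow_le hσ hlarge
    have hb1 : 1 ≤ b := by omega
    obtain ⟨cd, blk, c1, c2, c3, c4⟩ := exists_code T (by omega) b
    set s := ⌈x ^ δ⌉₊ with hs
    have hs1 : x ^ δ ≤ s := Nat.le_ceil _
    have hs2 : (s : ℝ) < x ^ δ + 1 := Nat.ceil_lt_add_one (by linarith)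
    have hs0 : (0 : ℝ) < s := by linarith
    have hσb : σ ^ b ≤ n :=
      (Nat.pow_le_pow_right (by omega) (by omega)).trans (Nat.pow_log_le_self σ hn0.ne')
    have hlam8 : lam ≤ 8 * b := by
      have h1 : lam < Nat.log σ n + 1 := by
        rw [hlam, Real.logb_lt_iff_lt_rpow hσ1 (by linarith)]
        have h2 := Nat.lt_pow_succ_log_self (by omega : 1 < σ) n
        have h3 : ((Nat.log σ n : ℝ) + 1) = ((Nat.log σ n).succ : ℕ) := by push_cast; ring
        rw [h3, Real.rpow_natCast]
        exact_mod_cast h2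
      have h2 : ((Nat.log σ n + 1 : ℕ) : ℝ) ≤ (8 * b : ℕ) := by
        exact_mod_cast (by omega : Nat.log σ n + 1 ≤ 8 * b)
      push_cast at h2
      linarith
    have hb0 : (0 : ℝ) < b := by exact_mod_cast hb1
    have hbl : 1 / (b : ℝ) ≤ 8 / lam := by
      rw [div_le_div_iff₀ hb0 hlam0]; linarith
    have hA : Adm n b s (σ ^ b) (phi T) cd blk (text T) := by
      refine ⟨hb1, by exact_mod_cast hs0, ?_, ?_, by positivity, ?_, c1, c2, c3, phi_mono T,
        phi_le T⟩
      · exact (Nat.lt_size.mpr ((Nat.pow_le_pow_left hσ b).trans hσb)).le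
      · rw [hs]
        exact Nat.ceil_le.mpr (hxδ.trans hx1)
      · rw [← pow_mul]
        exact (Nat.pow_le_pow_right (by omega) (by omega)).trans (Nat.pow_log_le_self σ hn0.ne')
    refine main hA (fun _ p _ => rfl) (by linarith) fun k => ?_
    have e1 : n * ((7 * n.size.size + 8 : ℕ) : ℝ) / s ≤ 29 * (n / y) := by
      calc n * ((7 * n.size.size + 8 : ℕ) : ℝ) / s ≤ n * (29 * y) / y ^ 2 := by
            gcongr; linarith
        _ = 29 * (n / y) := by
            have : y ≠ 0 := by linarith
            field_simp
    have e2 : n * ((7 * n.size.size + 8 : ℕ) : ℝ) / b ≤ 232 * (n * y / lam) := by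
      calc n * ((7 * n.size.size + 8 : ℕ) : ℝ) / b
          = n * ((7 * n.size.size + 8 : ℕ) : ℝ) * (1 / b) := by ring
        _ ≤ n * (29 * y) * (1 / b) := hng _ (by positivity)
        _ ≤ n * (29 * y) * (8 / lam) := by gcongr
        _ = 232 * (n * y / lam) := by ring
    have e3 : ((n / b : ℕ) : ℝ) * (k * Real.logb 2 σ) ≤ 8 * (n * (k * Real.logb 2 σ) / lam) := by
      calc ((n / b : ℕ) : ℝ) * (k * Real.logb 2 σ) ≤ (n / b) * (k * Real.logb 2 σ) := by
            gcongr; exact Nat.cast_div_le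
        _ = n * (1 / b) * (k * Real.logb 2 σ) := by ring
        _ ≤ n * (8 / lam) * (k * Real.logb 2 σ) := by gcongr
        _ = _ := by ring
    have e4 := c4 k
    have e5 : n * (k * Real.logb 2 σ + y) / lam = n * (k * Real.logb 2 σ) / lam + n * y / lam := by
      ring
    have e6 : 0 ≤ n * (k * Real.logb 2 σ) / lam := by positivity
    have e7 : 0 ≤ n * y / lam := by positivity
    rw [e5]
    linarith
  · -- for a large alphabet all values of `Φ` may be stored with `O(log log n)` bits each
    have hlam4 : lam ≤ 4 := by
      rw [hlam, Real.logb_le_iff_le_rpow hσ1 (by linarith)]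
      have : n ≤ σ ^ 4 := by omega
      exact_mod_cast this
    have hA : Adm n 1 1 1 (phi T) (fun _ => 1) (fun _ _ => 0) (fun _ => 0) :=
      ⟨one_pos, one_pos, by omega, by omega, one_pos, by omega, fun _ => one_pos, fun _ => le_rfl,
        fun _ _ _ => rfl, phi_mono T, phi_le T⟩
    refine main hA (fun h => absurd h (by norm_num)) (by push_cast; linarith) fun k => ?_
    have e0 : Nat.log2 1 = 0 := by decide
    have e1 := entropy_nonneg T k
    have e2 : n * ((7 * n.size.size + 8 : ℕ) : ℝ) ≤ 116 * (n * y / lam) := by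
      calc n * ((7 * n.size.size + 8 : ℕ) : ℝ) = n * ((7 * n.size.size + 8 : ℕ) : ℝ) * 1 := by ring
        _ ≤ n * (29 * y) * 1 := hng 1 zero_le_one
        _ ≤ n * (29 * y) * (4 / lam) := by
            gcongr; rwa [le_div_iff₀ hlam0, one_mul]
        _ = _ := by ring
    have e5 : n * (k * Real.logb 2 σ + y) / lam = n * (k * Real.logb 2 σ) / lam + n * y / lam := by
      ring
    have e6 : 0 ≤ n * (k * Real.logb 2 σ) / lam := by positivity
    have e7 : 0 ≤ n * y / lam := by positivity
    have e8 : 0 ≤ n * entropy T k := by positivity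
    rw [e5]
    simp only [e0, Nat.cast_zero, Finset.sum_const_zero, Nat.cast_one, div_one]
    linarith

end WeeLCP

theorem mainTheorem2 (δ : ℝ) (hδ_pos : 0 < δ) (hδ_le : δ ≤ 1) :
    ∃ (P : WeeLCP.Program)
      (enc : (w : ℕ) → {n σ : ℕ} → (Fin n → Fin σ) → List Bool)
      (C : ℝ) (n₀ : ℕ),
      ∀ (n σ : ℕ) (T : Fin n → Fin σ) (w : ℕ), n₀ ≤ n → 2 ≤ σ → n < 2 ^ w →
        (∀ k : ℕ,
          ((enc w T).length : ℝ) ≤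
            n * WeeLCP.entropy T k +
              C * (n * (k * Real.logb 2 σ + Real.logb 2 (Real.logb 2 n)) / Real.logb σ n +
                n / Real.logb 2 (Real.logb 2 n))) ∧
        (∀ (i : Fin n) (tA : ℕ), ∃ t : ℕ,
          WeeLCP.Answers P w T (enc w T) tA i (WeeLCP.lcpArray T i) t ∧
            (t : ℝ) ≤ C * (tA + Real.logb 2 n ^ δ)) := by
  classical
  obtain ⟨n₀, hn₀⟩ := WeeLCP.eventually_big δ hδ_pos
  have key : ∀ (w n σ : ℕ) (T : Fin n → Fin σ), n₀ ≤ n ∧ 2 ≤ σ ∧ n < 2 ^ w → _ :=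
    fun w n σ T h => WeeLCP.exists_data δ hδ_pos hδ_le T w (hn₀ n h.1).1 (hn₀ n h.1).2.1
      (hn₀ n h.1).2.2 h.2.1 h.2.2
  refine ⟨WeeLCP.query, fun w {n σ} T => if h : n₀ ≤ n ∧ 2 ≤ σ ∧ n < 2 ^ w then
    (key w n σ T h).choose else [], (12 * WeeLCP.Par.timeConst + 2000 : ℕ), n₀,
    fun n σ T w h1 h2 h3 => ?_⟩
  have h : n₀ ≤ n ∧ 2 ≤ σ ∧ n < 2 ^ w := ⟨h1, h2, h3⟩
  simp only [dif_pos h]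
  exact (key w n σ T h).choose_spec
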